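/- **Setting.** Let $k$ be a field and $\Lambda=\{\sum_i a_iT^{E_i} : a_i\in k,\ E_i\in\mathbb R,\ E_i\to\infty\}$ the Novikov field, with norm $\|\sum_i a_iT^{E_i}\|=\exp(-\min\{E_i : a_i\neq 0\})$ and $\|0\|=0$; tensor products and direct sums over $\Lambda$ are completed. Gradings take values in $\mathbb Z/N\mathbb Z$ for a non-negative even integer $N$. Let $G\subset\mathbb R_{\ge 0}$ be an additive submonoid such that $\{x\in G: x\le E\}$ is finite for every $E\in\mathbb R$. An *$A_\infty$ algebra* $(C,\mathfrak m)$ is a graded complete normed $\Lambda$-vector space $C$ with multilinear maps $\mathfrak m_n:C^{\otimes n}\to C$, $n\ge 0$, of degree $2-n$, with $\|\mathfrak m_n\|\le 1$ and $\|\mathfrak m_0\|<1$, such that for all homogeneous $\alpha_1,\dots,\alpha_n$ $$\sum_{\substack{n_1+n_2=n+1\\ 1\le i\le n_1}}(-1)^{\sum_{j<i}(|\alpha_j|+1)}\,\mathfrak m_{n_1}(\alpha_1,\dots,\alpha_{i-1},\mathfrak m_{n_2}(\alpha_i,\dots,\alpha_{i+n_2-1}),\alpha_{i+n_2},\dots,\alpha_n)=0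 .$$ An *$A_\infty$ homomorphism* $\mathfrak f:(C,\mathfrak m^C)\to(D,\mathfrak m^D)$ consists of multilinear maps $\mathfrak f_n:C^{\otimes n}\to D$, $n\ge 0$, of degree $1-n$, with $\|\mathfrak f_n\|\le 1$ and $\|\mathfrak f_0\|<1$, such that for all homogeneous $\alpha_1,\dots,\alpha_n$ $$\sum_{\substack{l\ge 0\\ r_1+\cdots+r_l=n}}\mathfrak m^D_l(\mathfrak f_{r_1}(\alpha_1,\dots,\alpha_{r_1}),\dots,\mathfrak f_{r_l}(\alpha_{n-r_l+1},\dots,\alpha_n))=\sum_{\substack{n_1+n_2=n+1\\ 1\le i\le n_1}}(-1)^{\sum_{j<i}(|\alpha_j|+1)}\,\mathfrak f_{n_1}(\alpha_1,\dots,\alpha_{i-1},\mathfrak m^C_{n_2}(\alpha_i,\dots,\alpha_{i+n_2-1}),\alpha_{i+n_2},\dots,\alpha_n).$$ A *$k$-structure* on $C$ is an isometric graded isomorphism $C\simeq\overline C\otimes\Lambda$, where $\overline C$ is a graded $k$-vector space with the trivial norm. An $A_\infty$ algebra with a $k$-structure is *$G$-gapped* if $\mathfrak m_n=\sum_{\beta\in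 G}T^\beta\,\mathfrak m_{n,\beta}\otimes\mathrm{Id}_\Lambda$ for multilinear maps $\mathfrak m_{n,\beta}:\overline C^{\otimes n}\to\overline C$; a homomorphism is *$G$-gapped* if similarly $\mathfrak f_n=\sum_{\beta\in G}T^\beta\,\mathfrak f_{n,\beta}\otimes\mathrm{Id}_\Lambda$. A $G$-gapped $A_\infty$ algebra is *weakly minimal* if $\mathfrak m_{1,0}=0$. Its *underlying algebra* is $A_C=H^*(\overline C,\mathfrak m_{1,0})$ with product $[\alpha_1]\circ[\alpha_2]=(-1)^{|\alpha_1|}[\mathfrak m_{2,0}(\alpha_1,\alpha_2)]$. A *quasi-isomorphism* is a $G$-gapped $A_\infty$ homomorphism $\mathfrak f$ such that $\mathfrak f_{1,0}$ induces an isomorphism $H^*(\overline C,\mathfrak m^C_{1,0})\to H^*(\overline D,\mathfrak m^D_{1,0})$. Two $G$-gapped $A_\infty$ algebras are *quasi-isomorphic* if there are quasi-isomorphisms between them in both directions. Let $c=\bar c\otimes\mathrm{Id}_\Lambda:C\to C$ be a $k$-structured involution (linear, of degree $0$, $c^2=\mathrm{Id}$). Then $\mathfrak m$ is *$c$ self-dual*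 if, for all $n\ge 0$ and all homogeneous $\alpha_1,\dots,\alpha_n$, $$\mathfrak m_n(c\,\alpha_1,\dots,c\,\alpha_n)=(-1)^{\sum_{i<j}(|\alpha_i|+1)(|\alpha_j|+1)+n+1}\,c\,\mathfrak m_n(\alpha_n,\dots,\alpha_1).$$ A $G$-gapped $A_\infty$ algebra $(C,\mathfrak m)$ with such an involution $c$ is *anti-symmetric* if $\mathfrak m$ is $c$ self-dual, and there are a graded $k$-vector space $V$ concentrated in odd degree and a graded algebra isomorphism from $A_C$ to the free graded commutative algebra $\Lambda V$ under which the map induced by $\bar c$ on $A_C$ becomes the algebra map of $\Lambda V$ induced by $-\mathrm{Id}_V$. **Theorem.** Assume $\operatorname{char}k\neq 2$. Let $(C,\mathfrak m)$ be a weakly minimal anti-symmetric $G$-gapped $A_\infty$ algebra with involution $c$. Put $$\mathfrak m^\infty_n=\begin{cases}\mathfrak m_{2,0}\otimes\mathrm{Id}_\Lambda, & n=2,\\ 0, & n\neq 2.\end{cases}$$ Then $(C,\mathfrak m^\infty)$ is a $G$-gapped $A_\infty$ algebra (with the same $k$-structure), and $(C,\mathfrak m)$ is quasi-isomorphic to $(C,\mathfrak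 m^\infty)$. -/

import Mathlib

open scoped Topology

noncomputable section

namespace AInf

/-! ### The Novikov field and completed scalar extension -/

/-- A set of reals is left-finite if it has finitely many elements below every bound. Left-finite
sets are the supports of the formal sums `∑ aᵢ T ^ Eᵢ` with `Eᵢ → ∞`. -/
def LeftFinite (S : Set ℝ) : Prop := ∀ E : ℝ, (S ∩ Set.Iic E).Finite

theorem LeftFinite.mono {S T : Set ℝ} (hT : LeftFinite T) (h : S ⊆ T) : LeftFinite S :=
  fun E => (hT E).subset (Set.inter_subset_inter_left _ h)

theorem LeftFinite.union {S T : Set ℝ} (hS : LeftFinite S) (hT : LeftFinite T) :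
    LeftFinite (S ∪ T) := fun E => by
  rw [Set.union_inter_distrib_right]
  exact (hS E).union (hT E)

theorem LeftFinite.singleton (a : ℝ) : LeftFinite {a} :=
  fun _ => (Set.finite_singleton a).subset Set.inter_subset_left

theorem LeftFinite.exists_lower {S : Set ℝ} (hS : LeftFinite S) : ∃ a : ℝ, ∀ s ∈ S, a ≤ s := by
  obtain ⟨b, hb⟩ := (hS 0).bddBelow
  refine ⟨min b 0, fun s hs => ?_⟩
  by_cases h : s ≤ 0
  · exact (min_le_left _ _).trans (hb ⟨hs, h⟩)
  · exact (min_le_right _ _).trans (not_le.mp h).le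

theorem LeftFinite.image2_add {S T : Set ℝ} (hS : LeftFinite S) (hT : LeftFinite T) :
    LeftFinite (Set.image2 (fun a b : ℝ => a + b) S T) := by
  obtain ⟨a, ha⟩ := hS.exists_lower
  obtain ⟨b, hb⟩ := hT.exists_lower
  intro E
  refine ((hS (E - b)).image2 (fun a b : ℝ => a + b) (hT (E - a))).subset ?_
  rintro _ ⟨⟨s, hs, t, ht, rfl⟩, hE⟩
  have h1 := ha s hs
  have h2 := hb t ht
  simp only [Set.mem_Iic] at hE
  exact ⟨s, ⟨hs, by simp only [Set.mem_Iic]; linarith⟩, t,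
    ⟨ht, by simp only [Set.mem_Iic]; linarith⟩, rfl⟩

/-- The Novikov field over `k`, realised inside the field of Hahn series: formal sums
`∑ aᵢ T ^ Eᵢ` with `aᵢ ∈ k`, `Eᵢ ∈ ℝ`, `Eᵢ → ∞`. (Only its commutative ring structure is used.) -/
def novikovSubring (k : Type*) [Field k] : Subring (HahnSeries ℝ k) where
  carrier := {x | LeftFinite x.support}
  zero_mem' := by
    intro E
    simp
  one_mem' := by
    refine (LeftFinite.singleton 0).mono ?_
    rw [HahnSeries.support_one]
  add_mem' := by
    intro x y hx hy
    exact (LeftFinite.union hx hy).mono (HahnSeries.support_add_subset _ _)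
  neg_mem' := by
    intro x hx
    simpa using hx
  mul_mem' := by
    intro x y hx hy
    refine (LeftFinite.image2_add hx hy).mono ?_
    exact HahnSeries.support_mul_subset

/-- The Novikov field `Λ` over `k`. -/
abbrev Novikov (k : Type*) [Field k] : Type _ := novikovSubring k

/-- The element `T ^ β` of the Novikov field. -/
def novT (k : Type*) [Field k] (β : ℝ) : Novikov k :=
  ⟨HahnSeries.single β 1, (LeftFinite.singleton β).mono HahnSeries.support_single_subset⟩

section Extension

variable (k : Type*) [Field k] (M : Type*) [AddCommGroup M] [Module k M]

/-- The formal sums `∑ xᵢ T ^ Eᵢ` with `xᵢ ∈ M` and `Eᵢ → ∞`, as a `Λ`-module. -/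
def novExtSubmodule : Submodule (Novikov k) (HahnModule ℝ k M) where
  carrier := {x | LeftFinite ((HahnModule.of k).symm x).support}
  zero_mem' := by
    intro E
    simp
  add_mem' := by
    intro x y hx hy
    exact (LeftFinite.union hx hy).mono (HahnSeries.support_add_subset _ _)
  smul_mem' := by
    intro r x hx
    refine (LeftFinite.image2_add r.2 hx).mono ?_
    exact HahnModule.support_smul_subset_vadd_support

/-- The completed tensor product `M ⊗ Λ`, for a `k`-vector space `M` with the trivial norm:
the completion of the algebraic tensor product `M ⊗ Λ` consists of all formal sums
`∑ xᵢ T ^ Eᵢ` with `xᵢ ∈ M` and `Eᵢ → ∞`. -/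
def NovExt : Type _ := novExtSubmodule k M

namespace NovExt

instance : AddCommGroup (NovExt k M) := inferInstanceAs (AddCommGroup (novExtSubmodule k M))

instance : Module (Novikov k) (NovExt k M) :=
  inferInstanceAs (Module (Novikov k) (novExtSubmodule k M))

variable {k M}

/-- The underlying formal series. -/
def series (x : NovExt k M) : HahnSeries ℝ M := (HahnModule.of k).symm x.1

/-- The coefficient of `T ^ E`. -/
def coeff (x : NovExt k M) (E : ℝ) : M := x.series.coeff E

theorem series_zero : (0 : NovExt k M).series = 0 := rfl

theorem series_add (x y : NovExt k M) : (x + y).series = x.series + y.series := rfl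

theorem series_neg (x : NovExt k M) : (-x).series = -x.series := rfl

theorem series_eq_zero {x : NovExt k M} (h : x.series = 0) : x = 0 :=
  Subtype.ext ((HahnModule.of k).symm.injective h)

/-- The norm `‖∑ xᵢ T ^ Eᵢ‖ = exp (- min Eᵢ)` (minimum over the `i` with `xᵢ ≠ 0`), `‖0‖ = 0`. -/
def seriesNorm (x : HahnSeries ℝ M) : ℝ :=
  open Classical in if x = 0 then 0 else Real.exp (-x.order)

theorem seriesNorm_nonneg (x : HahnSeries ℝ M) : 0 ≤ seriesNorm x := by
  unfold seriesNorm
  split_ifs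
  · exact le_rfl
  · exact (Real.exp_pos _).le

theorem seriesNorm_add_le (x y : HahnSeries ℝ M) :
    seriesNorm (x + y) ≤ seriesNorm x + seriesNorm y := by
  by_cases hx : x = 0
  · rw [hx, zero_add]
    exact le_add_of_nonneg_left (seriesNorm_nonneg 0)
  by_cases hy : y = 0
  · rw [hy, add_zero]
    exact le_add_of_nonneg_right (seriesNorm_nonneg 0)
  by_cases hxy : x + y = 0
  · have h : seriesNorm (x + y) = 0 := by simp [seriesNorm, hxy]
    rw [h]
    exact add_nonneg (seriesNorm_nonneg x) (seriesNorm_nonneg y)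
  · simp only [seriesNorm, hx, hy, hxy, if_false]
    have h := HahnSeries.min_order_le_order_add hxy
    rcases min_le_iff.mp h with h | h
    · have h1 := Real.exp_le_exp.mpr (neg_le_neg h)
      have h2 := Real.exp_pos (-y.order)
      linarith
    · have h1 := Real.exp_le_exp.mpr (neg_le_neg h)
      have h2 := Real.exp_pos (-x.order)
      linarith

/-- The norm on the completed tensor product. -/
def addGroupNorm : AddGroupNorm (NovExt k M) where
  toFun x := seriesNorm x.series
  map_zero' := by simp [series_zero, seriesNorm]
  add_le' x y := by
    rw [series_add]
    exact seriesNorm_add_le _ _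
  neg' x := by
    rw [series_neg]
    by_cases h : x.series = 0
    · rw [h, neg_zero]
    · have h' : -x.series ≠ 0 := fun h0 => h (neg_eq_zero.mp h0)
      simp only [seriesNorm, h, h', if_false, HahnSeries.order_neg]
  eq_zero_of_map_eq_zero' x h := by
    by_contra hx
    have hs : x.series ≠ 0 := fun h0 => hx (series_eq_zero h0)
    simp only [seriesNorm, hs, if_false] at h
    exact (Real.exp_pos _).ne' h

instance : NormedAddCommGroup (NovExt k M) := addGroupNorm.toNormedAddCommGroup

variable (k)

/-- The element `x ⊗ 1`, for `x ∈ M`. -/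
def incl (x : M) : NovExt k M :=
  ⟨HahnModule.of k (HahnSeries.single 0 x),
    (LeftFinite.singleton 0).mono HahnSeries.support_single_subset⟩

end NovExt

end Extension

/-! ### Signs -/

section Signs

variable {N : ℕ}

/-- The sign `(-1) ^ a`, for a degree `a ∈ ℤ/N` with `N` even. -/
def degSign (a : ZMod N) : ℤ := open Classical in if Even a then 1 else -1

/-- The sum over all pairs `i < j` of `(dᵢ + 1) (dⱼ + 1)`: the sign exponent of the reversal
permutation acting on homogeneous elements of degrees `d₁, …, dₖ`. -/
def revExp : List (ZMod N) → ZMod N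
  | [] => 0
  | a :: d => (a + 1) * (d.map (· + 1)).sum + revExp d

end Signs

/-! ### A-infinity algebras and homomorphisms -/

section General

variable {k : Type*} [Field k] {N : ℕ}
  {C : Type*} [NormedAddCommGroup C] [Module (Novikov k) C]
  {D : Type*} [NormedAddCommGroup D] [Module (Novikov k) D]

/-- The value `m_n (α₁, …, αₙ)` of a sequence of multilinear maps on a list of length `n`. -/
def evalList (m : ∀ n : ℕ, MultilinearMap (Novikov k) (fun _ : Fin n => C) D) (α : List C) : D :=
  m α.length α.get

/-- `α = (α₁, …, αₙ)` is a list of homogeneous elements, of degrees `d = (d₁, …, dₙ)`. -/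
def IsHomogeneousList (gr : ZMod N → Submodule (Novikov k) C) (α : List C)
    (d : List (ZMod N)) : Prop :=
  List.Forall₂ (fun x i => x ∈ gr i) α d

/-- The sum over all ways of writing `α = u ++ v ++ w` of
`(-1) ^ (∑ over u of (|αⱼ| + 1)) • f (u, m (v), w)`. Here `u` and `v` consist of the first `p`
and of the next `q` entries of `α`, where `p + q ≤ n = α.length`; so `f` has `n - q + 1` inputs. -/
def insertSum (f : ∀ n : ℕ, MultilinearMap (Novikov k) (fun _ : Fin n => C) D)
    (m : ∀ n : ℕ, MultilinearMap (Novikov k) (fun _ : Fin n => C) C)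
    (α : List C) (d : List (ZMod N)) : D :=
  ∑ p ∈ Finset.range (α.length + 1), ∑ q ∈ Finset.range (α.length + 1 - p),
    degSign ((d.take p).map (· + 1)).sum •
      evalList f (α.take p ++ evalList m ((α.drop p).take q) :: α.drop (p + q))

/-- An `A_∞` structure on a `ℤ/N`-graded complete normed `Λ`-vector space `C`. -/
structure AInfty (gr : ZMod N → Submodule (Novikov k) C) where
  m : ∀ n : ℕ, MultilinearMap (Novikov k) (fun _ : Fin n => C) C
  degree : ∀ (α : List C) (d : List (ZMod N)), IsHomogeneousList gr α d →
    evalList m α ∈ gr (d.sum + 2 - (α.length : ZMod N))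
  norm_le : ∀ (n : ℕ) (α : Fin n → C), ‖m n α‖ ≤ ∏ i, ‖α i‖
  norm_zero_lt : ‖evalList m []‖ < 1
  relation : ∀ (α : List C) (d : List (ZMod N)), IsHomogeneousList gr α d →
    insertSum m m α d = 0

/-- An `A_∞` pre-homomorphism `C → D`. -/
structure PreHom (grC : ZMod N → Submodule (Novikov k) C)
    (grD : ZMod N → Submodule (Novikov k) D) where
  f : ∀ n : ℕ, MultilinearMap (Novikov k) (fun _ : Fin n => C) D
  degree : ∀ (α : List C) (d : List (ZMod N)), IsHomogeneousList grC α d →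
    evalList f α ∈ grD (d.sum + 1 - (α.length : ZMod N))
  norm_le : ∀ (n : ℕ) (α : Fin n → C), ‖f n α‖ ≤ ∏ i, ‖α i‖
  norm_zero_lt : ‖evalList f []‖ < 1

/-- A pre-homomorphism is an `A_∞` homomorphism if
`∑ m_l (f (block₁), …, f (block_l)) = ∑ ± f (…, m (…), …)`.
On the left, `r = (r₁, …, r_l)` runs over the finite sequences (of any length `l ≥ 0`) of
natural numbers with sum `n`, and `α` is cut into consecutive blocks of lengths `r₁, …, r_l`.
Since the `rⱼ` may vanish, this sum can be infinite; it converges in norm. -/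
def PreHom.IsHom {grC : ZMod N → Submodule (Novikov k) C}
    {grD : ZMod N → Submodule (Novikov k) D} (φ : PreHom grC grD)
    (A : AInfty grC) (B : AInfty grD) : Prop :=
  ∀ (α : List C) (d : List (ZMod N)), IsHomogeneousList grC α d →
    HasSum
      (fun r : {r : List ℕ // r.sum = α.length} =>
        evalList B.m ((r.1.splitLengths α).map (evalList φ.f)))
      (insertSum φ.f A.m α d)

/-- The opposite operation `m^op` on a list `α` of homogeneous elements of degrees `d`. -/
def AInfty.opEval {gr : ZMod N → Submodule (Novikov k) C} (A : AInfty gr)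
    (α : List C) (d : List (ZMod N)) : C :=
  degSign (revExp d + (α.length : ZMod N) + 1) • evalList A.m α.reverse

/-- `A` is self-dual with respect to `c`: the strict map `c : (C, m^op) → (C, m)` is an `A_∞`
homomorphism. (For a strict map, the only term on the left of the homomorphism equation is the
one with all blocks of length one, and the only one on the right is `c (m^op (α))`.) -/
def AInfty.IsSelfDual {gr : ZMod N → Submodule (Novikov k) C} (A : AInfty gr)
    (c : C →ₗ[Novikov k] C) : Prop :=
  ∀ (α : List C) (d : List (ZMod N)), IsHomogeneousList gr α d →
    evalList A.m (α.map c) = c (A.opEval α d)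

end General

/-! ### `k`-structures and gapping -/

section Gapped

variable {k : Type*} [Field k] {N : ℕ}
  {C : Type*} [NormedAddCommGroup C] [Module (Novikov k) C]
  {Cbar : Type*} [AddCommGroup Cbar] [Module k Cbar]
  {D : Type*} [NormedAddCommGroup D] [Module (Novikov k) D]
  {Dbar : Type*} [AddCommGroup Dbar] [Module k Dbar]

/-- A `k`-structure on `C`: an isometric isomorphism of graded `Λ`-modules from `C` to the completed
tensor product `Cbar ⊗ Λ`, where `Cbar` is a graded `k`-vector space with the trivial norm. It makes
`C` a complete normed `Λ`-vector space, the completed direct sum of its graded pieces. -/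
structure KStructure (gr : ZMod N → Submodule (Novikov k) C)
    (grbar : ZMod N → Submodule k Cbar) where
  isInternal : DirectSum.IsInternal grbar
  equiv : C ≃ₗ[Novikov k] NovExt k Cbar
  norm_map : ∀ x : C, ‖equiv x‖ = ‖x‖
  mem_gr : ∀ (i : ZMod N) (x : C), x ∈ gr i ↔ ∀ E : ℝ, (equiv x).coeff E ∈ grbar i

variable {gr : ZMod N → Submodule (Novikov k) C} {grbar : ZMod N → Submodule k Cbar}
  {grD : ZMod N → Submodule (Novikov k) D} {grDbar : ZMod N → Submodule k Dbar}

/-- The inclusion `Cbar → C`, `x ↦ x ⊗ 1`. -/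
def KStructure.incl (S : KStructure gr grbar) (x : Cbar) : C :=
  S.equiv.symm (NovExt.incl k x)

/-- A `G`-gapped `A_∞` algebra. The operations are `m_n = ∑_{β ∈ G} T ^ β m_{n,β} ⊗ Id_Λ`; as both
sides are bounded and `Λ`-multilinear, this is a statement on elements of `Cbar`. The `m_{n,β}` are
determined by the `m_n`. -/
structure GappedAInfty (S : KStructure gr grbar) (G : AddSubmonoid ℝ) extends AInfty gr where
  comp : ∀ n : ℕ, G → MultilinearMap k (fun _ : Fin n => Cbar) Cbar
  hasSum_comp : ∀ (n : ℕ) (x : Fin n → Cbar),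
    HasSum (fun β : G => novT k β • S.incl (comp n β x)) (m n (fun i => S.incl (x i)))

/-- A `G`-gapped `A_∞` pre-homomorphism. -/
structure GappedPreHom (S : KStructure gr grbar) (S' : KStructure grD grDbar)
    (G : AddSubmonoid ℝ) extends PreHom gr grD where
  comp : ∀ n : ℕ, G → MultilinearMap k (fun _ : Fin n => Cbar) Dbar
  hasSum_comp : ∀ (n : ℕ) (x : Fin n → Cbar),
    HasSum (fun β : G => novT k β • S'.incl (comp n β x)) (f n (fun i => S.incl (x i)))

/-- A `k`-structured involution `c = cbar ⊗ Id_Λ` of `C`. -/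
structure KInvolution (S : KStructure gr grbar) where
  c : C →ₗ[Novikov k] C
  cbar : Cbar →ₗ[k] Cbar
  coeff_c : ∀ (x : C) (E : ℝ), (S.equiv (c x)).coeff E = cbar ((S.equiv x).coeff E)
  involutive : ∀ x : C, c (c x) = x
  map_gr : ∀ (i : ZMod N) (x : C), x ∈ gr i → c x ∈ gr i

/-! ### Cohomology, quasi-isomorphisms -/

/-- The cohomology `ker d / im d`, for an endomorphism `d` with `d ∘ d = 0`. -/
abbrev Coh (d : Cbar →ₗ[k] Cbar) : Type _ :=
  LinearMap.ker d ⧸ (LinearMap.range d).submoduleOf (LinearMap.ker d)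

/-- The cohomology class of a cocycle. -/
def cohClass (d : Cbar →ₗ[k] Cbar) : LinearMap.ker d →ₗ[k] Coh d :=
  Submodule.mkQ _

/-- The graded piece of degree `i` of the cohomology. -/
def cohGrading (grbar : ZMod N → Submodule k Cbar) (d : Cbar →ₗ[k] Cbar) (i : ZMod N) :
    Submodule k (Coh d) :=
  ((grbar i).submoduleOf (LinearMap.ker d)).map (cohClass d)

theorem mem_ker_of_comm {dC : Cbar →ₗ[k] Cbar} {dD : Dbar →ₗ[k] Dbar} {f : Cbar →ₗ[k] Dbar}
    (h : f ∘ₗ dC = dD ∘ₗ f) : ∀ x ∈ LinearMap.ker dC, f x ∈ LinearMap.ker dD := by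
  intro x hx
  have h1 := LinearMap.congr_fun h x
  simp only [LinearMap.comp_apply, LinearMap.mem_ker] at h1 hx ⊢
  rw [← h1, hx, map_zero]

/-- The map induced on cohomology by a map of complexes. -/
def cohMap {dC : Cbar →ₗ[k] Cbar} {dD : Dbar →ₗ[k] Dbar} (f : Cbar →ₗ[k] Dbar)
    (h : f ∘ₗ dC = dD ∘ₗ f) : Coh dC →ₗ[k] Coh dD :=
  Submodule.mapQ _ _ (f.restrict (mem_ker_of_comm h)) (by
    rintro ⟨x, hx⟩ ⟨y, hy⟩
    refine ⟨f y, ?_⟩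
    have h1 := LinearMap.congr_fun h y
    simp only [LinearMap.comp_apply] at h1
    rw [← h1, hy]
    rfl)

/-- A multilinear map in one variable, as a linear map. -/
def unary (g : MultilinearMap k (fun _ : Fin 1 => Cbar) Dbar) : Cbar →ₗ[k] Dbar :=
  (MultilinearMap.ofSubsingleton k Cbar Dbar (0 : Fin 1)).symm g

variable {S : KStructure gr grbar} {S' : KStructure grD grDbar} {G : AddSubmonoid ℝ}

/-- The differential `m_{1,0}` on `Cbar`. -/
def GappedAInfty.diff (A : GappedAInfty S G) : Cbar →ₗ[k] Cbar := unary (A.comp 1 0)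

/-- Weak minimality: `m_{1,0} = 0`. -/
def GappedAInfty.WeaklyMinimal (A : GappedAInfty S G) : Prop := A.diff = 0

/-- A `G`-gapped `A_∞` homomorphism `φ` is a quasi-isomorphism if `φ_{1,0}` induces an isomorphism
on cohomology. (That `φ_{1,0}` is a map of complexes follows from the homomorphism equation.) -/
def GappedPreHom.IsQuasiIso (φ : GappedPreHom S S' G) (A : GappedAInfty S G)
    (B : GappedAInfty S' G) : Prop :=
  φ.toPreHom.IsHom A.toAInfty B.toAInfty ∧
    ∃ h : unary (φ.comp 1 0) ∘ₗ A.diff = B.diff ∘ₗ unary (φ.comp 1 0),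
      Function.Bijective (cohMap (unary (φ.comp 1 0)) h)

/-- Two `G`-gapped `A_∞` algebras are quasi-isomorphic: there are quasi-isomorphisms between them,
in both directions. -/
def GappedAInfty.QuasiIsomorphic (A : GappedAInfty S G) (B : GappedAInfty S' G) : Prop :=
  (∃ φ : GappedPreHom S S' G, φ.IsQuasiIso A B) ∧ ∃ ψ : GappedPreHom S' S G, ψ.IsQuasiIso B A

/-! ### Anti-symmetric algebras -/

section AntiSymmetric

variable {V : Type*} [AddCommGroup V] [Module k V]

/-- `V` is a graded vector space concentrated in odd degree. -/
structure IsOddGrading (grV : ZMod N → Submodule k V) : Prop where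
  isInternal : DirectSum.IsInternal grV
  eq_bot : ∀ i : ZMod N, ¬ Odd i → grV i = ⊥

/-- The grading of `ΛV` induced by the grading of `V`: degree `i` is spanned by the products
`v₁ ⋯ vₗ` of homogeneous elements of `V` whose degrees add up to `i`. -/
def exteriorGrading (grV : ZMod N → Submodule k V) (i : ZMod N) :
    Submodule k (ExteriorAlgebra k V) :=
  Submodule.span k {x | ∃ (v : List V) (d : List (ZMod N)),
    List.Forall₂ (fun v j => v ∈ grV j) v d ∧ d.sum = i ∧
      x = (v.map (ExteriorAlgebra.ι k)).prod}

/-- `A` is anti-symmetric with respect to the involution `c`, with graded vector space `V` in odd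
degree. The free graded commutative algebra on such a `V` is (away from characteristic two, the only
case in which this definition is meant) the exterior algebra. The underlying algebra of `A` is the
cohomology of `m_{1,0}` with the product `[a] ∘ [b] = (-1) ^ |a| [m_{2,0} (a, b)]`. (`m_{2,0}` and
`cbar` send cocycles to cocycles, by the `A_∞` relations and by self-duality; this is why the
conditions below are about all cocycles `z` equal to `m_{2,0} (a, b)`, or to `cbar a`.) -/
structure GappedAInfty.IsAntiSymmetric (A : GappedAInfty S G) (c : KInvolution S)
    (grV : ZMod N → Submodule k V) : Prop where
  isOddGrading : IsOddGrading grV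
  isSelfDual : A.toAInfty.IsSelfDual c.c
  exists_equiv : ∃ Φ : ExteriorAlgebra k V ≃ₗ[k] Coh A.diff,
    (∀ i : ZMod N,
      (exteriorGrading grV i).map (Φ : ExteriorAlgebra k V →ₗ[k] Coh A.diff)
        = cohGrading grbar A.diff i) ∧
    (∀ (i : ZMod N) (a b z : LinearMap.ker A.diff), (a : Cbar) ∈ grbar i →
      (z : Cbar) = degSign i • A.comp 2 0 ![(a : Cbar), (b : Cbar)] →
      Φ.symm (cohClass A.diff z)
        = Φ.symm (cohClass A.diff a) * Φ.symm (cohClass A.diff b)) ∧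
    (∀ a z : LinearMap.ker A.diff, (z : Cbar) = c.cbar (a : Cbar) →
      Φ.symm (cohClass A.diff z)
        = ExteriorAlgebra.map (-LinearMap.id : V →ₗ[k] V) (Φ.symm (cohClass A.diff a)))

end AntiSymmetric

/-- `B` is the `A_∞` structure on `C` (with the same `k`-structure) whose only operation is
`m_2 = m_{2,0} ⊗ Id_Λ`, where `m_{2,0}` is the operation of `A`. -/
def GappedAInfty.IsFormalModel (B A : GappedAInfty S G) : Prop :=
  (∀ n : ℕ, n ≠ 2 → B.m n = 0) ∧
    ∀ x : Fin 2 → Cbar, B.m 2 (fun i => S.incl (x i)) = S.incl (A.comp 2 0 x)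

end Gapped

end AInf

end

/-! Since `m_{1,0} = 0`, the underlying algebra is `Cbar` itself: an exterior algebra on odd
generators `x_i`, on which `c` acts as `(-1)^|x|`. Comparing degrees in the self-duality equation,
and using that two is invertible, one gets `m_0 = 0`, `m_1 = 0`, and a change of sign of `m_n
(x_{i_1}, …, x_{i_n})` when its inputs are reversed (`GappedAInfty.isMinimalOps`). The formal
structure has the same properties (`IsMinimalOps.of_binary`). So it is enough to relate any two such
structures `m`, `m'` with the same leading product `μ = m_{2,0}` by a homomorphism `f` with `f_{1,0}
= id` (`exists_homomorphism`), and to use this in both directions.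

The map `f` is built by recursion on the arity `n`, then on the exponent `β ∈ G`. Because `m_0 = m_1
= 0`, the defect of the homomorphism equation in arity `n + 1` involves only `f_1, …, f_n`. Changing
`f_{n,β}` changes the coefficient of `T ^ β` in it by a Hochschild coboundary for `μ`
(`coeff_variation`). The first coefficient of the defect that can be nonzero is a Hochschild cocycle
(`wordDiff_coeff_defect`), by a Bianchi identity (`bianchi`). The obstruction therefore lies in the
Hochschild cohomology of an exterior algebra, which, as in the Hochschild-Kostant-Rosenberg theorem,
is detected by symmetrisation on the generators. Symmetrisation kills the defect: if `f` is strict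
on generators, reversing the block of inputs of `m` or `m'` shows that the sum of the defect over
all rearrangements of a word in the generators equals its own negative (`sum_defect_generatorWord`).

The cohomological input is made explicit by a Morse matching on words in the monomial basis `e_I`.
Each word is upper, lower or critical; the critical words are the weakly decreasing words in the
generators, and `lift` matches lower words with upper words that have one more entry. Along the
matching the Hochschild differential is triangular, with invertible diagonal, for the shortlex order
of letters (`wordDiff_lift`). Hence a cochain supported on lower words can be chosen to cancel the
defect on all upper words (`exists_wordDiff_eq`), and a cocycle that vanishes on upper and critical
words is zero (`eq_zero_of_wordDiff_eq_zero`). All rearrangements of a critical word other than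
itself are upper, so the vanishing of the symmetrised defect gives its vanishing on critical words.
No factorial is inverted, only two. The corrections vanish on words in the generators, which keeps
`f` strict there.

Two devices organise the signs and the sums. Multilinear operations are treated as functions of
lists, with recursive sums over decompositions. The Koszul sign `(-1)^(|x| + 1)` becomes an operator
`σ`, equal to `-c` in the application. -/

noncomputable section

set_option linter.unusedSectionVars false

namespace AInf

/-! ### Operations on functions of lists -/

section ListCalculus

variable {A C D W W' : Type*} [AddCommGroup C] [AddCommGroup D] [AddCommGroup W] [AddCommGroup W']

/-- The sum of `ψ u v` over all ways of writing a list as `u ++ v`. -/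
def splitSum : (List A → List A → W) → List A → W
  | ψ, [] => ψ [] []
  | ψ, x :: t => ψ [] (x :: t) + splitSum (fun u v => ψ (x :: u) v) t

/-- The sum of `φ (σ u ++ m v :: w)` over all ways of writing a list as `u ++ v ++ w`. -/
def insertOp (σ : C → C) (m : List C → C) : (List C → W) → List C → W
  | φ, [] => φ [m []]
  | φ, x :: t => splitSum (fun v w => φ (m v :: w)) (x :: t)
      + insertOp σ m (fun l => φ (σ x :: l)) t

/-- Auxiliary function for `blockSum`: the first block starts with a given list. -/
def blockAux (f : List C → D) : (List D → W) → List C → List C → W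
  | φ, b, [] => φ [f b]
  | φ, b, x :: t => blockAux f φ (b ++ [x]) t + blockAux f (fun l => φ (f b :: l)) [x] t

/-- The sum of `φ [f b₁, …, f bₗ]` over all ways of writing a list as the concatenation of
nonempty blocks `b₁, …, bₗ`. -/
def blockSum (f : List C → D) : (List D → W) → List C → W
  | φ, [] => φ []
  | φ, x :: t => blockAux f φ [x] t

/-- Auxiliary function for `blockSumAt`: the first block starts with a given list. -/
def blockAtAux (σ : D → D) (f X : List C → D) : (List D → W) → List C → List C → W
  | φ, b, [] => φ [X b]
  | φ, b, x :: t => blockAtAux σ f X φ (b ++ [x]) t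
      + (blockAux f (fun l => φ (X b :: l)) [x] t
        + blockAtAux σ f X (fun l => φ (σ (f b) :: l)) [x] t)

/-- The sum of `φ [σ (f b₁), …, σ (f bᵢ₋₁), X bᵢ, f bᵢ₊₁, …, f bₗ]` over all ways of writing a
list as the concatenation of nonempty blocks `b₁, …, bₗ`, and all `i`. -/
def blockSumAt (σ : D → D) (f X : List C → D) : (List D → W) → List C → W
  | _, [] => 0
  | φ, x :: t => blockAtAux σ f X φ [x] t

/-- Additivity of a map, unbundled. -/
def IsAdd (g : C → W) : Prop := ∀ x y, g (x + y) = g x + g y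

/-- Each slot of `φ` satisfies the predicate `L`. -/
def Slotwise (L : (A → W) → Prop) (φ : List A → W) : Prop :=
  ∀ u w, L (fun x => φ (u ++ x :: w))

theorem IsAdd.map_zero {g : C → W} (hg : IsAdd g) : g 0 = 0 := by
  have := hg 0 0
  simpa using this

theorem IsAdd.map_neg {g : C → W} (hg : IsAdd g) (x : C) : g (-x) = -g x := by
  have := hg x (-x)
  rw [add_neg_cancel, hg.map_zero] at this
  exact (neg_eq_of_add_eq_zero_right this.symm).symm

theorem IsAdd.map_sub {g : C → W} (hg : IsAdd g) (x y : C) : g (x - y) = g x - g y := by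
  rw [sub_eq_add_neg, hg, hg.map_neg, sub_eq_add_neg]

theorem IsAdd.add {g h : C → W} (hg : IsAdd g) (hh : IsAdd h) :
    IsAdd (fun x => g x + h x) := fun x y => by
  simp only [hg x y, hh x y]; abel

theorem IsAdd.comp {g : D → W} {h : C → D} (hg : IsAdd g) (hh : IsAdd h) :
    IsAdd (fun x => g (h x)) := fun x y => by
  simp only [hh x y, hg _ _]

theorem Slotwise.cons {L : (A → W) → Prop} {φ : List A → W} (h : Slotwise L φ) (a : A) :
    Slotwise L (fun l => φ (a :: l)) := fun u w => h (a :: u) w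

theorem Slotwise.head {L : (A → W) → Prop} {φ : List A → W} (h : Slotwise L φ) (w : List A) :
    L (fun x => φ (x :: w)) := h [] w

/-! #### Sums over splittings -/

theorem splitSum_nil (ψ : List A → List A → W) : splitSum ψ [] = ψ [] [] := rfl

theorem splitSum_cons (ψ : List A → List A → W) (x : A) (t : List A) :
    splitSum ψ (x :: t) = ψ [] (x :: t) + splitSum (fun u v => ψ (x :: u) v) t := rfl

theorem splitSum_add (ψ χ : List A → List A → W) (l : List A) :
    splitSum (fun u v => ψ u v + χ u v) l = splitSum ψ l + splitSum χ l := by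
  induction l generalizing ψ χ with
  | nil => rfl
  | cons x t ih => simp only [splitSum_cons, ih]; abel

theorem splitSum_map {g : W → W'} (hg : IsAdd g) (ψ : List A → List A → W) (l : List A) :
    g (splitSum ψ l) = splitSum (fun u v => g (ψ u v)) l := by
  induction l generalizing ψ with
  | nil => rfl
  | cons x t ih => simp only [splitSum_cons, hg _ _, ih]

theorem splitSum_neg (ψ : List A → List A → W) (l : List A) :
    splitSum (fun u v => -ψ u v) l = -splitSum ψ l :=
  (splitSum_map (g := fun x : W => -x) (fun x y => by simp [add_comm]) ψ l).symm

theorem splitSum_congr {ψ χ : List A → List A → W} {l : List A}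
    (h : ∀ u v, u ++ v = l → ψ u v = χ u v) : splitSum ψ l = splitSum χ l := by
  induction l generalizing ψ χ with
  | nil => exact h [] [] rfl
  | cons x t ih =>
    rw [splitSum_cons, splitSum_cons, h [] (x :: t) rfl, ih]
    intro u v huv
    exact h (x :: u) v (by simp [huv])

theorem splitSum_induction {Q : W → Prop} (hadd : ∀ a b, Q a → Q b → Q (a + b))
    {ψ : List A → List A → W} {l : List A} (h : ∀ u v, u ++ v = l → Q (ψ u v)) :
    Q (splitSum ψ l) := by
  induction l generalizing ψ with
  | nil => exact h [] [] rfl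
  | cons x t ih =>
    exact hadd _ _ (h [] (x :: t) rfl) (ih fun u v huv => h (x :: u) v (by simp [huv]))

theorem splitSum_zero {ψ : List A → List A → W} {l : List A}
    (h : ∀ u v, u ++ v = l → ψ u v = 0) : splitSum ψ l = 0 :=
  splitSum_induction (Q := fun x => x = 0) (by rintro _ _ rfl rfl; simp) h

/-- Coassociativity of deconcatenation. -/
theorem splitSum_assoc (χ : List A → List A → List A → W) (l : List A) :
    splitSum (fun u v => splitSum (fun a b => χ u a b) v) l
      = splitSum (fun u v => splitSum (fun a b => χ a b v) u) l := by
  induction l generalizing χ with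
  | nil => rfl
  | cons x t ih =>
    simp only [splitSum_cons, splitSum_nil, ih, splitSum_add]
    abel

theorem splitSum_param {B : Type*} {L : (B → W) → Prop}
    (hadd : ∀ f g, L f → L g → L (fun x => f x + g x))
    {ψ : B → List A → List A → W} (h : ∀ u v, L (fun x => ψ x u v)) (l : List A) :
    L (fun x => splitSum (ψ x) l) := by
  induction l generalizing ψ with
  | nil => exact h [] []
  | cons x t ih => exact hadd _ _ (h _ _) (ih fun u v => h (x :: u) v)

theorem splitSum_slot {L : (A → W) → Prop}
    (hadd : ∀ f g, L f → L g → L (fun x => f x + g x)) {ψ : List A → List A → W}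
    (h1 : ∀ v, Slotwise L (fun u => ψ u v)) (h2 : ∀ u, Slotwise L (fun v => ψ u v)) :
    Slotwise L (splitSum ψ) := by
  intro u w
  induction u generalizing ψ with
  | nil => exact hadd _ _ (h2 [] [] w) (splitSum_param hadd (fun u v => h1 v [] u) w)
  | cons y t ih =>
    exact hadd _ _ (h2 [] (y :: t) w) (ih (fun v => (h1 v).cons y) (fun u => h2 (y :: u)))

/-! #### Insertion of an operation -/

section Insert

variable (σ : C → C) (m : List C → C)

theorem insertOp_nil (φ : List C → W) : insertOp σ m φ [] = φ [m []] := rfl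

theorem insertOp_cons (φ : List C → W) (x : C) (t : List C) :
    insertOp σ m φ (x :: t) = splitSum (fun v w => φ (m v :: w)) (x :: t)
      + insertOp σ m (fun l => φ (σ x :: l)) t := rfl

theorem insertOp_add (φ χ : List C → W) (l : List C) :
    insertOp σ m (fun u => φ u + χ u) l = insertOp σ m φ l + insertOp σ m χ l := by
  induction l generalizing φ χ with
  | nil => rfl
  | cons x t ih => simp only [insertOp_cons, splitSum_add, ih]; abel

theorem insertOp_map {g : W → W'} (hg : IsAdd g) (φ : List C → W) (l : List C) :
    g (insertOp σ m φ l) = insertOp σ m (fun u => g (φ u)) l := by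
  induction l generalizing φ with
  | nil => rfl
  | cons x t ih => simp only [insertOp_cons, hg _ _, splitSum_map hg, ih]

theorem insertOp_neg (φ : List C → W) (l : List C) :
    insertOp σ m (fun u => -φ u) l = -insertOp σ m φ l :=
  (insertOp_map σ m (g := fun x : W => -x) (fun x y => by simp [add_comm]) φ l).symm

theorem insertOp_sub (φ χ : List C → W) (l : List C) :
    insertOp σ m (fun u => φ u - χ u) l = insertOp σ m φ l - insertOp σ m χ l := by
  simp only [sub_eq_add_neg, insertOp_add, insertOp_neg]

variable {σ m}

/-- To prove a property, closed under addition, of `insertOp σ m φ l`, it is enough to prove it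
for all summands. -/
theorem insertOp_induction {Q : W → Prop} (hadd : ∀ a b, Q a → Q b → Q (a + b))
    {φ : List C → W} {l : List C}
    (h : ∀ u v w, u ++ v ++ w = l → Q (φ (u.map σ ++ m v :: w))) : Q (insertOp σ m φ l) := by
  induction l generalizing φ with
  | nil => exact h [] [] [] rfl
  | cons x t ih =>
    refine hadd _ _ (splitSum_induction hadd fun v w hvw => ?_) (ih fun u v w huvw => ?_)
    · exact h [] v w hvw
    · exact h (x :: u) v w (by simpa using huvw)

theorem insertOp_zero {φ : List C → W} {l : List C}
    (h : ∀ u v w, u ++ v ++ w = l → φ (u.map σ ++ m v :: w) = 0) : insertOp σ m φ l = 0 :=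
  insertOp_induction (Q := fun x => x = 0) (by rintro _ _ rfl rfl; simp) h

theorem insertOp_param {B : Type*} {L : (B → W) → Prop}
    (hadd : ∀ f g, L f → L g → L (fun x => f x + g x))
    {φ : B → List C → W} (h : ∀ u, L (fun x => φ x u)) (l : List C) :
    L (fun x => insertOp σ m (φ x) l) := by
  induction l generalizing φ with
  | nil => exact h _
  | cons x t ih =>
    exact hadd _ _ (splitSum_param hadd (fun u v => h _) _) (ih fun u => h _)

/-- The varying entry lies in the inserted block, to its right, or to its left under `σ`; in each
case the summand is a composite in that entry. The predicate `L` is kept abstract to cover both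
additivity and continuous linearity. -/
theorem insertOp_slot {L : (C → W) → Prop} {L' : (C → C) → Prop}
    (hadd : ∀ f g, L f → L g → L (fun x => f x + g x))
    (hcomp : ∀ f g, L f → L' g → L (fun x => f (g x))) (hσ : L' σ) (hm : Slotwise L' m)
    {φ : List C → W} (hφ : Slotwise L φ) : Slotwise L (insertOp σ m φ) := by
  have key : ∀ {φ : List C → W}, Slotwise L φ →
      Slotwise L (splitSum (fun v w => φ (m v :: w))) := fun hφ =>
    splitSum_slot hadd (fun v u w => hcomp _ _ (hφ [] v) (hm u w)) fun u => hφ.cons _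
  intro u w
  induction u generalizing φ with
  | nil =>
    exact hadd _ _ (key hφ [] w)
      (insertOp_param hadd (φ := fun x l => φ (σ x :: l)) (fun u => hcomp _ _ (hφ [] u) hσ) w)
  | cons y t ih => exact hadd _ _ (key hφ (y :: t) w) (ih (hφ.cons _))

/-- The Leibniz rule of an insertion with respect to deconcatenation. -/
theorem insertOp_splitSum (ψ : List C → List C → W) (l : List C) :
    insertOp σ m (splitSum ψ) l
      = splitSum (fun u v => insertOp σ m (fun a => ψ a v) u) l
        + splitSum (fun u v => insertOp σ m (fun b => ψ (u.map σ) b) v) l := by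
  induction l generalizing ψ with
  | nil => simp only [insertOp_nil, splitSum_cons, splitSum_nil, List.map_nil]; abel
  | cons x t ih =>
    have h1 : splitSum (fun v w => splitSum (fun a b => ψ (m v :: a) b) w) (x :: t)
        = ψ [m []] (x :: t) + splitSum (fun u v => splitSum (fun a b => ψ (m a :: b) v) (x :: u)) t
        := by
      rw [splitSum_assoc (fun v a b => ψ (m v :: a) b), splitSum_cons, splitSum_nil]
    have h2 : insertOp σ m (fun l => splitSum ψ (σ x :: l)) t
        = insertOp σ m (fun l => ψ [] (σ x :: l)) t
          + (splitSum (fun u v => insertOp σ m (fun a => ψ (σ x :: a) v) u) t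
          + splitSum (fun u v => insertOp σ m (fun b => ψ (σ x :: u.map σ) b) v) t) := by
      rw [← ih, ← insertOp_add]; rfl
    rw [insertOp_cons, h2]
    simp only [splitSum_cons (fun u v => insertOp σ m (fun a => ψ a v) u),
      splitSum_cons (fun u v => insertOp σ m (fun b => ψ (u.map σ) b) v), insertOp_nil,
      List.map_nil, List.map_cons]
    simp only [insertOp_cons, splitSum_add]
    simp only [splitSum_cons ψ, splitSum_add] at h1 ⊢
    rw [h1]
    abel

end Insert

/-! #### Sums over decompositions into blocks -/

section Block

variable (f : List C → D)

/-- The recursion of `blockAux` extends the open block by one entry at a time. Summing over the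
place where the block is closed gives a recursion on the first block, the form used from here on,
with induction on the length. -/
theorem blockAux_eq (φ : List D → W) (b t : List C) :
    blockAux f φ b t = splitSum (fun u v => blockSum f (fun l => φ (f (b ++ u) :: l)) v) t := by
  induction t generalizing φ b with
  | nil => simp [blockAux, splitSum_nil, blockSum]
  | cons x t ih =>
    rw [blockAux, splitSum_cons, ih (b := b ++ [x]), add_comm]
    simp [blockSum]

theorem blockSum_nil (φ : List D → W) : blockSum f φ [] = φ [] := rfl

theorem blockSum_cons (φ : List D → W) (x : C) (t : List C) :
    blockSum f φ (x :: t)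
      = splitSum (fun u v => blockSum f (fun l => φ (f (x :: u) :: l)) v) t := by
  rw [blockSum, blockAux_eq]; rfl

theorem blockAtAux_eq (σ : D → D) (X : List C → D) (φ : List D → W) (b t : List C) :
    blockAtAux σ f X φ b t = splitSum (fun u v => blockSum f (fun l => φ (X (b ++ u) :: l)) v
      + blockSumAt σ f X (fun l => φ (σ (f (b ++ u)) :: l)) v) t := by
  induction t generalizing φ b with
  | nil => simp [blockAtAux, splitSum_nil, blockSum, blockSumAt]
  | cons x t ih =>
    rw [blockAtAux, splitSum_cons, ih (b := b ++ [x]), add_comm]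
    simp [blockSum, blockSumAt]

theorem blockSumAt_cons (σ : D → D) (X : List C → D) (φ : List D → W) (x : C) (t : List C) :
    blockSumAt σ f X φ (x :: t) = splitSum (fun u v => blockSum f (fun l => φ (X (x :: u) :: l)) v
      + blockSumAt σ f X (fun l => φ (σ (f (x :: u)) :: l)) v) t := by
  rw [blockSumAt, blockAtAux_eq]; rfl

theorem blockSum_add (φ χ : List D → W) (l : List C) :
    blockSum f (fun u => φ u + χ u) l = blockSum f φ l + blockSum f χ l := by
  induction h : l.length using Nat.strong_induction_on generalizing l φ χ with
  | _ n ih =>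
    cases l with
    | nil => rfl
    | cons x t =>
      simp only [blockSum_cons, ← splitSum_add]
      refine splitSum_congr fun u v huv => ih v.length ?_ _ _ _ rfl
      rw [← h, ← huv]; simp only [List.length_cons, List.length_append]; omega

theorem blockSum_map {g : W → W'} (hg : IsAdd g) (φ : List D → W) (l : List C) :
    g (blockSum f φ l) = blockSum f (fun u => g (φ u)) l := by
  induction h : l.length using Nat.strong_induction_on generalizing l φ with
  | _ n ih =>
    cases l with
    | nil => rfl
    | cons x t =>
      simp only [blockSum_cons, splitSum_map hg]
      refine splitSum_congr fun u v huv => ih v.length ?_ _ _ rfl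
      rw [← h, ← huv]; simp only [List.length_cons, List.length_append]; omega

variable {f}

/-- To prove a property, closed under addition, of `blockSum f φ l`, it is enough to prove it
for all summands. -/
theorem blockSum_induction {Q : W → Prop} (hadd : ∀ a b, Q a → Q b → Q (a + b))
    {φ : List D → W} {l : List C}
    (h : ∀ bs : List (List C), (∀ b ∈ bs, b ≠ []) → bs.flatten = l → Q (φ (bs.map f))) :
    Q (blockSum f φ l) := by
  induction hl : l.length using Nat.strong_induction_on generalizing l φ with
  | _ n ih =>
    cases l with
    | nil => exact h [] (by simp) rfl
    | cons x t =>
      rw [blockSum_cons]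
      refine splitSum_induction hadd fun u v huv => ih v.length ?_ (fun bs hbs hv => ?_) rfl
      · rw [← hl, ← huv]; simp only [List.length_cons, List.length_append]; omega
      · exact h ((x :: u) :: bs) (by simpa using hbs) (by simp [hv, huv])

theorem blockSum_zero {φ : List D → W} {l : List C}
    (h : ∀ bs : List (List C), (∀ b ∈ bs, b ≠ []) → bs.flatten = l → φ (bs.map f) = 0) :
    blockSum f φ l = 0 :=
  blockSum_induction (Q := fun x => x = 0) (by rintro _ _ rfl rfl; simp) h

theorem blockSum_param {B : Type*} {L : (B → W) → Prop}
    (hadd : ∀ f g, L f → L g → L (fun x => f x + g x))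
    {φ : B → List D → W} (h : ∀ u, L (fun x => φ x u)) (l : List C) :
    L (fun x => blockSum f (φ x) l) := by
  induction hl : l.length using Nat.strong_induction_on generalizing l φ with
  | _ n ih =>
    cases l with
    | nil => exact h _
    | cons x t =>
      simp only [blockSum_cons]
      have : ∀ v : List C, v.length ≤ t.length → ∀ y,
          L (fun x => blockSum f (fun l => φ x (y :: l)) v) := fun v hv y =>
        ih v.length (by rw [← hl]; simp only [List.length_cons]; omega) (fun u => h _) _ rfl
      clear hl ih
      suffices H : ∀ (t' : List C), t'.length ≤ t.length → ∀ e : List C → D,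
          L (fun x' => splitSum (fun u v => blockSum f (fun l => φ x' (e u :: l)) v) t') from
        H t le_rfl _
      intro t' ht'
      induction t' with
      | nil => exact fun e => this _ ht' _
      | cons y s ihs =>
        exact fun e => hadd _ _ (this _ ht' _) (ihs (by simp at ht'; omega) (fun u => e (y :: u)))

/-- The proof returns to `blockAux`, which is structurally recursive: the varying entry is either
already in the open block, or it is still to be read and enters the open block later. -/
theorem blockSum_slot {L : (C → W) → Prop} {L₁ : (D → W) → Prop} {L₂ : (C → D) → Prop}
    (hadd : ∀ f g, L f → L g → L (fun x => f x + g x))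
    (hadd₁ : ∀ f g, L₁ f → L₁ g → L₁ (fun x => f x + g x))
    (hcomp : ∀ f g, L₁ f → L₂ g → L (fun x => f (g x))) (hf : Slotwise L₂ f)
    {φ : List D → W} (hφ : Slotwise L₁ φ) : Slotwise L (blockSum f φ) := by
  have aux : ∀ (n : ℕ) (φ : List D → W), Slotwise L₁ φ → ∀ (b u w : List C), u.length ≤ n →
      L (fun x => blockAux f φ (b ++ u ++ [x]) w) ∧
      L (fun x => blockAux f φ b (u ++ x :: w)) := by
    intro n φ hφ b u w hu
    have h1 : ∀ (φ : List D → W), Slotwise L₁ φ → ∀ (b c w : List C),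
        L (fun x => blockAux f φ (b ++ x :: c) w) := by
      intro φ hφ b c w
      induction w generalizing φ b c with
      | nil => exact hcomp _ _ (hφ [] []) (hf b c)
      | cons y s ih =>
        refine hadd _ _ ?_ ?_
        · simpa using ih φ hφ b (c ++ [y])
        · refine hcomp (fun z => blockAux f (fun l => φ (z :: l)) [y] s) _ ?_ (hf b c)
          have := blockSum_param (f := f) (L := L₁) hadd₁ (φ := fun z l => φ (z :: l))
            (fun u => hφ [] u) (y :: s)
          exact this
    constructor
    · exact h1 φ hφ (b ++ u) [] w
    · induction u generalizing φ b with
      | nil =>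
        refine hadd _ _ (h1 φ hφ b [] w) ?_
        simpa using h1 _ (hφ.cons (f b)) [] [] w
      | cons y s ih =>
        refine hadd _ _ (ih φ hφ (b ++ [y]) (by simp at hu; omega))
          (ih _ (hφ.cons (f b)) [y] (by simp at hu; omega))
  intro u w
  cases u with
  | nil => exact (aux 0 φ hφ [] [] w le_rfl).1
  | cons y s => exact (aux _ φ hφ [y] s w le_rfl).2

theorem blockSumAt_sub {σ : D → D} {X Y : List C → D} {φ : List D → W}
    (hφ : Slotwise IsAdd φ) (l : List C) :
    blockSumAt σ f (fun u => X u - Y u) φ l = blockSumAt σ f X φ l - blockSumAt σ f Y φ l := by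
  induction h : l.length using Nat.strong_induction_on generalizing l φ with
  | _ n ih =>
    cases l with
    | nil => simp [blockSumAt]
    | cons x t =>
      rw [eq_sub_iff_add_eq]
      simp only [blockSumAt_cons, ← splitSum_add]
      refine splitSum_congr fun u v huv => ?_
      have h1 := ih v.length
          (by rw [← h, ← huv]; simp only [List.length_cons, List.length_append]; omega)
          (hφ.cons (σ (f (x :: u)))) v rfl
      have h2 : IsAdd (fun z => blockSum f (fun l => φ (z :: l)) v) :=
        blockSum_param (L := IsAdd) (fun f g hf hg => hf.add hg) (fun u => hφ [] u) v
      rw [h1, h2.map_sub]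
      abel

/-- Multiplicativity of `blockSum` with respect to deconcatenation. -/
theorem blockSum_splitSum (ψ : List D → List D → W) (l : List C) :
    blockSum f (splitSum ψ) l
      = splitSum (fun u v => blockSum f (fun a => blockSum f (fun b => ψ a b) v) u) l := by
  induction h : l.length using Nat.strong_induction_on generalizing l ψ with
  | _ n ih =>
    cases l with
    | nil => rfl
    | cons x t =>
      have h1 : blockSum f (splitSum ψ) (x :: t)
          = splitSum (fun u v => blockSum f (fun b => ψ [] (f (x :: u) :: b)) v) t
            + splitSum (fun u v => splitSum (fun v1 v2 => blockSum f
              (fun a => blockSum f (fun b => ψ (f (x :: u) :: a) b) v2) v1) v) t := by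
        rw [blockSum_cons, ← splitSum_add]
        refine splitSum_congr fun u v huv => ?_
        rw [← ih v.length
            (by rw [← h, ← huv]; simp only [List.length_cons, List.length_append]; omega)
            _ v rfl, ← blockSum_add]
        rfl
      rw [h1, splitSum_assoc, splitSum_cons, blockSum_nil, ← blockSum_cons]
      congr 1
      refine splitSum_congr fun u v _ => ?_
      rw [blockSum_cons]

end Block

/-! #### The identities of an `A_∞` structure -/

section Identities

variable {σ : C → C} {τ : D → D} {m : List C → C} {m' : List D → D} {f : List C → D}
  {P : C → Prop} {P' : D → Prop}

theorem splitSum_head {φ : List C → W} (hφ : Slotwise IsAdd φ) (hm : m [] = 0) (x : C)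
    (t : List C) : splitSum (fun v w => φ (m v :: w)) (x :: t)
      = splitSum (fun v w => φ (m (x :: v) :: w)) t := by
  rw [splitSum_cons, hm, (hφ.head (x :: t)).map_zero, zero_add]

/-- The square of the insertion of an `A_∞` structure vanishes. -/
theorem insertOp_insertOp (hσ : IsAdd σ) (hm : Slotwise IsAdd m)
    (hm0 : m [] = 0) (hodd : ∀ l : List C, (∀ x ∈ l, P x) → m (l.map σ) = -σ (m l))
    (hrel : ∀ l : List C, (∀ x ∈ l, P x) → insertOp σ m m l = 0)
    {φ : List C → W} (hφ : Slotwise IsAdd φ) (l : List C) (hl : ∀ x ∈ l, P x) :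
    insertOp σ m (insertOp σ m φ) l = 0 := by
  have hadd : ∀ {φ : List C → W}, Slotwise IsAdd φ → Slotwise IsAdd (insertOp σ m φ) := fun h =>
    insertOp_slot (L' := IsAdd) (fun f g hf hg => hf.add hg)
      (fun f g hf hg => hf.comp hg) hσ hm h
  induction l generalizing φ with
  | nil => rw [insertOp_nil, hm0, ((hadd hφ).head []).map_zero]
  | cons x t ih =>
    have hx := hl x (by simp)
    have ht : ∀ y ∈ t, P y := fun y hy => hl y (by simp [hy])
    have e1 : insertOp σ m (fun l => insertOp σ m φ (σ x :: l)) t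
        = splitSum (fun u v => φ (insertOp σ m (fun a => m (σ x :: a)) u :: v)) t
          + splitSum (fun u v => insertOp σ m (fun b => φ (m (σ x :: u.map σ) :: b)) v) t := by
      have : ∀ u v, φ (insertOp σ m (fun a => m (σ x :: a)) u :: v)
          = insertOp σ m (fun a => φ (m (σ x :: a) :: v)) u := fun u v =>
        insertOp_map σ m (hφ [] v) _ u
      simp only [this]
      rw [← insertOp_splitSum]
      have h2 : (fun l => insertOp σ m φ (σ x :: l)) = fun l =>
          splitSum (fun v w => φ (m (σ x :: v) :: w)) l
            + insertOp σ m (fun l => φ (σ (σ x) :: l)) l := by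
        funext l
        rw [insertOp_cons, splitSum_head hφ hm0]
      rw [h2, insertOp_add, ih (hφ.cons _) ht, add_zero]
    rw [insertOp_cons, splitSum_head (hadd hφ) hm0, e1, ← splitSum_add, ← splitSum_add]
    have e2 : splitSum (fun u v => insertOp σ m φ (m (x :: u) :: v)
        + (φ (insertOp σ m (fun a => m (σ x :: a)) u :: v)
        + insertOp σ m (fun b => φ (m (σ x :: u.map σ) :: b)) v)) t
        = splitSum (fun u v => splitSum (fun a b => φ (m (m (x :: u) :: a) :: b)) v
          + φ (insertOp σ m (fun a => m (σ x :: a)) u :: v)) t := by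
      refine splitSum_congr fun u v huv => ?_
      have hu : ∀ y ∈ x :: u, P y := fun y hy => hl y (by
        rw [← huv]; simp only [List.mem_cons, List.mem_append] at hy ⊢; tauto)
      -- Two disjoint insertions occur in both orders. The order decides whether `σ` is applied
      -- before or after the left `m`, and `m ∘ σ = -σ ∘ m` makes the two contributions cancel.
      have h1 : insertOp σ m (fun b => φ (m (σ x :: u.map σ) :: b)) v
          = -insertOp σ m (fun b => φ (σ (m (x :: u)) :: b)) v := by
        rw [← insertOp_neg]
        have h2 := hodd (x :: u) hu
        rw [List.map_cons] at h2
        rw [h2]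
        congr 1
        funext b
        exact (hφ [] b).map_neg _
      rw [insertOp_cons, splitSum_head hφ hm0, h1]
      abel
    rw [e2, splitSum_add, splitSum_assoc, ← splitSum_add]
    refine splitSum_zero fun u v huv => ?_
    have hu : ∀ y ∈ x :: u, P y := fun y hy => hl y (by
      rw [← huv]; simp only [List.mem_cons, List.mem_append] at hy ⊢; tauto)
    rw [← splitSum_map (g := fun z => φ (z :: v)) (hφ.head v)]
    -- The nested insertions that remain form the relation for `x :: u`, placed in the first slot of
    -- `φ`.
    have h3 := hrel (x :: u) hu
    rw [insertOp_cons, splitSum_head hm hm0] at h3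
    rw [← (hφ.head v).map_zero, ← h3]
    exact ((hφ.head v) _ _).symm

/-- An operation inserted in the original list falls inside exactly one block. The blocks to its
left have `σ` applied to all entries, and `f` turns this into one `τ` on the value of the block. -/
theorem insertOp_blockSum (hm0 : m [] = 0) (hf : Slotwise IsAdd f)
    (heven : ∀ l : List C, (∀ x ∈ l, P x) → f (l.map σ) = τ (f l))
    {φ : List D → W} (hφ : Slotwise IsAdd φ) (l : List C) (hl : ∀ x ∈ l, P x) :
    insertOp σ m (blockSum f φ) l = blockSumAt τ f (insertOp σ m f) φ l := by
  have hadd : ∀ {φ : List D → W}, Slotwise IsAdd φ → Slotwise IsAdd (blockSum f φ) := fun h =>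
    blockSum_slot (L₁ := IsAdd) (L₂ := IsAdd) (fun f g hf hg => hf.add hg)
      (fun f g hf hg => hf.add hg) (fun f g hf hg => hf.comp hg) hf h
  induction h : l.length using Nat.strong_induction_on generalizing l φ with
  | _ n ih =>
    cases l with
    | nil => rw [insertOp_nil, hm0, ((hadd hφ).head []).map_zero]; rfl
    | cons x t =>
      have hpar : ∀ v, IsAdd (fun z => blockSum f (fun l => φ (z :: l)) v) := fun v =>
        blockSum_param (L := IsAdd) (fun f g hf hg => hf.add hg) (fun u => hφ [] u) v
      have e1 : insertOp σ m (fun l => blockSum f φ (σ x :: l)) t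
          = splitSum (fun u v =>
              blockSum f (fun l => φ (insertOp σ m (fun a => f (σ x :: a)) u :: l)) v) t
            + splitSum (fun u v => blockSumAt τ f (insertOp σ m f)
              (fun l => φ (τ (f (x :: u)) :: l)) v) t := by
        have h1 : ∀ u v, blockSum f (fun l => φ (insertOp σ m (fun a => f (σ x :: a)) u :: l)) v
            = insertOp σ m (fun a => blockSum f (fun l => φ (f (σ x :: a) :: l)) v) u :=
          fun u v => insertOp_map σ m (hpar v) _ u
        have h2 : splitSum (fun u v => blockSumAt τ f (insertOp σ m f)
              (fun l => φ (τ (f (x :: u)) :: l)) v) t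
            = splitSum (fun u v => insertOp σ m
              (fun b => blockSum f (fun l => φ (f (σ x :: u.map σ) :: l)) b) v) t := by
          refine splitSum_congr fun u v huv => ?_
          have hu : ∀ y ∈ x :: u, P y := fun y hy => hl y (by
            rw [← huv]; simp only [List.mem_cons, List.mem_append] at hy ⊢; tauto)
          have h3 := heven (x :: u) hu
          rw [List.map_cons] at h3
          rw [h3]
          exact (ih v.length
              (by rw [← h, ← huv]; simp only [List.length_cons, List.length_append]; omega)
              (hφ.cons _) v
            (fun y hy => hl y (by rw [← huv]; simp [hy])) rfl).symm
        simp only [h1]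
        rw [h2, ← insertOp_splitSum (fun a b => blockSum f (fun l => φ (f (σ x :: a) :: l)) b)]
        simp only [blockSum_cons]
      rw [insertOp_cons, splitSum_head (hadd hφ) hm0, e1]
      simp only [blockSum_cons]
      rw [splitSum_assoc, blockSumAt_cons, splitSum_add, ← add_assoc, ← splitSum_add]
      congr 1
      refine splitSum_congr fun u v huv => ?_
      rw [← splitSum_map (hpar v), ← hpar v, insertOp_cons, splitSum_head hf hm0]

/-- The inputs of an inserted `m'` come from consecutive blocks. The concatenation of these blocks
is a single block, on which the special value is `blockSum f m'`. -/
theorem blockSum_insertOp (hm0 : m' [] = 0) {φ : List D → W} (hφ : Slotwise IsAdd φ)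
    (l : List C) :
    blockSum f (insertOp τ m' φ) l = blockSumAt τ f (blockSum f m') φ l := by
  induction h : l.length using Nat.strong_induction_on generalizing l φ with
  | _ n ih =>
    cases l with
    | nil => rw [blockSum_nil, insertOp_nil, hm0, (hφ.head []).map_zero]; rfl
    | cons x t =>
      have hpar : ∀ v, IsAdd (fun z => blockSum f (fun l => φ (z :: l)) v) := fun v =>
        blockSum_param (L := IsAdd) (fun f g hf hg => hf.add hg) (fun u => hφ [] u) v
      have e1 : blockSum f (insertOp τ m' φ) (x :: t)
          = splitSum (fun u v => splitSum (fun v1 v2 => blockSum f (fun l =>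
              φ (blockSum f (fun a => m' (f (x :: u) :: a)) v1 :: l)) v2) v) t
            + splitSum (fun u v => blockSumAt τ f (blockSum f m')
              (fun l => φ (τ (f (x :: u)) :: l)) v) t := by
        rw [blockSum_cons, ← splitSum_add]
        refine splitSum_congr fun u v huv => ?_
        rw [← ih v.length
            (by rw [← h, ← huv]; simp only [List.length_cons, List.length_append]; omega)
            (hφ.cons _) v rfl]
        have h1 : ∀ v1 v2, blockSum f (fun l =>
              φ (blockSum f (fun a => m' (f (x :: u) :: a)) v1 :: l)) v2
            = blockSum f (fun a => blockSum f (fun l => φ (m' (f (x :: u) :: a) :: l)) v2) v1 :=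
          fun v1 v2 => blockSum_map f (hpar v2) _ v1
        simp only [h1]
        rw [← blockSum_splitSum (fun a b => φ (m' (f (x :: u) :: a) :: b)), ← blockSum_add]
        congr 1
        funext l
        rw [insertOp_cons, splitSum_head hφ hm0]
      rw [e1, blockSumAt_cons, splitSum_add, splitSum_assoc]
      congr 1
      refine splitSum_congr fun u v huv => ?_
      rw [← splitSum_map (hpar v), ← blockSum_cons]

/-- The defect of `f` to be an `A_∞` homomorphism. -/
def defect (σ : C → C) (m : List C → C) (m' : List D → D) (f : List C → D) (l : List C) : D :=
  blockSum f m' l - insertOp σ m f l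

/-- The Bianchi identity for the defect of an `A_∞` homomorphism. -/
theorem bianchi (hσ : IsAdd σ) (hm : Slotwise IsAdd m) (hm' : Slotwise IsAdd m')
    (hf : Slotwise IsAdd f) (hm0 : m [] = 0) (hm0' : m' [] = 0)
    (hodd : ∀ l : List C, (∀ x ∈ l, P x) → m (l.map σ) = -σ (m l))
    (hrel : ∀ l : List C, (∀ x ∈ l, P x) → insertOp σ m m l = 0)
    (heven : ∀ l : List C, (∀ x ∈ l, P x) → f (l.map σ) = τ (f l))
    (hP : ∀ l : List C, (∀ x ∈ l, P x) → P' (f l))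
    (hrel' : ∀ l : List D, (∀ x ∈ l, P' x) → insertOp τ m' m' l = 0)
    (l : List C) (hl : ∀ x ∈ l, P x) :
    blockSumAt τ f (defect σ m m' f) m' l + insertOp σ m (defect σ m m' f) l = 0 := by
  -- Expanding the defect gives four terms. The mixed ones agree by `insertOp_blockSum` and cancel;
  -- the other two contain the squares of the insertions of `m` and of `m'` and vanish by the
  -- relations.
  have h1 := blockSumAt_sub (σ := τ) (f := f) (X := blockSum f m') (Y := insertOp σ m f) hm' l
  have h2 := insertOp_sub σ m (blockSum f m') (insertOp σ m f) l
  have h3 := insertOp_insertOp (P := P) hσ hm hm0 hodd hrel hf l hl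
  have h4 := insertOp_blockSum (P := P) (τ := τ) hm0 hf heven hm' l hl
  have h5 := blockSum_insertOp (f := f) (τ := τ) hm0' hm' l
  have h6 : blockSum f (insertOp τ m' m') l = 0 := by
    refine blockSum_zero fun bs hbs hl' => hrel' _ fun y hy => ?_
    obtain ⟨b, hb, rfl⟩ := List.mem_map.mp hy
    exact hP b fun x hx => hl x (by rw [← hl']; exact List.mem_flatten.mpr ⟨b, hb, hx⟩)
  unfold defect
  rw [h1, h2, h3, h4, ← h5, h6]
  abel

end Identities

end ListCalculus

/-! ### A matching on words of finite sets -/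

section Words

variable {ι : Type*} [LinearOrder ι]

/-- The number of empty sets with which a word begins. -/
def emptyRun : List (Finset ι) → ℕ
  | [] => 0
  | I :: t => if I = ∅ then emptyRun t + 1 else 0

/-- The letters of a word: the concatenation of its entries, each in increasing order. -/
def letters : List (Finset ι) → List ι
  | [] => []
  | I :: t => I.sort ++ letters t

/-- Upper words: after a weakly decreasing sequence of singletons, bounded by `p`, there is an even
run of empty sets or an ascent. -/
inductive IsUpper : WithTop ι → List (Finset ι) → Prop
  | empty (p : WithTop ι) (t : List (Finset ι)) (h : Even (emptyRun (∅ :: t))) :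
      IsUpper p (∅ :: t)
  | ascent (p : WithTop ι) (I : Finset ι) (t : List (Finset ι)) (hI : I ≠ ∅)
      (h : ∀ x ∈ I, p < (x : WithTop ι)) : IsUpper p (I :: t)
  | cons (p : WithTop ι) (j : ι) (t : List (Finset ι)) (hj : (j : WithTop ι) ≤ p)
      (h : IsUpper (j : WithTop ι) t) : IsUpper p ({j} :: t)

/-- Critical words: weakly decreasing sequences of singletons, bounded by `p`. -/
inductive IsCritical : WithTop ι → List (Finset ι) → Prop
  | nil (p : WithTop ι) : IsCritical p []
  | cons (p : WithTop ι) (j : ι) (t : List (Finset ι)) (hj : (j : WithTop ι) ≤ p)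
      (h : IsCritical (j : WithTop ι) t) : IsCritical p ({j} :: t)

/-- Lower words: after a weakly decreasing sequence of singletons, bounded by `p`, there is an odd
run of empty sets or a descent to the smallest element of a set with at least two elements. -/
inductive IsLower : WithTop ι → List (Finset ι) → Prop
  | empty (p : WithTop ι) (t : List (Finset ι)) (h : ¬ Even (emptyRun (∅ :: t))) :
      IsLower p (∅ :: t)
  | descent (p : WithTop ι) (j : ι) (I J : Finset ι) (t : List (Finset ι)) (hI : I = insert j J)
      (hJ : J ≠ ∅) (h : ∀ x ∈ J, j < x) (hj : (j : WithTop ι) ≤ p) : IsLower p (I :: t)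
  | cons (p : WithTop ι) (j : ι) (t : List (Finset ι)) (hj : (j : WithTop ι) ≤ p)
      (h : IsLower (j : WithTop ι) t) : IsLower p ({j} :: t)

/-- The upper word matched with a lower word. -/
def lift : List (Finset ι) → List (Finset ι)
  | [] => []
  | I :: t => open Classical in
    if h : I.Nonempty then
      if I.card = 1 then I :: lift t else {I.min' h} :: I.erase (I.min' h) :: t
    else ∅ :: ∅ :: t

theorem lift_empty_cons (t : List (Finset ι)) : lift (∅ :: t) = ∅ :: ∅ :: t := by
  simp [lift]

theorem lift_singleton_cons (j : ι) (t : List (Finset ι)) :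
    lift ({j} :: t) = {j} :: lift t := by
  simp [lift]

theorem lift_insert_cons {j : ι} {J : Finset ι} (hJ : J ≠ ∅) (h : ∀ x ∈ J, j < x)
    (t : List (Finset ι)) : lift (insert j J :: t) = {j} :: J :: t := by
  have hj : j ∉ J := fun hj => lt_irrefl _ (h j hj)
  have h1 : (insert j J).Nonempty := Finset.insert_nonempty _ _
  have h2 : (insert j J).min' h1 = j := by
    apply le_antisymm
    · exact Finset.min'_le _ _ (Finset.mem_insert_self _ _)
    · refine Finset.le_min' _ _ _ fun y hy => ?_
      rcases Finset.mem_insert.mp hy with rfl | hy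
      · exact le_rfl
      · exact (h y hy).le
  have h3 : (insert j J).card ≠ 1 := by
    rw [Finset.card_insert_of_notMem hj]
    have := Finset.card_pos.mpr (Finset.nonempty_iff_ne_empty.mpr hJ)
    omega
  rw [lift, dif_pos h1, if_neg h3, h2, Finset.erase_insert hj]

/-- Read from the left: singletons that do not exceed the bound are passed over, and the first other
entry decides between upper and lower. If there is none, the word is critical. -/
theorem trichotomy (p : WithTop ι) (w : List (Finset ι)) :
    IsUpper p w ∨ IsLower p w ∨ IsCritical p w := by
  induction w generalizing p with
  | nil => exact .inr (.inr (.nil p))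
  | cons I t ih =>
    by_cases hI : I = ∅
    · subst hI
      by_cases h : Even (emptyRun (∅ :: t))
      · exact .inl (.empty p t h)
      · exact .inr (.inl (.empty p t h))
    have hI' := Finset.nonempty_iff_ne_empty.mpr hI
    set j := I.min' hI' with hj
    have hle : ∀ x ∈ I, j ≤ x := fun x hx => Finset.min'_le _ _ hx
    by_cases hp : (j : WithTop ι) ≤ p
    · have hins : insert j (I.erase j) = I := Finset.insert_erase (Finset.min'_mem _ _)
      by_cases hJ : I.erase j = ∅
      · have : I = {j} := by rw [← hins, hJ]; rfl
        rw [this]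
        rcases ih j with h | h | h
        · exact .inl (.cons p j t hp h)
        · exact .inr (.inl (.cons p j t hp h))
        · exact .inr (.inr (.cons p j t hp h))
      · refine .inr (.inl (.descent p j I (I.erase j) t hins.symm hJ (fun x hx => ?_) hp))
        exact lt_of_le_of_ne (hle x (Finset.mem_of_mem_erase hx)) (Finset.ne_of_mem_erase hx).symm
    · exact .inl (.ascent p I t hI fun x hx =>
        lt_of_lt_of_le (not_le.mp hp) (WithTop.coe_le_coe.mpr (hle x hx)))

/-- A cochain supported on lower words thereby vanishes on upper and on critical words. -/
theorem IsLower.not_upper_not_critical {p : WithTop ι} {w : List (Finset ι)} (h : IsLower p w) :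
    ¬ IsUpper p w ∧ ¬ IsCritical p w := by
  induction h with
  | empty p t h =>
    refine ⟨fun hu => ?_, fun hc => ?_⟩
    · generalize hw : (∅ :: t : List (Finset ι)) = w at hu
      cases hu with
      | empty _ t' h' => rw [hw] at h; exact h h'
      | ascent _ I _ hI _ => exact hI (by simp at hw; exact hw.1.symm)
      | cons _ j _ _ _ => simp at hw
    · generalize hw : (∅ :: t : List (Finset ι)) = w at hc
      cases hc with
      | nil => simp at hw
      | cons _ j _ _ _ => simp at hw
  | descent p j I J t hI hJ h hj =>
    have hs : ∀ i, I ≠ {i} := by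
      intro i hi
      obtain ⟨x, hx⟩ := Finset.nonempty_iff_ne_empty.mpr hJ
      have h1 : x ∈ I := hI ▸ Finset.mem_insert_of_mem hx
      have h2 : j ∈ I := hI ▸ Finset.mem_insert_self _ _
      rw [hi, Finset.mem_singleton] at h1 h2
      exact (h x hx).ne (h2.trans h1.symm)
    refine ⟨fun hu => ?_, fun hc => ?_⟩
    · generalize hw : (I :: t : List (Finset ι)) = w at hu
      cases hu with
      | empty _ t' h' =>
        simp only [List.cons.injEq] at hw
        exact Finset.insert_ne_empty _ _ (hI ▸ hw.1)
      | ascent _ I' _ hI' h' =>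
        simp only [List.cons.injEq] at hw
        exact not_lt.mpr hj (h' j (by rw [← hw.1, hI]; exact Finset.mem_insert_self _ _))
      | cons _ i _ _ _ => simp only [List.cons.injEq] at hw; exact hs i hw.1
    · generalize hw : (I :: t : List (Finset ι)) = w at hc
      cases hc with
      | nil => simp at hw
      | cons _ i _ _ _ => simp only [List.cons.injEq] at hw; exact hs i hw.1
  | cons p j t hj h ih =>
    refine ⟨fun hu => ?_, fun hc => ?_⟩
    · generalize hw : ({j} :: t : List (Finset ι)) = w at hu
      cases hu with
      | empty _ t' h' => simp at hw
      | ascent _ I' _ hI' h' =>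
        simp only [List.cons.injEq] at hw
        exact not_lt.mpr hj (h' j (by rw [← hw.1]; exact Finset.mem_singleton_self _))
      | cons _ i _ _ h' =>
        simp only [List.cons.injEq, Finset.singleton_inj] at hw
        obtain ⟨rfl, rfl⟩ := hw
        exact ih.1 h'
    · generalize hw : ({j} :: t : List (Finset ι)) = w at hc
      cases hc with
      | nil => simp at hw
      | cons _ i _ _ h' =>
        simp only [List.cons.injEq, Finset.singleton_inj] at hw
        obtain ⟨rfl, rfl⟩ := hw
        exact ih.2 h'

theorem emptyRun_empty_cons (t : List (Finset ι)) : emptyRun (∅ :: t) = emptyRun t + 1 := by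
  simp [emptyRun]

theorem emptyRun_cons_of_ne {I : Finset ι} (h : I ≠ ∅) (t : List (Finset ι)) :
    emptyRun (I :: t) = 0 := by
  simp [emptyRun, h]

/-- Every upper word is matched with a lower word, unless it begins with an ascent. -/
theorem IsUpper.exists_lift {p : WithTop ι} {u : List (Finset ι)} (h : IsUpper p u) :
    (∃ w, IsLower p w ∧ lift w = u) ∨
      ∃ I t, u = I :: t ∧ I ≠ ∅ ∧ ∀ x ∈ I, p < (x : WithTop ι) := by
  induction h with
  | empty p t h =>
    left
    cases t with
    | nil => simp [emptyRun] at h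
    | cons I t =>
      by_cases hI : I = ∅
      · subst hI
        refine ⟨∅ :: t, .empty p t ?_, lift_empty_cons t⟩
        rw [emptyRun_empty_cons] at h
        rwa [Nat.even_add_one] at h
      · rw [emptyRun_empty_cons, emptyRun_cons_of_ne hI] at h
        simp at h
  | ascent p I t hI h => exact .inr ⟨I, t, rfl, hI, h⟩
  | cons p j t hj h ih =>
    left
    rcases ih with ⟨w, hw, rfl⟩ | ⟨I, t', rfl, hI, h'⟩
    · exact ⟨{j} :: w, .cons p j w hj hw, lift_singleton_cons j w⟩
    · have h'' : ∀ x ∈ I, j < x := fun x hx => WithTop.coe_lt_coe.mp (h' x hx)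
      exact ⟨insert j I :: t', .descent p j _ I t' rfl hI h'' hj, lift_insert_cons hI h'' t'⟩

theorem IsUpper.exists_lift_top {u : List (Finset ι)} (h : IsUpper ⊤ u) :
    ∃ w, IsLower ⊤ w ∧ lift w = u := by
  rcases h.exists_lift with h | ⟨I, t, -, hI, h'⟩
  · exact h
  · obtain ⟨x, hx⟩ := Finset.nonempty_iff_ne_empty.mpr hI
    exact absurd (h' x hx) (not_lt.mpr le_top)

theorem sort_insert_of_lt {j : ι} {J : Finset ι} (h : ∀ x ∈ J, j < x) :
    (insert j J).sort = j :: J.sort := by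
  have hj : j ∉ J := fun hj => lt_irrefl _ (h j hj)
  exact Finset.sort_insert (· ≤ ·) (fun b hb => (h b hb).le) hj

theorem letters_singleton_cons (j : ι) (t : List (Finset ι)) :
    letters ({j} :: t) = j :: letters t := by
  simp [letters]

theorem letters_empty_cons (t : List (Finset ι)) : letters (∅ :: t) = letters t := by
  simp [letters]

/-- As the letters are unchanged, a lower word and its lift have the same degree and the same place
in the word order. -/
theorem IsLower.letters_lift {p : WithTop ι} {w : List (Finset ι)} (h : IsLower p w) :
    letters (lift w) = letters w := by
  induction h with
  | empty p t h => simp only [lift_empty_cons, letters_empty_cons]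
  | descent p j I J t hI hJ h hj =>
    subst hI
    rw [lift_insert_cons hJ h, letters_singleton_cons, letters, letters, sort_insert_of_lt h]
    rfl
  | cons p j t hj h ih => rw [lift_singleton_cons, letters_singleton_cons,
      letters_singleton_cons, ih]

theorem IsLower.length_lift {p : WithTop ι} {w : List (Finset ι)} (h : IsLower p w) :
    (lift w).length = w.length + 1 := by
  induction h with
  | empty p t h => simp only [lift_empty_cons, List.length_cons]
  | descent p j I J t hI hJ h hj =>
    subst hI
    rw [lift_insert_cons hJ h]; rfl
  | cons p j t hj h ih => rw [lift_singleton_cons, List.length_cons, ih, List.length_cons]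

theorem IsLower.lift_cons {p : WithTop ι} {I : Finset ι} {t : List (Finset ι)}
    (h : IsLower p (I :: t)) (hI : I ≠ ∅) :
    ∃ (i : ι) (u : List (Finset ι)), lift (I :: t) = {i} :: u ∧ (i : WithTop ι) ≤ p := by
  generalize hw : I :: t = w at h
  cases h with
  | empty _ t h => simp only [List.cons.injEq] at hw; exact absurd hw.1 hI
  | descent _ j I J t hI hJ h hj => subst hI; exact ⟨j, _, lift_insert_cons hJ h t, hj⟩
  | cons _ j t hj h => exact ⟨j, _, lift_singleton_cons j t, hj⟩

/-- The word order: shortlex on the letters. -/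
abbrev WordLT (w w' : List (Finset ι)) : Prop := List.Shortlex (· < ·) (letters w) (letters w')

theorem wordLT_wf [WellFoundedLT ι] : WellFounded (WordLT (ι := ι)) :=
  InvImage.wf letters (List.Shortlex.wf wellFounded_lt)

theorem wordLT_singleton_cons {j : ι} {w w' : List (Finset ι)} :
    WordLT ({j} :: w) ({j} :: w') ↔ WordLT w w' := by
  simp only [WordLT, letters_singleton_cons, List.shortlex_cons_iff]

/-- Merging keeps the number of letters and moves a letter of `K`, smaller than all of `J`, to the
front. -/
theorem wordLT_merge {J K : Finset ι} (hd : Disjoint J K) (hJ : J ≠ ∅)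
    {x : ι} (hx : x ∈ K) (hlt : ∀ y ∈ J, x < y) (t : List (Finset ι)) :
    WordLT ((J ∪ K) :: t) (J :: K :: t) := by
  refine List.Shortlex.of_lex ?_ ?_
  · simp [letters, Finset.card_union_of_disjoint hd, add_assoc]
  · simp only [letters]
    rcases h1 : (J ∪ K).sort with _ | ⟨a, A⟩
    · have := (Finset.mem_sort (· ≤ ·)).mpr (Finset.mem_union_right J hx)
      rw [h1] at this; simp at this
    rcases h2 : J.sort with _ | ⟨b, B⟩
    · obtain ⟨y, hy⟩ := Finset.nonempty_iff_ne_empty.mpr hJ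
      have := (Finset.mem_sort (· ≤ ·)).mpr hy
      rw [h2] at this; simp at this
    rw [h1, h2]
    refine List.Lex.rel (lt_of_le_of_lt (b := x) ?_ (hlt b ?_))
    · have h3 := (Finset.mem_sort (· ≤ ·)).mpr (Finset.mem_union_right J hx)
      have h4 := Finset.pairwise_sort (J ∪ K) (· ≤ ·)
      rw [h1] at h3 h4
      rcases List.mem_cons.mp h3 with rfl | h3
      · exact le_rfl
      · exact (List.pairwise_cons.mp h4).1 x h3
    · rw [← Finset.mem_sort (· ≤ ·), h2]; simp

/-! #### The reduced Hochschild operator on words -/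

variable {k M : Type*} [CommRing k] [AddCommGroup M] [Module k M]

/-- The part of the Hochschild differential that multiplies adjacent entries. -/
def mergeOp (s : Finset ι → k) (c : Finset ι → Finset ι → k) :
    (List (Finset ι) → M) → List (Finset ι) → M
  | _, [] => 0
  | _, [_] => 0
  | Ψ, I :: J :: t => c I J • Ψ ((I ∪ J) :: t) + s I • mergeOp s c (fun w => Ψ (I :: w)) (J :: t)

/-- The part of the Hochschild differential that acts by the first entry. -/
def leftOp (L : Finset ι → M →ₗ[k] M) (Ψ : List (Finset ι) → M) : List (Finset ι) → M
  | [] => 0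
  | I :: t => L I (Ψ t)

/-- The part of the Hochschild differential that acts by the last entry. -/
def rightOp (R : Finset ι → M →ₗ[k] M) : (List (Finset ι) → M) → List (Finset ι) → M
  | _, [] => 0
  | Ψ, [I] => R I (Ψ [])
  | Ψ, I :: J :: t => rightOp R (fun w => Ψ (I :: w)) (J :: t)

/-- The Hochschild differential on cochains, as functions of words in a basis. -/
def wordDiff (s : Finset ι → k) (c : Finset ι → Finset ι → k) (L R : Finset ι → M →ₗ[k] M)
    (Ψ : List (Finset ι) → M) (w : List (Finset ι)) : M :=
  mergeOp s c Ψ w + leftOp L Ψ w + rightOp R Ψ w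

section Linear

variable {s : Finset ι → k} {c : Finset ι → Finset ι → k} {L R : Finset ι → M →ₗ[k] M}

theorem mergeOp_sub (Ψ Ψ' : List (Finset ι) → M) (w : List (Finset ι)) :
    mergeOp s c (fun x => Ψ x - Ψ' x) w = mergeOp s c Ψ w - mergeOp s c Ψ' w := by
  induction w generalizing Ψ Ψ' with
  | nil => simp [mergeOp]
  | cons I t ih =>
    cases t with
    | nil => simp [mergeOp]
    | cons J t => simp only [mergeOp, ih, smul_sub]; abel

theorem leftOp_sub (Ψ Ψ' : List (Finset ι) → M) (w : List (Finset ι)) :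
    leftOp L (fun x => Ψ x - Ψ' x) w = leftOp L Ψ w - leftOp L Ψ' w := by
  cases w <;> simp [leftOp]

theorem rightOp_sub (Ψ Ψ' : List (Finset ι) → M) (w : List (Finset ι)) :
    rightOp R (fun x => Ψ x - Ψ' x) w = rightOp R Ψ w - rightOp R Ψ' w := by
  induction w generalizing Ψ Ψ' with
  | nil => simp [rightOp]
  | cons I t ih =>
    cases t with
    | nil => simp [rightOp]
    | cons J t => simp only [rightOp, ih]

theorem wordDiff_sub (Ψ Ψ' : List (Finset ι) → M) (w : List (Finset ι)) :
    wordDiff s c L R (fun x => Ψ x - Ψ' x) w = wordDiff s c L R Ψ w - wordDiff s c L R Ψ' w := by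
  simp only [wordDiff, mergeOp_sub, leftOp_sub, rightOp_sub]; abel

theorem mergeOp_zero {Ψ : List (Finset ι) → M} {w : List (Finset ι)}
    (h : ∀ u I J t, u ++ I :: J :: t = w → Ψ (u ++ (I ∪ J) :: t) = 0) :
    mergeOp s c Ψ w = 0 := by
  induction w generalizing Ψ with
  | nil => simp [mergeOp]
  | cons I t ih =>
    cases t with
    | nil => simp [mergeOp]
    | cons J t =>
      have h0 : Ψ ((I ∪ J) :: t) = 0 := h [] I J t rfl
      rw [mergeOp, ih, h0]
      · simp
      · intro u I' J' t' h'
        exact h (I :: u) I' J' t' (by simp [h'])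

theorem rightOp_zero {Ψ : List (Finset ι) → M} {w : List (Finset ι)}
    (h : ∀ u I, u ++ [I] = w → Ψ u = 0) : rightOp R Ψ w = 0 := by
  induction w generalizing Ψ with
  | nil => simp [rightOp]
  | cons I t ih =>
    cases t with
    | nil => simp [rightOp, h [] I rfl]
    | cons J t =>
      exact ih fun u I' h' => h (I :: u) I' (by simp [h'])

/-- Each of the three parts evaluates the cochain only on words with one entry fewer. -/
theorem wordDiff_eq_zero {Ψ : List (Finset ι) → M} {n : ℕ}
    (h : ∀ w : List (Finset ι), w.length = n → Ψ w = 0)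
    {w : List (Finset ι)} (hw : w.length = n + 1) : wordDiff s c L R Ψ w = 0 := by
  rw [wordDiff, mergeOp_zero, rightOp_zero]
  · cases w with
    | nil => simp [leftOp]
    | cons I t => simp [leftOp, h t (by simpa using hw)]
  · rintro u I rfl
    exact h u (by simpa using hw)
  · rintro u I J t rfl
    exact h _ (by simp at hw ⊢; omega)

end Linear

/-- The structure constants of the product of an exterior algebra in the monomial basis, with the
properties needed below. -/
structure IsMonomialProduct (s : Finset ι → k) (c : Finset ι → Finset ι → k) : Prop where
  sign_singleton : ∀ j, s {j} = 1
  sign_empty : s ∅ = -1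
  of_not_disjoint : ∀ I J, ¬ Disjoint I J → c I J = 0
  empty_left : ∀ J, c ∅ J = 1
  singleton_empty : ∀ j, c {j} ∅ = -1
  isUnit : ∀ j J, (∀ x ∈ J, j < x) → IsUnit (c {j} J)

section Matching

variable {s : Finset ι → k} {c : Finset ι → Finset ι → k} {L R : Finset ι → M →ₗ[k] M}

/-- The possible leading coefficients of the Hochschild differential along the matching. -/
def IsLeadingCoeff (r : M ≃ₗ[k] M) (θ : M ≃ₗ[k] M) : Prop :=
  θ = r ∨ ∃ a : kˣ, ∀ x, θ x = a • x

-- The run of empty sets in the lift is even. Merges inside it cancel in pairs, so that only the two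
-- ends count: if a nonempty set follows, the subtracted term gives `θ = -1`; if the whole word is
-- empty sets, the right action remains and `θ = r`.
open Classical in
theorem mergeOp_lift_empty (hc : IsMonomialProduct s c) {r : M ≃ₗ[k] M} (hr : ∀ x, R ∅ x = r x)
    (t : List (Finset ι)) (ht : ¬ Even (emptyRun (∅ :: t))) :
    ∃ θ : M ≃ₗ[k] M, IsLeadingCoeff r θ ∧ ∀ (p : WithTop ι) (Ψ : List (Finset ι) → M),
      (∀ u, IsUpper p u → Ψ u = 0) →
      mergeOp s c Ψ (lift (∅ :: t)) + rightOp R Ψ (lift (∅ :: t)) - Ψ (∅ :: t)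
        = θ (Ψ (∅ :: t)) := by
  induction h : t.length using Nat.strong_induction_on generalizing t with
  | _ n ih =>
  simp only [lift_empty_cons]
  rcases t with _ | ⟨J, t⟩
  · refine ⟨r, .inl rfl, fun p Ψ _ => ?_⟩
    simp [mergeOp, rightOp, hc.empty_left, hr]
  -- The merges at the first two places have the same value, with opposite coefficients `c ∅ ∅ = 1`
  -- and `s ∅ * c ∅ J = -1`.
  have step : ∀ Ψ : List (Finset ι) → M, mergeOp s c Ψ (∅ :: ∅ :: J :: t)
      = mergeOp s c (fun w => Ψ (∅ :: ∅ :: w)) (J :: t) := by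
    intro Ψ
    simp [mergeOp, hc.empty_left, hc.sign_empty]
  simp only [step, rightOp]
  by_cases hJ : J = ∅
  · subst hJ
    rcases t with _ | ⟨K, t⟩
    · simp [emptyRun] at ht
    by_cases hK : K = ∅
    · subst hK
      simp only [emptyRun_empty_cons] at ht
      obtain ⟨θ, hθ, H⟩ := ih t.length (by rw [← h]; simp) t (by
        rw [emptyRun_empty_cons]; intro he; apply ht; exact he.add even_two) rfl
      refine ⟨θ, hθ, fun p Ψ hU => ?_⟩
      -- Two empty sets in front keep the initial run even, so upper words go to upper words and the
      -- hypothesis on `Ψ` passes to the tail.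
      have := H ⊤ (fun w => Ψ (∅ :: ∅ :: w)) (fun u hu => hU _ (.empty p _ ?_))
      · rwa [lift_empty_cons] at this
      · have : Even (emptyRun u) := by
          cases hu with
          | empty _ _ h => exact h
          | ascent _ I _ hI _ => simp [emptyRun_cons_of_ne hI]
          | cons _ j _ _ _ => simp [emptyRun]
        rw [emptyRun_empty_cons, emptyRun_empty_cons]
        exact this.add even_two
    · simp [emptyRun_empty_cons, emptyRun_cons_of_ne hK] at ht
  · refine ⟨LinearEquiv.neg k, .inr ⟨-1, fun x => by simp⟩, fun p Ψ hU => ?_⟩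
    have hev : ∀ u : List (Finset ι), emptyRun u = 0 → Ψ (∅ :: ∅ :: u) = 0 := fun u hu =>
      hU _ (.empty p _ (by rw [emptyRun_empty_cons, emptyRun_empty_cons, hu]; decide))
    rw [mergeOp_zero, rightOp_zero]
    · simp
    · intro u I hu
      apply hev
      rcases u with _ | ⟨K, u⟩
      · rfl
      · simp only [List.cons_append, List.cons.injEq] at hu
        exact emptyRun_cons_of_ne (hu.1 ▸ hJ) _
    · intro u I K t' hu
      apply hev
      rcases u with _ | ⟨K', u⟩
      · simp only [List.nil_append, List.cons.injEq] at hu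
        refine emptyRun_cons_of_ne (fun h0 => hJ ?_) _
        rw [← hu.1, Finset.union_eq_empty.mp h0 |>.1]
      · simp only [List.cons_append, List.cons.injEq] at hu
        exact emptyRun_cons_of_ne (hu.1 ▸ hJ) _

open Classical in
/-- On the upper word matched with a lower word `w`, the Hochschild differential is an isomorphism
in the value at `w`, up to values at smaller words. -/
theorem mergeOp_lift (hc : IsMonomialProduct s c) {r : M ≃ₗ[k] M} (hr : ∀ x, R ∅ x = r x)
    {p : WithTop ι} {w : List (Finset ι)} (hw : IsLower p w) :
    ∃ θ : M ≃ₗ[k] M, IsLeadingCoeff r θ ∧ ∀ Ψ : List (Finset ι) → M,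
      (∀ u, IsUpper p u → Ψ u = 0) → (∀ u, IsCritical p u → Ψ u = 0) →
      (∀ u, WordLT u w → Ψ u = 0) →
      mergeOp s c Ψ (lift w) + rightOp R Ψ (lift w) - (if w.head? = some ∅ then Ψ w else 0)
        = θ (Ψ w) := by
  induction hw with
  | empty p t h =>
    obtain ⟨θ, hθ, H⟩ := mergeOp_lift_empty hc hr t h
    refine ⟨θ, hθ, fun Ψ hU _ _ => ?_⟩
    simpa using H p Ψ hU
  | descent p j I J t hI hJ h hj =>
    subst hI
    obtain ⟨a, ha⟩ := hc.isUnit j J h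
    refine ⟨LinearEquiv.smulOfUnit a, .inr ⟨a, fun x => rfl⟩, fun Ψ hU hC hL => ?_⟩
    -- The first merge, of `{j}` with `J`, gives the leading term. A merge of `J` with a disjoint
    -- `K` gives an upper word if `K` lies above `j`, and a smaller word otherwise; every later
    -- merge leaves the ascent from `j` to `J` in place.
    have e1 : mergeOp s c (fun w => Ψ ({j} :: w)) (J :: t) = 0 := by
      rcases t with _ | ⟨K, t⟩
      · rfl
      rw [mergeOp, mergeOp_zero (Ψ := fun w => Ψ ({j} :: J :: w)), smul_zero, add_zero]
      · by_cases hd : Disjoint J K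
        · by_cases hK : ∀ x ∈ K, j < x
          · rw [hU _ (.cons p j _ hj (.ascent _ (J ∪ K) t ?_ ?_)), smul_zero]
            · exact fun h0 => hJ (Finset.union_eq_empty.mp h0).1
            · intro x hx
              rw [WithTop.coe_lt_coe]
              rcases Finset.mem_union.mp hx with hx | hx
              exacts [h x hx, hK x hx]
          · push Not at hK
            obtain ⟨x, hx, hxj⟩ := hK
            rw [hL _ ?_, smul_zero]
            have h1 := wordLT_merge hd hJ hx (fun y hy => lt_of_le_of_lt hxj (h y hy)) t
            have h2 := wordLT_singleton_cons (j := j) |>.mpr h1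
            have h3 := (IsLower.descent p j _ J (K :: t) rfl hJ h hj).letters_lift
            rw [lift_insert_cons hJ h] at h3
            rwa [WordLT, h3] at h2
        · rw [hc.of_not_disjoint _ _ hd, zero_smul]
      · intro u I' J' t' _
        exact hU _ (.cons p j _ hj (.ascent _ J _ hJ fun x hx => WithTop.coe_lt_coe.mpr (h x hx)))
    have e2 : rightOp R (fun w => Ψ ({j} :: w)) (J :: t) = 0 := by
      refine rightOp_zero fun u I hu => ?_
      rcases u with _ | ⟨K, u⟩
      · exact hC _ (.cons p j _ hj (.nil _))
      · simp only [List.cons_append, List.cons.injEq] at hu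
        obtain ⟨rfl, -⟩ := hu
        exact hU _ (.cons p j _ hj (.ascent _ K _ hJ fun x hx => WithTop.coe_lt_coe.mpr (h x hx)))
    have e3 : ({j} ∪ J : Finset ι) = insert j J := rfl
    have e4 : ¬ (insert j J :: t).head? = some ∅ := by simp
    rw [lift_insert_cons hJ h, mergeOp, rightOp, e1, e2, if_neg e4, e3, ← ha]
    simp [LinearEquiv.smulOfUnit, Units.smul_def]
  | cons p j t hj ht ih =>
    obtain ⟨θ, hθ, H⟩ := ih
    refine ⟨θ, hθ, fun Ψ hU hC hL => ?_⟩
    have H1 := H (fun w => Ψ ({j} :: w)) (fun u hu => hU _ (.cons p j u hj hu))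
      (fun u hu => hC _ (.cons p j u hj hu)) (fun u hu => hL _ (wordLT_singleton_cons.mpr hu))
    rw [← H1, lift_singleton_cons, if_neg (by simp)]
    rcases t with _ | ⟨I, t⟩
    · generalize hw : ([] : List (Finset ι)) = w at ht
      cases ht <;> simp at hw
    by_cases hI : I = ∅
    · subst hI
      -- Merging `{j}` with the empty set after it contributes `-Ψ ({j} :: ∅ :: t)`. This is the
      -- subtracted term of the induction hypothesis: the preceding singleton takes over the role of
      -- the left action.
      rw [lift_empty_cons, mergeOp, rightOp, hc.singleton_empty, hc.sign_singleton,
        if_pos (by simp)]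
      simp only [Finset.union_empty, neg_smul, one_smul]
      abel
    · obtain ⟨i, u, hu, hi⟩ := ht.lift_cons hI
      -- For `i = j` the product vanishes; for `i < j` the merged word is smaller.
      have hz : c {j} {i} • Ψ (({j} ∪ {i}) :: u) = 0 := by
        by_cases hij : i = j
        · rw [hij, hc.of_not_disjoint _ _ (by simp), zero_smul]
        · have hlt : i < j := lt_of_le_of_ne (WithTop.coe_le_coe.mp hi) hij
          rw [hL _ ?_, smul_zero]
          have h2 := wordLT_merge (J := {j}) (K := {i}) (x := i) (by simpa using Ne.symm hij)
            (by simp) (by simp) (by simpa using hlt) u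
          have h3 := ht.letters_lift
          rw [hu] at h3
          rw [WordLT] at h2 ⊢
          rwa [letters_singleton_cons j ({i} :: u), h3, ← letters_singleton_cons] at h2
      rw [hu, mergeOp, rightOp, hc.sign_singleton, if_neg (by simpa using hI), hz]
      simp

/-- To `mergeOp_lift` the left action is added. On an initial empty set it is `-1` and accounts for
the subtracted term; otherwise it drops a letter and so evaluates `Ψ` at a smaller word, where `Ψ`
vanishes. -/
theorem wordDiff_lift (hc : IsMonomialProduct s c) {r : M ≃ₗ[k] M} (hr : ∀ x, R ∅ x = r x)
    (hL0 : ∀ x, L ∅ x = -x) {w : List (Finset ι)} (hw : IsLower ⊤ w) :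
    ∃ θ : M ≃ₗ[k] M, IsLeadingCoeff r θ ∧ ∀ Ψ : List (Finset ι) → M,
      (∀ u, IsUpper ⊤ u → Ψ u = 0) → (∀ u, IsCritical ⊤ u → Ψ u = 0) →
      (∀ u, WordLT u w → Ψ u = 0) → wordDiff s c L R Ψ (lift w) = θ (Ψ w) := by
  classical
  obtain ⟨θ, hθ, H⟩ := mergeOp_lift hc hr hw
  refine ⟨θ, hθ, fun Ψ hU hC hL => ?_⟩
  rw [← H Ψ hU hC hL, wordDiff]
  have : leftOp L Ψ (lift w) = -(if w.head? = some ∅ then Ψ w else 0) := by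
    rcases w with _ | ⟨I, t⟩
    · simp [leftOp, lift]
    by_cases hI : I = ∅
    · subst hI
      simp [lift_empty_cons, leftOp, hL0]
    · obtain ⟨i, u, hu, -⟩ := hw.lift_cons hI
      have h3 := hw.letters_lift
      rw [hu, letters_singleton_cons] at h3
      rw [hu, leftOp, hL u (List.Shortlex.of_length_lt (by rw [← h3]; simp)), map_zero,
        if_neg (by simpa using hI), neg_zero]
  rw [this]
  abel

/-- A cocycle that vanishes on upper words and on critical words is zero. -/
theorem eq_zero_of_wordDiff_eq_zero [WellFoundedLT ι] (hc : IsMonomialProduct s c)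
    {r : M ≃ₗ[k] M} (hr : ∀ x, R ∅ x = r x) (hL0 : ∀ x, L ∅ x = -x)
    {Ψ : List (Finset ι) → M} (hU : ∀ u, IsUpper ⊤ u → Ψ u = 0)
    (hC : ∀ u, IsCritical ⊤ u → Ψ u = 0) (hΨ : ∀ u, wordDiff s c L R Ψ u = 0)
    (w : List (Finset ι)) : Ψ w = 0 := by
  refine wordLT_wf.induction (C := fun w => Ψ w = 0) w fun w ih => ?_
  rcases trichotomy ⊤ w with h | h | h
  · exact hU w h
  · obtain ⟨θ, -, H⟩ := wordDiff_lift hc hr hL0 h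
    -- The smallest word with a nonzero value would be lower, but its value is read off from the
    -- differential at the lift by an isomorphism.
    have := H Ψ hU hC ih
    rw [hΨ] at this
    exact (θ.map_eq_zero_iff).mp this.symm
  · exact hC w h

open Classical in
/-- A cochain can be made to vanish on all upper words by adding a coboundary. -/
theorem exists_wordDiff_eq [WellFoundedLT ι] (hc : IsMonomialProduct s c)
    {r : M ≃ₗ[k] M} (hr : ∀ x, R ∅ x = r x) (hL0 : ∀ x, L ∅ x = -x)
    (N : List (Finset ι) → M) : ∃ Ψ : List (Finset ι) → M,
      (∀ u, IsUpper ⊤ u → Ψ u = 0) ∧ (∀ u, IsCritical ⊤ u → Ψ u = 0) ∧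
      (∀ u, IsUpper ⊤ u → N u + wordDiff s c L R Ψ u = 0) ∧
      ∀ Q Q' : List (Finset ι) → Submodule k M, (∀ u, N u ∈ Q' u) →
        (∀ Ψ : List (Finset ι) → M, (∀ w, Ψ w ∈ Q w) → ∀ u, wordDiff s c L R Ψ u ∈ Q' u) →
        (∀ w, IsLower ⊤ w → ∀ x ∈ Q' (lift w), x ∈ Q w ∧ r.symm x ∈ Q w) → ∀ w, Ψ w ∈ Q w := by
  have H := fun w : {w : List (Finset ι) // IsLower ⊤ w} => wordDiff_lift hc hr hL0 w.2
  choose θ hθ H using H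
  -- The required equation at `lift w` is solved for the value at `w`, with the values at smaller
  -- words known and all the others replaced by zero.
  let F : ∀ w : List (Finset ι), (∀ u, WordLT u w → M) → M := fun w rec =>
    if h : IsLower ⊤ w then (θ ⟨w, h⟩).symm (-(N (lift w) + wordDiff s c L R
      (fun u => if hu : WordLT u w then rec u hu else 0) (lift w))) else 0
  let Ψ : List (Finset ι) → M := wordLT_wf.fix F
  have hΨ : ∀ w, Ψ w = F w (fun u _ => Ψ u) := fun w => wordLT_wf.fix_eq F w
  have hlow : ∀ w, ¬ IsLower ⊤ w → Ψ w = 0 := fun w h => by rw [hΨ]; exact dif_neg h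
  have hU : ∀ u, IsUpper ⊤ u → Ψ u = 0 := fun u h =>
    hlow u fun h' => h'.not_upper_not_critical.1 h
  have hC : ∀ u, IsCritical ⊤ u → Ψ u = 0 := fun u h =>
    hlow u fun h' => h'.not_upper_not_critical.2 h
  have hval : ∀ w (h : IsLower ⊤ w), θ ⟨w, h⟩ (Ψ w) = -(N (lift w) + wordDiff s c L R
      (fun u => if WordLT u w then Ψ u else 0) (lift w)) := by
    intro w h
    rw [hΨ]
    simp only [F, dif_pos h, LinearEquiv.apply_symm_apply, dite_eq_ite]
  refine ⟨Ψ, hU, hC, fun u hu => ?_, fun Q Q' hN hδ hQ w => ?_⟩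
  · obtain ⟨w, hw, rfl⟩ := hu.exists_lift_top
    -- The difference between `Ψ` and its truncation below `w` vanishes on all smaller words, so its
    -- differential at `lift w` is `θ (Ψ w)`.
    have h1 := H ⟨w, hw⟩ (fun u => Ψ u - if WordLT u w then Ψ u else 0)
      (fun u hu => by simp [hU u hu]) (fun u hu => by simp [hC u hu])
      (fun u hu => by simp [hu])
    have h2 : ¬ WordLT w w := fun h => wordLT_wf.irrefl.irrefl w h
    rw [wordDiff_sub, if_neg h2, sub_zero, hval w hw] at h1
    have h3 := eq_sub_iff_add_eq.mp h1.symm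
    rw [← h3]
    abel
  · refine wordLT_wf.induction (C := fun w => Ψ w ∈ Q w) w fun w ih => ?_
    by_cases h : IsLower ⊤ w
    · have h1 : θ ⟨w, h⟩ (Ψ w) ∈ Q' (lift w) := by
        rw [hval w h]
        refine neg_mem (add_mem (hN _) (hδ _ (fun u => ?_) _))
        split_ifs with hu
        · exact ih u hu
        · exact zero_mem _
      have h2 := hQ w h _ h1
      -- This is why the shape of `θ` is recorded: an arbitrary automorphism need not respect the
      -- family `Q`, but the inverses of `r` and of a scalar bring the value back into `Q w`.
      rcases hθ ⟨w, h⟩ with h3 | ⟨a, h3⟩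
      · rw [← h3] at h2
        simpa using h2.2
      · have h4 := h2.1
        rw [h3] at h4
        have := (Q w).smul_mem (↑a⁻¹ : k) h4
        simpa [Units.smul_def, smul_smul] using this
    · rw [hlow w h]; exact zero_mem _

end Matching

end Words

/-! ### Coefficients of Novikov series -/

theorem LeftFinite.isPWO {S : Set ℝ} (hS : LeftFinite S) : S.IsPWO := by
  rw [Set.isPWO_iff_isWF, Set.isWF_iff_no_descending_seq]
  intro f hf hmem
  have h1 : Set.range f ⊆ S ∩ Set.Iic (f 0) := by
    rintro _ ⟨n, rfl⟩
    exact ⟨hmem n, hf.antitone (Nat.zero_le n)⟩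
  exact Set.infinite_range_of_injective hf.injective ((hS _).subset h1)

section Coefficients

variable {k : Type*} [Field k] {M M' : Type*} [AddCommGroup M] [Module k M]
  [AddCommGroup M'] [Module k M']

namespace NovExt

theorem leftFinite_support (x : NovExt k M) : LeftFinite (Function.support x.coeff) := x.2

theorem ext_coeff {x y : NovExt k M} (h : ∀ E, x.coeff E = y.coeff E) : x = y :=
  Subtype.ext (HahnModule.ext _ _ (funext h))

/-- A Novikov series with prescribed coefficients. -/
def ofCoeff (f : ℝ → M) (hf : LeftFinite (Function.support f)) : NovExt k M :=
  ⟨HahnModule.of k ⟨f, hf.isPWO⟩, hf⟩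

@[simp]
theorem coeff_ofCoeff (f : ℝ → M) (hf : LeftFinite (Function.support f)) (E : ℝ) :
    (ofCoeff (k := k) f hf).coeff E = f E := rfl

@[simp]
theorem coeff_add (x y : NovExt k M) (E : ℝ) : (x + y).coeff E = x.coeff E + y.coeff E := rfl

@[simp]
theorem coeff_zero (E : ℝ) : (0 : NovExt k M).coeff E = 0 := rfl

@[simp]
theorem coeff_neg (x : NovExt k M) (E : ℝ) : (-x).coeff E = -x.coeff E := rfl

@[simp]
theorem coeff_sub (x y : NovExt k M) (E : ℝ) : (x - y).coeff E = x.coeff E - y.coeff E := by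
  rw [sub_eq_add_neg, coeff_add, coeff_neg, sub_eq_add_neg]

/-- A sum over one exponent can be restricted to any convenient finite set of exponents, unlike the
antidiagonal, which depends on both supports. -/
theorem coeff_smul_eq_finsum (r : Novikov k) (x : NovExt k M) (E : ℝ) :
    (r • x).coeff E = ∑ᶠ t, r.1.coeff t • x.coeff (E - t) := by
  have h1 : (r • x).coeff E = ∑ ij ∈ Finset.VAddAntidiagonal E
      (Set.VAddAntidiagonal.finite_of_isPWO r.1.isPWO_support
        ((HahnModule.of k).symm x.1).isPWO_support E), r.1.coeff ij.1 • x.coeff ij.2 :=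
    HahnModule.coeff_smul r.1 x.1 E
  rw [h1, finsum_eq_sum_of_support_subset (s := (Finset.VAddAntidiagonal E
      (Set.VAddAntidiagonal.finite_of_isPWO r.1.isPWO_support
        ((HahnModule.of k).symm x.1).isPWO_support E)).image Prod.fst)]
  · rw [Finset.sum_image]
    · refine Finset.sum_congr rfl fun ij hij => ?_
      rw [Finset.mem_vaddAntidiagonal] at hij
      rw [← hij.2.2]
      simp
    · intro a ha b hb hab
      rw [Finset.mem_coe, Finset.mem_vaddAntidiagonal] at ha hb
      have h2 := ha.2.2.trans hb.2.2.symm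
      simp only [vadd_eq_add] at h2
      exact Prod.ext hab (by linarith)
  · intro t ht
    rw [Finset.mem_coe, Finset.mem_image]
    refine ⟨(t, E - t), ?_, rfl⟩
    rw [Finset.mem_vaddAntidiagonal]
    refine ⟨fun h0 => ht ?_, fun h0 => ht ?_, by simp⟩
    · simp [h0]
    · have h0 : x.coeff (E - t) = 0 := h0
      simp [h0]

theorem leftFinite_support_novikov (r : Novikov k) : LeftFinite (Function.support r.1.coeff) := r.2

theorem coeff_smul_eq_sum (r : Novikov k) (x : NovExt k M) (E : ℝ) (A : Finset ℝ)
    (hA : ∀ t, r.1.coeff t ≠ 0 → x.coeff (E - t) ≠ 0 → t ∈ A) :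
    (r • x).coeff E = ∑ t ∈ A, r.1.coeff t • x.coeff (E - t) := by
  rw [coeff_smul_eq_finsum]
  refine finsum_eq_sum_of_support_subset _ fun t ht => hA t ?_ ?_
  · intro h0; exact ht (by simp [h0])
  · intro h0; exact ht (by simp [h0])

theorem exists_of_coeff_smul_ne_zero {r : Novikov k} {x : NovExt k M} {E : ℝ}
    (h : (r • x).coeff E ≠ 0) : ∃ t, r.1.coeff t ≠ 0 ∧ x.coeff (E - t) ≠ 0 := by
  by_contra! h'
  exact h ((coeff_smul_eq_sum r x E ∅ fun t h1 h2 => absurd (h' t h1) h2).trans Finset.sum_empty)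

/-- The monomial `a T ^ β` in the Novikov field. -/
def _root_.AInf.novMonomial (β : ℝ) (a : k) : Novikov k :=
  ⟨HahnSeries.single β a, (LeftFinite.singleton β).mono HahnSeries.support_single_subset⟩

theorem _root_.AInf.novT_eq (β : ℝ) : novT k β = novMonomial β 1 := rfl

@[simp]
theorem coeff_monomial_smul (β : ℝ) (a : k) (x : NovExt k M) (E : ℝ) :
    (novMonomial β a • x).coeff E = a • x.coeff (E - β) := by
  rw [coeff_smul_eq_sum _ _ _ {β}]
  · simp [novMonomial]
  · intro t ht _
    by_contra h
    exact ht (HahnSeries.coeff_single_of_ne (by simpa using h))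

theorem coeff_incl (x : M) (E : ℝ) : (incl k x).coeff E =
    open Classical in if E = 0 then x else 0 := by
  classical
  exact HahnSeries.coeff_single

theorem norm_le_exp_iff (x : NovExt k M) (γ : ℝ) :
    ‖x‖ ≤ Real.exp (-γ) ↔ ∀ E < γ, x.coeff E = 0 := by
  change seriesNorm x.series ≤ _ ↔ ∀ E < γ, x.series.coeff E = 0
  generalize x.series = y
  by_cases hy : y = 0
  · simp [hy, seriesNorm, (Real.exp_pos _).le]
  · simp only [seriesNorm, hy, if_false, Real.exp_le_exp, neg_le_neg_iff]
    constructor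
    · intro h E hE
      exact HahnSeries.coeff_eq_zero_of_lt_order (lt_of_lt_of_le hE h)
    · intro h
      by_contra h'
      exact HahnSeries.coeff_order_eq_zero.not.mpr hy (h _ (not_le.mp h'))

theorem norm_lt_exp_iff (x : NovExt k M) (γ : ℝ) :
    ‖x‖ < Real.exp (-γ) ↔ ∀ E ≤ γ, x.coeff E = 0 := by
  change seriesNorm x.series < _ ↔ ∀ E ≤ γ, x.series.coeff E = 0
  generalize x.series = y
  by_cases hy : y = 0
  · simp [hy, seriesNorm, Real.exp_pos _]
  · simp only [seriesNorm, hy, if_false, Real.exp_lt_exp, neg_lt_neg_iff]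
    constructor
    · intro h E hE
      exact HahnSeries.coeff_eq_zero_of_lt_order (lt_of_le_of_lt hE h)
    · intro h
      by_contra h'
      exact HahnSeries.coeff_order_eq_zero.not.mpr hy (h _ (not_lt.mp h'))

theorem finite_support_pair (g : NovExt k M) (x : NovExt k M') (E : ℝ) :
    {t | g.coeff t ≠ 0 ∧ x.coeff (E - t) ≠ 0}.Finite := by
  obtain ⟨a, ha⟩ := x.leftFinite_support.exists_lower
  refine (g.leftFinite_support (E - a)).subset ?_
  rintro t ⟨h1, h2⟩
  refine ⟨h1, ?_⟩
  have := ha _ h2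
  simp only [Set.mem_Iic]
  linarith

/-- The coefficients of the application of a series of linear maps. -/
def appCoeff (g : NovExt k (M →ₗ[k] M')) (x : NovExt k M) (E : ℝ) : M' :=
  ∑ᶠ t, g.coeff t (x.coeff (E - t))

theorem appCoeff_eq_sum_left (g : NovExt k (M →ₗ[k] M')) (x : NovExt k M) (E : ℝ) (A : Finset ℝ)
    (hA : ∀ t, g.coeff t ≠ 0 → x.coeff (E - t) ≠ 0 → t ∈ A) :
    appCoeff g x E = ∑ t ∈ A, g.coeff t (x.coeff (E - t)) := by
  refine finsum_eq_sum_of_support_subset _ fun t ht => hA t ?_ ?_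
  · intro h0; exact ht (by simp [h0])
  · intro h0; exact ht (by simp [h0])

theorem appCoeff_eq_sum_right (g : NovExt k (M →ₗ[k] M')) (x : NovExt k M) (E : ℝ) (A : Finset ℝ)
    (hA : ∀ t, x.coeff t ≠ 0 → g.coeff (E - t) ≠ 0 → t ∈ A) :
    appCoeff g x E = ∑ t ∈ A, g.coeff (E - t) (x.coeff t) := by
  have h1 : appCoeff g x E = ∑ᶠ t, g.coeff (E - t) (x.coeff t) := by
    rw [appCoeff, ← finsum_comp_equiv (Equiv.subLeft E)]
    simp
  rw [h1]
  refine finsum_eq_sum_of_support_subset _ fun t ht => hA t ?_ ?_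
  · intro h0; exact ht (by simp [h0])
  · intro h0; exact ht (by simp [h0])

theorem appCoeff_support (g : NovExt k (M →ₗ[k] M')) (x : NovExt k M) :
    Function.support (appCoeff g x) ⊆ Set.image2 (fun a b : ℝ => a + b)
      (Function.support g.coeff) (Function.support x.coeff) := by
  intro E hE
  by_contra h
  refine hE ((appCoeff_eq_sum_left g x E ∅ fun t h1 h2 => ?_).trans Finset.sum_empty)
  exact absurd ⟨t, h1, E - t, h2, by simp⟩ h

/-- The application of a series of linear maps. -/
def app : NovExt k (M →ₗ[k] M') →ₗ[Novikov k] NovExt k M →ₗ[Novikov k] NovExt k M' :=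
  LinearMap.mk₂ (Novikov k)
    (fun g x => ofCoeff (appCoeff g x)
      ((g.leftFinite_support.image2_add x.leftFinite_support).mono (appCoeff_support g x)))
    (fun g g' x => ext_coeff fun E => by
      classical
      have hA := fun g : NovExt k (M →ₗ[k] M') => (finite_support_pair g x E)
      have H : ∀ g'' : NovExt k (M →ₗ[k] M'), (∀ t, g''.coeff t ≠ 0 →
        g.coeff t ≠ 0 ∨ g'.coeff t ≠ 0)
          → appCoeff g'' x E = ∑ t ∈ (hA g).toFinset ∪ (hA g').toFinset,
            g''.coeff t (x.coeff (E - t)) := fun g'' h =>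
        appCoeff_eq_sum_left g'' x E _ fun t h1 h2 => by
          rcases h t h1 with h | h <;> simp [h, h2]
      simp only [coeff_add, coeff_ofCoeff]
      rw [H g fun t => .inl, H g' fun t => .inr, H (g + g') ?_, ← Finset.sum_add_distrib]
      · rfl
      · intro t ht
        by_contra! h
        exact ht (by rw [coeff_add, h.1, h.2, add_zero]))
    (fun r g x => ext_coeff fun E => by
      classical
      obtain ⟨lr, hr⟩ := (leftFinite_support_novikov r).exists_lower
      obtain ⟨lg, hg⟩ := g.leftFinite_support.exists_lower
      obtain ⟨lx, hx⟩ := x.leftFinite_support.exists_lower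
      -- Lower bounds for the three supports confine all contributing exponents to finite windows
      -- `A` and `B`. Both sides become sums over `A × B` that differ by the order of summation.
      set A := (leftFinite_support_novikov r (E - lg - lx)).toFinset with hA
      set B := (x.leftFinite_support (E - lr - lg)).toFinset with hB
      have mA : ∀ t, r.1.coeff t ≠ 0 → t ≤ E - lg - lx → t ∈ A := fun t h1 h2 => by
        rw [hA, Set.Finite.mem_toFinset]; exact ⟨h1, h2⟩
      have mB : ∀ t, x.coeff t ≠ 0 → t ≤ E - lr - lg → t ∈ B := fun t h1 h2 => by
        rw [hB, Set.Finite.mem_toFinset]; exact ⟨h1, h2⟩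
      rw [coeff_ofCoeff, appCoeff_eq_sum_right _ _ _ B, coeff_smul_eq_sum _ _ _ A]
      · have h1 : ∀ s ∈ B, (r • g).coeff (E - s) (x.coeff s)
            = ∑ t ∈ A, r.1.coeff t • g.coeff (E - s - t) (x.coeff s) := by
          intro s hs
          rw [coeff_smul_eq_sum _ _ _ A]
          · simp [LinearMap.sum_apply]
          · intro t h1 h2
            have := hg _ h2
            have := hx s (by rw [hB, Set.Finite.mem_toFinset] at hs; exact hs.1)
            exact mA t h1 (by linarith)
        have h2 : ∀ t ∈ A, r.1.coeff t • (ofCoeff (k := k) (appCoeff g x)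
            ((g.leftFinite_support.image2_add x.leftFinite_support).mono
              (appCoeff_support g x))).coeff (E - t)
            = ∑ s ∈ B, r.1.coeff t • g.coeff (E - s - t) (x.coeff s) := by
          intro t ht
          rw [coeff_ofCoeff, appCoeff_eq_sum_right _ _ _ B, Finset.smul_sum]
          · simp only [sub_right_comm]
          · intro s h1 h2
            have := hg _ h2
            have := hr t (by rw [hA, Set.Finite.mem_toFinset] at ht; exact ht.1)
            exact mB s h1 (by linarith)
        rw [Finset.sum_congr rfl h1, Finset.sum_congr rfl h2, Finset.sum_comm]
      · intro t h1 h2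
        obtain ⟨a, ha, b, hb, hab⟩ := appCoeff_support g x h2
        have := hg a ha
        have := hx b hb
        exact mA t h1 (by simp only at hab; linarith)
      · intro s h1 h2
        obtain ⟨t, h3, h4⟩ := exists_of_coeff_smul_ne_zero h2
        have := hr t h3
        have := hg _ h4
        exact mB s h1 (by linarith))
    (fun g x x' => ext_coeff fun E => by
      classical
      have hA := fun x : NovExt k M => (finite_support_pair g x E)
      have H : ∀ x'' : NovExt k M, (∀ t, x''.coeff t ≠ 0 → x.coeff t ≠ 0 ∨ x'.coeff t ≠ 0)
          → appCoeff g x'' E = ∑ t ∈ (hA x).toFinset ∪ (hA x').toFinset,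
            g.coeff t (x''.coeff (E - t)) := fun x'' h =>
        appCoeff_eq_sum_left g x'' E _ fun t h1 h2 => by
          rcases h _ h2 with h | h <;> simp [h, h1]
      simp only [coeff_add, coeff_ofCoeff]
      rw [H x fun t => .inl, H x' fun t => .inr, H (x + x') ?_, ← Finset.sum_add_distrib]
      · simp
      · intro t ht
        by_contra! h
        exact ht (by rw [coeff_add, h.1, h.2, add_zero]))
    (fun r g x => ext_coeff fun E => by
      classical
      obtain ⟨lr, hr⟩ := (leftFinite_support_novikov r).exists_lower
      obtain ⟨lg, hg⟩ := g.leftFinite_support.exists_lower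
      obtain ⟨lx, hx⟩ := x.leftFinite_support.exists_lower
      set A := (leftFinite_support_novikov r (E - lg - lx)).toFinset with hA
      set B := (g.leftFinite_support (E - lr - lx)).toFinset with hB
      have mA : ∀ t, r.1.coeff t ≠ 0 → t ≤ E - lg - lx → t ∈ A := fun t h1 h2 => by
        rw [hA, Set.Finite.mem_toFinset]; exact ⟨h1, h2⟩
      have mB : ∀ t, g.coeff t ≠ 0 → t ≤ E - lr - lx → t ∈ B := fun t h1 h2 => by
        rw [hB, Set.Finite.mem_toFinset]; exact ⟨h1, h2⟩
      rw [coeff_ofCoeff, appCoeff_eq_sum_left _ _ _ B, coeff_smul_eq_sum _ _ _ A]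
      · have h1 : ∀ s ∈ B, g.coeff s ((r • x).coeff (E - s))
            = ∑ t ∈ A, r.1.coeff t • g.coeff s (x.coeff (E - s - t)) := by
          intro s hs
          rw [coeff_smul_eq_sum _ _ _ A]
          · simp
          · intro t h1 h2
            have := hx _ h2
            have := hg s (by rw [hB, Set.Finite.mem_toFinset] at hs; exact hs.1)
            exact mA t h1 (by linarith)
        have h2 : ∀ t ∈ A, r.1.coeff t • (ofCoeff (k := k) (appCoeff g x)
            ((g.leftFinite_support.image2_add x.leftFinite_support).mono
              (appCoeff_support g x))).coeff (E - t)
            = ∑ s ∈ B, r.1.coeff t • g.coeff s (x.coeff (E - s - t)) := by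
          intro t ht
          rw [coeff_ofCoeff, appCoeff_eq_sum_left _ _ _ B, Finset.smul_sum]
          · simp only [sub_right_comm]
          · intro s h1 h2
            have := hx _ h2
            have := hr t (by rw [hA, Set.Finite.mem_toFinset] at ht; exact ht.1)
            exact mB s h1 (by linarith)
        rw [Finset.sum_congr rfl h1, Finset.sum_congr rfl h2, Finset.sum_comm]
      · intro t h1 h2
        obtain ⟨a, ha, b, hb, hab⟩ := appCoeff_support g x h2
        have := hg a ha
        have := hx b hb
        exact mA t h1 (by simp only at hab; linarith)
      · intro s h1 h2
        obtain ⟨t, h3, h4⟩ := exists_of_coeff_smul_ne_zero h2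
        have := hr t h3
        have := hx _ h4
        exact mB s h1 (by linarith))

theorem coeff_app (g : NovExt k (M →ₗ[k] M')) (x : NovExt k M) (E : ℝ) :
    (app g x).coeff E = appCoeff g x E := rfl

theorem coeff_app_incl (g : NovExt k (M →ₗ[k] M')) (x : M) (E : ℝ) :
    (app g (incl k x)).coeff E = g.coeff E x := by
  classical
  rw [coeff_app, appCoeff_eq_sum_right _ _ _ {0}]
  · simp [coeff_incl]
  · intro t ht _
    rw [coeff_incl] at ht
    simp only [ne_eq, ite_eq_right_iff, not_forall] at ht
    simpa using ht.1

theorem coeff_app_eq_zero {g : NovExt k (M →ₗ[k] M')} {x : NovExt k M} {a b : ℝ}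
    (hg : ∀ E < a, g.coeff E = 0) (hx : ∀ E < b, x.coeff E = 0) :
    ∀ E < a + b, (app g x).coeff E = 0 := by
  intro E hE
  by_contra h
  obtain ⟨s, hs, t, ht, hst⟩ := appCoeff_support g x h
  have h1 : a ≤ s := not_lt.mp fun h => hs (hg s h)
  have h2 : b ≤ t := not_lt.mp fun h => ht (hx t h)
  simp only at hst
  linarith

/-- The coefficientwise application of a linear map. -/
def mapCoeff (f : M →ₗ[k] M') : NovExt k M →ₗ[Novikov k] NovExt k M' where
  toFun x := ofCoeff (fun E => f (x.coeff E)) (x.leftFinite_support.mono fun E hE h0 => hE (by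
    change f (x.coeff E) = 0
    rw [h0, map_zero]))
  map_add' x y := ext_coeff fun E => by simp
  map_smul' r x := ext_coeff fun E => by
    simp only [coeff_ofCoeff, RingHom.id_apply]
    obtain ⟨lx, hx⟩ := x.leftFinite_support.exists_lower
    set A := (leftFinite_support_novikov r (E - lx)).toFinset with hA
    rw [coeff_smul_eq_sum _ _ _ A, coeff_smul_eq_sum _ _ _ A]
    · simp
    · intro t h1 h2
      have h3 : x.coeff (E - t) ≠ 0 := fun h0 => h2 (by simp [h0])
      have := hx _ h3
      rw [hA, Set.Finite.mem_toFinset]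
      exact ⟨h1, by simp only [Set.mem_Iic]; linarith⟩
    · intro t h1 h3
      have := hx _ h3
      rw [hA, Set.Finite.mem_toFinset]
      exact ⟨h1, by simp only [Set.mem_Iic]; linarith⟩

@[simp]
theorem coeff_mapCoeff (f : M →ₗ[k] M') (x : NovExt k M) (E : ℝ) :
    (mapCoeff f x).coeff E = f (x.coeff E) := rfl

/-- The `Λ`-multilinear map defined by a Novikov series of `k`-multilinear maps. -/
def extend : ∀ n : ℕ, NovExt k (MultilinearMap k (fun _ : Fin n => M) M') →ₗ[Novikov k]
    MultilinearMap (Novikov k) (fun _ : Fin n => NovExt k M) (NovExt k M')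
  | 0 => (MultilinearMap.constLinearEquivOfIsEmpty (R := Novikov k) (S := Novikov k)
      (M₁ := fun _ : Fin 0 => NovExt k M) (M₂ := NovExt k M')).toLinearMap ∘ₗ
        mapCoeff (MultilinearMap.constLinearEquivOfIsEmpty (R := k) (S := k)
          (M₁ := fun _ : Fin 0 => M) (M₂ := M')).symm.toLinearMap
  | n + 1 => (multilinearCurryLeftEquiv (Novikov k) (fun _ : Fin (n + 1) => NovExt k M)
        (NovExt k M')).symm.toLinearMap ∘ₗ
      (LinearMap.llcomp (Novikov k) (NovExt k M) _ _ (extend n)) ∘ₗ app ∘ₗ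
        mapCoeff (multilinearCurryLeftEquiv k (fun _ : Fin (n + 1) => M) M').toLinearMap

theorem extend_zero_apply (g : NovExt k (MultilinearMap k (fun _ : Fin 0 => M) M'))
    (x : Fin 0 → NovExt k M) (E : ℝ) :
    (extend 0 g x).coeff E = g.coeff E (fun i => i.elim0) := by
  have : (0 : Fin 0 → M) = fun i => i.elim0 := Subsingleton.elim _ _
  rw [← this]
  rfl

theorem extend_succ_apply (n : ℕ) (g : NovExt k (MultilinearMap k (fun _ : Fin (n + 1) => M) M'))
    (x : Fin (n + 1) → NovExt k M) :
    extend (n + 1) g x = extend n (app (mapCoeff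
      (multilinearCurryLeftEquiv k (fun _ : Fin (n + 1) => M) M').toLinearMap g) (x 0))
        (Fin.tail x) := rfl

theorem coeff_extend_incl (n : ℕ) (g : NovExt k (MultilinearMap k (fun _ : Fin n => M) M'))
    (x : Fin n → M) (E : ℝ) :
    (extend n g (fun i => incl k (x i))).coeff E = g.coeff E x := by
  induction n generalizing E with
  | zero =>
    rw [extend_zero_apply]
    congr 1
    exact Subsingleton.elim _ _
  | succ n ih =>
    rw [extend_succ_apply]
    have : Fin.tail (fun i => incl k (x i)) = fun i => incl k (Fin.tail x i) := rfl
    rw [this, ih, coeff_app_incl, coeff_mapCoeff]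
    change g.coeff E (Fin.cons (x 0) (Fin.tail x)) = _
    rw [Fin.cons_self_tail]

/-- Valuations add when one argument after another is applied. For `a = 0` this is the norm bound
for an extension with nonnegative exponents. -/
theorem coeff_extend_eq_zero (n : ℕ) (g : NovExt k (MultilinearMap k (fun _ : Fin n => M) M'))
    {a : ℝ} (hg : ∀ E < a, g.coeff E = 0) (x : Fin n → NovExt k M) (b : Fin n → ℝ)
    (hx : ∀ i, ∀ E < b i, (x i).coeff E = 0) :
    ∀ E < a + ∑ i, b i, (extend n g x).coeff E = 0 := by
  induction n generalizing a with
  | zero =>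
    intro E hE
    rw [extend_zero_apply, hg E (by simpa using hE)]
    rfl
  | succ n ih =>
    intro E hE
    rw [extend_succ_apply]
    refine ih _ (a := a + b 0) (coeff_app_eq_zero (fun E hE => ?_) (hx 0)) (Fin.tail x)
      (Fin.tail b) (fun i => hx i.succ) E ?_
    · rw [coeff_mapCoeff, hg E hE, map_zero]
    · rw [Fin.sum_univ_succ] at hE
      simp only [Fin.tail]
      linarith

end NovExt

end Coefficients

/-! ### Coefficients, valuations and approximation in a space with a `k`-structure -/

section KCoefficients

variable {k : Type*} [Field k] {N : ℕ}
  {C : Type*} [NormedAddCommGroup C] [Module (Novikov k) C]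
  {Cbar : Type*} [AddCommGroup Cbar] [Module k Cbar]
  {gr : ZMod N → Submodule (Novikov k) C} {grbar : ZMod N → Submodule k Cbar}

namespace KStructure

variable (S : KStructure gr grbar)

/-- The coefficient of `T ^ E`. -/
def coeff (x : C) (E : ℝ) : Cbar := (S.equiv x).coeff E

theorem ext_coeff {x y : C} (h : ∀ E, S.coeff x E = S.coeff y E) : x = y :=
  S.equiv.injective (NovExt.ext_coeff h)

@[simp]
theorem coeff_add (x y : C) (E : ℝ) : S.coeff (x + y) E = S.coeff x E + S.coeff y E := by
  simp [coeff]

@[simp]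
theorem coeff_zero (E : ℝ) : S.coeff 0 E = 0 := by simp [coeff]

@[simp]
theorem coeff_neg (x : C) (E : ℝ) : S.coeff (-x) E = -S.coeff x E := by simp [coeff]

@[simp]
theorem coeff_sub (x y : C) (E : ℝ) : S.coeff (x - y) E = S.coeff x E - S.coeff y E := by
  simp [coeff]

theorem coeff_sum {B : Type*} (s : Finset B) (f : B → C) (E : ℝ) :
    S.coeff (∑ b ∈ s, f b) E = ∑ b ∈ s, S.coeff (f b) E :=
  map_sum (AddMonoidHom.mk' (fun x => S.coeff x E) fun x y => S.coeff_add x y E) f s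

@[simp]
theorem coeff_monomial_smul (β : ℝ) (a : k) (x : C) (E : ℝ) :
    S.coeff (novMonomial β a • x) E = a • S.coeff x (E - β) := by
  simp [coeff]

@[simp]
theorem coeff_novT_smul (β : ℝ) (x : C) (E : ℝ) :
    S.coeff (novT k β • x) E = S.coeff x (E - β) := by
  simp [novT_eq]

open Classical in
theorem coeff_incl (x : Cbar) (E : ℝ) : S.coeff (S.incl x) E = if E = 0 then x else 0 := by
  simp [coeff, incl, NovExt.coeff_incl]

@[simp]
theorem coeff_incl_zero (x : Cbar) : S.coeff (S.incl x) 0 = x := by simp [coeff_incl]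

theorem coeff_incl_of_ne (x : Cbar) {E : ℝ} (hE : E ≠ 0) : S.coeff (S.incl x) E = 0 := by
  simp [coeff_incl, hE]

theorem incl_add (x y : Cbar) : S.incl (x + y) = S.incl x + S.incl y :=
  S.ext_coeff fun E => by
    classical
    simp only [coeff_add, coeff_incl]
    split_ifs <;> simp

theorem incl_smul (a : k) (x : Cbar) : S.incl (a • x) = novMonomial 0 a • S.incl x :=
  S.ext_coeff fun E => by
    classical
    simp only [coeff_monomial_smul, coeff_incl, sub_zero]
    split_ifs <;> simp

theorem incl_zero : S.incl 0 = 0 := S.ext_coeff fun E => by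
  classical
  simp [coeff_incl]

theorem incl_neg (x : Cbar) : S.incl (-x) = -S.incl x := by
  rw [eq_neg_iff_add_eq_zero, ← incl_add, neg_add_cancel, incl_zero]

theorem norm_le_exp_iff (x : C) (γ : ℝ) :
    ‖x‖ ≤ Real.exp (-γ) ↔ ∀ E < γ, S.coeff x E = 0 := by
  rw [← S.norm_map]
  exact NovExt.norm_le_exp_iff _ _

theorem norm_lt_exp_iff (x : C) (γ : ℝ) :
    ‖x‖ < Real.exp (-γ) ↔ ∀ E ≤ γ, S.coeff x E = 0 := by
  rw [← S.norm_map]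
  exact NovExt.norm_lt_exp_iff _ _

/-- The elements of valuation at least `γ`. -/
def ge (γ : ℝ) : AddSubgroup C where
  carrier := {x | ∀ E < γ, S.coeff x E = 0}
  add_mem' hx hy E hE := by rw [coeff_add, hx E hE, hy E hE, add_zero]
  zero_mem' E _ := S.coeff_zero E
  neg_mem' hx E hE := by rw [coeff_neg, hx E hE, neg_zero]

theorem ge_anti {a b : ℝ} (h : a ≤ b) : S.ge b ≤ S.ge a := fun _ hx E hE =>
  hx E (lt_of_lt_of_le hE h)

theorem incl_mem_ge (x : Cbar) : S.incl x ∈ S.ge 0 := fun _ hE => S.coeff_incl_of_ne x hE.ne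

theorem monomial_smul_mem_ge {x : C} {γ : ℝ} (hx : x ∈ S.ge γ) (β : ℝ) (a : k) :
    novMonomial β a • x ∈ S.ge (β + γ) := fun E hE => by
  rw [coeff_monomial_smul, hx _ (by linarith), smul_zero]

/-- A set defined by conditions on coefficients is closed. -/
theorem isClosed_coeff (P : ℝ → Set Cbar) : IsClosed {x : C | ∀ E, S.coeff x E ∈ P E} := by
  rw [← isOpen_compl_iff, Metric.isOpen_iff]
  intro x hx
  simp only [Set.mem_compl_iff, Set.mem_ofPred_eq, not_forall] at hx
  obtain ⟨E, hE⟩ := hx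
  -- The coefficient of `T ^ E` is constant on open balls of radius `exp (-E)`.
  refine ⟨Real.exp (-E), Real.exp_pos _, fun y hy hy' => hE ?_⟩
  rw [Metric.mem_ball, dist_eq_norm, S.norm_lt_exp_iff] at hy
  have h1 := hy E le_rfl
  rw [coeff_sub, sub_eq_zero] at h1
  rw [← h1]
  exact hy' E

theorem isClosed_ge (γ : ℝ) : IsClosed (S.ge γ : Set C) := by
  have : (S.ge γ : Set C) = {x : C | ∀ E, S.coeff x E ∈ {y : Cbar | E < γ → y = 0}} := by
    ext x; exact Iff.rfl
  rw [this]
  exact S.isClosed_coeff _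

/-- An element is the sum of its coefficients. -/
theorem hasSum_coeff {B : Type*} (e : B → ℝ) (he : Function.Injective e)
    (hfin : ∀ E : ℝ, {b | e b ≤ E}.Finite) (x : C) (hx : ∀ E, S.coeff x E ≠ 0 → E ∈ Set.range e) :
    HasSum (fun b => novT k (e b) • S.incl (S.coeff x (e b))) x := by
  classical
  rw [HasSum, SummationFilter.unconditional_filter, Metric.tendsto_atTop]
  intro ε hε
  -- All exponents up to `-log ε` are included, so what is left out has norm less than `ε = exp
  -- (-(-log ε))`.
  refine ⟨(hfin (-Real.log ε)).toFinset, fun s hs => ?_⟩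
  rw [dist_eq_norm]
  have h1 : ε = Real.exp (-(-Real.log ε)) := by rw [neg_neg, Real.exp_log hε]
  rw [h1, S.norm_lt_exp_iff]
  intro E hE
  rw [coeff_sub, sub_eq_zero, coeff_sum]
  simp only [coeff_novT_smul, coeff_incl, sub_eq_zero]
  by_cases h : ∃ b ∈ s, E = e b
  · obtain ⟨b, hb, rfl⟩ := h
    rw [Finset.sum_eq_single b]
    · simp
    · intro b' _ hb'
      rw [if_neg]
      exact fun h => hb' (he h.symm)
    · exact fun h => absurd hb h
  · have h0 : S.coeff x E = 0 := by
      by_contra h0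
      obtain ⟨b, rfl⟩ := hx E h0
      exact h ⟨b, hs (by simpa using hE), rfl⟩
    rw [h0]
    refine Finset.sum_eq_zero fun b hb => if_neg fun h' => h ⟨b, hb, h'⟩

-- Partial sums over large enough sets agree with the limit in the coefficient of `T ^ E`, and in a
-- finite sum that coefficient comes from the only index with exponent `E`.
open Classical in
theorem coeff_of_hasSum {B : Type*} {e : B → ℝ} (he : Function.Injective e) {y : B → Cbar} {x : C}
    (h : HasSum (fun b => novT k (e b) • S.incl (y b)) x) (E : ℝ) :
    S.coeff x E = if hE : ∃ b, e b = E then y hE.choose else 0 := by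
  rw [HasSum, SummationFilter.unconditional_filter, Metric.tendsto_atTop] at h
  obtain ⟨s, hs⟩ := h (Real.exp (-E)) (Real.exp_pos _)
  have key : ∀ s' ≥ s, S.coeff x E = ∑ b ∈ s', if E = e b then y b else 0 := by
    intro s' hs'
    have h1 := hs s' hs'
    rw [dist_eq_norm, S.norm_lt_exp_iff] at h1
    have h2 := h1 E le_rfl
    rw [coeff_sub, sub_eq_zero, coeff_sum] at h2
    rw [← h2]
    simp only [coeff_novT_smul, coeff_incl, sub_eq_zero]
  split_ifs with hE
  · rw [key (insert hE.choose s) (Finset.subset_insert _ _), Finset.sum_eq_single hE.choose]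
    · rw [if_pos hE.choose_spec.symm]
    · intro b _ hb
      rw [if_neg]
      intro h
      exact hb (he (h.symm.trans hE.choose_spec.symm))
    · exact fun h => absurd (Finset.mem_insert_self _ _) h
  · rw [key s le_rfl]
    exact Finset.sum_eq_zero fun b _ => if_neg fun h => hE ⟨b, h.symm⟩

theorem coeff_of_hasSum_apply {B : Type*} {e : B → ℝ} (he : Function.Injective e) {y : B → Cbar}
    {x : C} (h : HasSum (fun b => novT k (e b) • S.incl (y b)) x) (b : B) :
    S.coeff x (e b) = y b := by
  have hE : ∃ b', e b' = e b := ⟨b, rfl⟩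
  rw [S.coeff_of_hasSum he h, dif_pos hE, he hE.choose_spec]

theorem coeff_of_hasSum_eq_zero {B : Type*} {e : B → ℝ} (he : Function.Injective e) {y : B → Cbar}
    {x : C} (h : HasSum (fun b => novT k (e b) • S.incl (y b)) x) {E : ℝ} (hE : ∀ b, e b ≠ E) :
    S.coeff x E = 0 := by
  rw [S.coeff_of_hasSum he h, dif_neg]
  rintro ⟨b, hb⟩
  exact hE b hb

theorem leftFinite_support (x : C) : LeftFinite (Function.support (S.coeff x)) :=
  (S.equiv x).leftFinite_support

/-- An element whose coefficients lie in the span of a set `Γ` is a limit of sums of monomials with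
coefficients in `Γ`. -/
theorem mem_closure_of_coeff {x : C} {F : Set ℝ} {Γ : Set Cbar}
    (hF : ∀ E, S.coeff x E ≠ 0 → E ∈ F) (hΓ : ∀ E, S.coeff x E ∈ Submodule.span k Γ) :
    x ∈ closure (AddSubgroup.closure
      {z : C | ∃ E ∈ F, ∃ a : k, ∃ y ∈ Γ, z = novMonomial E a • S.incl y} : Set C) := by
  set A := AddSubgroup.closure {z : C | ∃ E ∈ F, ∃ a : k, ∃ y ∈ Γ, z = novMonomial E a • S.incl y}
  have h := S.hasSum_coeff (B := Function.support (S.coeff x)) (fun b => b.1)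
    Subtype.val_injective (fun E => by
      refine Set.Finite.of_finite_image (f := Subtype.val)
        ((S.leftFinite_support x E).subset ?_) Subtype.val_injective.injOn
      rintro _ ⟨b, hb, rfl⟩
      exact ⟨b.2, hb⟩) x (fun E hE => ⟨⟨E, hE⟩, rfl⟩)
  refine mem_closure_of_tendsto h (Filter.Eventually.of_forall fun s => ?_)
  refine A.sum_mem fun b _ => ?_
  have hb := hF _ b.2
  have h1 := hΓ b.1
  refine Submodule.span_induction (p := fun y _ => novT k b.1 • S.incl y ∈ A) ?_ ?_ ?_ ?_ h1
  · intro y hy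
    exact AddSubgroup.subset_closure ⟨b.1, hb, 1, y, hy, rfl⟩
  · rw [incl_zero, smul_zero]; exact zero_mem _
  · intro y z _ _ hy hz
    rw [incl_add, smul_add]; exact add_mem hy hz
  · intro a y _ hy
    rw [incl_smul, smul_comm]
    refine AddSubgroup.closure_induction (p := fun z _ => novMonomial 0 a • z ∈ A) ?_ ?_ ?_ ?_ hy
    · rintro _ ⟨E, hE, a', y', hy', rfl⟩
      refine AddSubgroup.subset_closure ⟨E, hE, a * a', y', hy', ?_⟩
      apply S.ext_coeff
      simp [mul_smul]
    · rw [smul_zero]; exact zero_mem _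
    · intro z z' _ _ hz hz'; rw [smul_add]; exact add_mem hz hz'
    · intro z _ hz; rw [smul_neg]; exact neg_mem hz

end KStructure

/-! ### Continuous multilinear functions of lists -/

/-- The map is `Λ`-linear and continuous. -/
def IsContLinear (h : C → C) : Prop :=
  Continuous h ∧ IsAdd h ∧ ∀ (r : Novikov k) (x : C), h (r • x) = r • h x

theorem IsContLinear.add (f g : C → C) (hf : IsContLinear (k := k) f)
    (hg : IsContLinear (k := k) g) : IsContLinear (k := k) (fun x => f x + g x) :=
  ⟨hf.1.add hg.1, hf.2.1.add hg.2.1, fun r x => by simp only [hf.2.2 r x, hg.2.2 r x, smul_add]⟩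

theorem IsContLinear.comp (f g : C → C) (hf : IsContLinear (k := k) f)
    (hg : IsContLinear (k := k) g) : IsContLinear (k := k) (fun x => f (g x)) :=
  ⟨hf.1.comp hg.1, hf.2.1.comp hg.2.1, fun r x => by simp only [hg.2.2 r x, hf.2.2 r _]⟩

/-- The function of lists is `Λ`-multilinear and separately continuous. -/
abbrev IsContMultilinear (φ : List C → C) : Prop := Slotwise (IsContLinear (k := k)) φ

theorem IsContMultilinear.isAdd {φ : List C → C} (h : IsContMultilinear (k := k) φ) :
    Slotwise IsAdd φ := fun u w => (h u w).2.1

theorem IsContMultilinear.add {φ χ : List C → C} (h : IsContMultilinear (k := k) φ)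
    (h' : IsContMultilinear (k := k) χ) : IsContMultilinear (k := k) (fun l => φ l + χ l) :=
  fun u w => (h u w).add _ _ (h' u w)

theorem IsContMultilinear.neg {φ : List C → C} (h : IsContMultilinear (k := k) φ) :
    IsContMultilinear (k := k) (fun l => -φ l) := fun u w =>
  ⟨(h u w).1.neg, fun x y => by simp only [(h u w).2.1 x y, neg_add],
    fun r x => by simp only [(h u w).2.2 r x, smul_neg]⟩

theorem IsContMultilinear.sub {φ χ : List C → C} (h : IsContMultilinear (k := k) φ)
    (h' : IsContMultilinear (k := k) χ) : IsContMultilinear (k := k) (fun l => φ l - χ l) := by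
  simpa only [sub_eq_add_neg] using h.add h'.neg

theorem evalList_of_length (f : ∀ n : ℕ, MultilinearMap (Novikov k) (fun _ : Fin n => C) C)
    {α : List C} {n : ℕ} (h : α.length = n) :
    evalList f α = f n (fun i => α.get (i.cast h.symm)) := by
  subst h; rfl

/-- With all other inputs fixed, the product bound on the norm is a linear bound in the remaining
one. -/
theorem isContMultilinear_evalList
    {f : ∀ n : ℕ, MultilinearMap (Novikov k) (fun _ : Fin n => C) C}
    (hf : ∀ (n : ℕ) (α : Fin n → C), ‖f n α‖ ≤ ∏ i, ‖α i‖) :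
    IsContMultilinear (k := k) (evalList f) := by
  intro u w
  set n := u.length + (w.length + 1) with hn
  have hlen : ∀ x : C, (u ++ x :: w).length = n := fun x => by simp [hn]
  set i₀ : Fin n := ⟨u.length, by omega⟩ with hi₀
  set b : Fin n → C := fun i => (u ++ (0 : C) :: w).get (i.cast (hlen 0).symm)
  have key : ∀ x, evalList f (u ++ x :: w) = (f n).toLinearMap b i₀ x := by
    intro x
    rw [evalList_of_length f (hlen x), MultilinearMap.toLinearMap_apply]
    congr 1
    funext i
    by_cases hi : i = i₀
    · subst hi
      simp [i₀]
    · rw [Function.update_of_ne hi]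
      have hi' : (i : ℕ) ≠ u.length := fun h => hi (Fin.ext h)
      simp only [b, List.get_eq_getElem, Fin.val_cast, List.getElem_append]
      split_ifs with h
      · rfl
      · obtain ⟨j, hj⟩ : ∃ j, (i : ℕ) - u.length = j + 1 := ⟨i - u.length - 1, by omega⟩
        simp only [hj, List.getElem_cons_succ]
  have hcont : Continuous ((f n).toLinearMap b i₀) := by
    refine AddMonoidHomClass.continuous_of_bound ((f n).toLinearMap b i₀)
      (∏ i ∈ Finset.univ.erase i₀, ‖b i‖) fun x => ?_
    rw [MultilinearMap.toLinearMap_apply]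
    refine (hf n _).trans_eq ?_
    rw [← Finset.mul_prod_erase _ _ (Finset.mem_univ i₀), Function.update_self, mul_comm]
    congr 1
    refine Finset.prod_congr rfl fun i hi => ?_
    rw [Function.update_of_ne (Finset.ne_of_mem_erase hi)]
  refine ⟨?_, ?_, ?_⟩
  · simp only [key]; exact hcont
  · intro x y; simp only [key, map_add]
  · intro r x; simp only [key, map_smul]

namespace KStructure

variable (S : KStructure gr grbar)

/-- To prove that the values of a continuous multilinear function lie in a closed subgroup, it is
enough to consider generators. -/
theorem slotwise_mem {φ : List C → C} (hφ : IsContMultilinear (k := k) φ) {Q : AddSubgroup C}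
    (hQ : IsClosed (Q : Set C)) {F : Set ℝ}
    (hF : ∀ E ∈ F, ∀ (a : k), ∀ q ∈ Q, novMonomial E a • q ∈ Q) {ξ : Type*} (Γ : ξ → Set Cbar)
    {d : List ξ} (h : ∀ β : List Cbar, List.Forall₂ (fun b i => b ∈ Γ i) β d →
      φ (β.map S.incl) ∈ Q)
    {α : List C} (hα : List.Forall₂ (fun x i => (∀ E, S.coeff x E ≠ 0 → E ∈ F) ∧
      ∀ E, S.coeff x E ∈ Submodule.span k (Γ i)) α d) : φ α ∈ Q := by
  -- The entries are replaced by generators one at a time from the left; `β` collects those already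
  -- replaced. Thus separate continuity suffices.
  suffices H : ∀ (β : List Cbar) (d' : List ξ), List.Forall₂ (fun b i => b ∈ Γ i) β d' →
      (∀ β : List Cbar, List.Forall₂ (fun b i => b ∈ Γ i) β (d' ++ d) → φ (β.map S.incl) ∈ Q) →
      φ (β.map S.incl ++ α) ∈ Q from H [] [] .nil h
  clear h
  induction hα with
  | nil => intro β d' hβ h; simpa using h β (by simpa using hβ)
  | @cons x i w dw hx hw ih =>
    intro β d' hβ h
    have h1 := S.mem_closure_of_coeff hx.1 hx.2
    have hcl := hφ (β.map S.incl) w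
    let Q' : AddSubgroup C := Q.comap
      (AddMonoidHom.mk' (fun x => φ (β.map S.incl ++ x :: w)) fun x y => hcl.2.1 x y)
    have hQ' : IsClosed (Q' : Set C) := hQ.preimage hcl.1
    have h2 : AddSubgroup.closure {z : C | ∃ E ∈ F, ∃ a : k, ∃ y ∈ Γ i,
        z = novMonomial E a • S.incl y} ≤ Q' := by
      rw [AddSubgroup.closure_le]
      rintro _ ⟨E, hE, a, y, hy, rfl⟩
      change φ (β.map S.incl ++ (novMonomial E a • S.incl y) :: w) ∈ Q
      rw [show φ (β.map S.incl ++ (novMonomial E a • S.incl y) :: w)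
        = novMonomial E a • φ (β.map S.incl ++ S.incl y :: w) from hcl.2.2 _ _]
      refine hF E hE a _ ?_
      have := ih (β ++ [y]) (d' ++ [i]) (List.rel_append hβ (.cons hy .nil))
        (by simpa using h)
      simpa using this
    exact hQ'.closure_subset_iff.mpr h2 h1

/-- A multilinear map with prescribed gapped components. -/
theorem exists_extension {G : AddSubmonoid ℝ} (hG_nonneg : ∀ x ∈ G, 0 ≤ x)
    (hG_finite : ∀ E : ℝ, {x : ℝ | x ∈ G ∧ x ≤ E}.Finite) (n : ℕ)
    (g : G → MultilinearMap k (fun _ : Fin n => Cbar) Cbar) :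
    ∃ f : MultilinearMap (Novikov k) (fun _ : Fin n => C) C,
      (∀ α : Fin n → C, ‖f α‖ ≤ ∏ i, ‖α i‖) ∧
      ∀ x : Fin n → Cbar, HasSum (fun β : G => novT k β • S.incl (g β x))
        (f (fun i => S.incl (x i))) := by
  classical
  -- Exponents outside `G` get coefficient zero; the support is left-finite because `G` is finite
  -- below every bound.
  let g' : NovExt k (MultilinearMap k (fun _ : Fin n => Cbar) Cbar) :=
    NovExt.ofCoeff (fun E => if h : E ∈ G then g ⟨E, h⟩ else 0) (by
      intro E
      refine (hG_finite E).subset ?_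
      rintro t ⟨h1, h2⟩
      refine ⟨?_, h2⟩
      by_contra h
      exact h1 (dif_neg h))
  let f : MultilinearMap (Novikov k) (fun _ : Fin n => C) C :=
    S.equiv.symm.toLinearMap.compMultilinearMap
      ((NovExt.extend n g').compLinearMap fun _ => S.equiv.toLinearMap)
  have hf : ∀ α, S.equiv (f α) = NovExt.extend n g' (fun i => S.equiv (α i)) := fun α => by
    simp [f]
  refine ⟨f, fun α => ?_, fun x => ?_⟩
  · by_cases h0 : ∃ i, α i = 0
    · obtain ⟨i, hi⟩ := h0
      rw [f.map_coord_zero i hi, norm_zero]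
      exact Finset.prod_nonneg fun i _ => norm_nonneg _
    -- For nonzero inputs the norms are written as `exp (-b i)`, and the bound becomes additivity of
    -- valuations.
    · push Not at h0
      have h1 : ∀ i, ∃ b : ℝ, ‖α i‖ = Real.exp (-b) := by
        intro i
        refine ⟨-Real.log ‖α i‖, ?_⟩
        rw [neg_neg, Real.exp_log (norm_pos_iff.mpr (h0 i))]
      choose b hb using h1
      simp only [hb]
      rw [← Real.exp_sum, Finset.sum_neg_distrib, S.norm_le_exp_iff]
      intro E hE
      rw [coeff, hf]
      refine NovExt.coeff_extend_eq_zero n g' (a := 0) (fun E hE => ?_) _ b (fun i => ?_) E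
        (by simpa using hE)
      · exact dif_neg fun h => not_lt.mpr (hG_nonneg E h) hE
      · exact (S.norm_le_exp_iff (α i) (b i)).mp (hb i).le
  · have hc : ∀ E, S.coeff (f fun i => S.incl (x i)) E = g'.coeff E x := by
      intro E
      rw [coeff, hf]
      have : (fun i => S.equiv (S.incl (x i))) = fun i => NovExt.incl k (x i) := by
        funext i; simp [incl]
      rw [this, NovExt.coeff_extend_incl]
    have h := S.hasSum_coeff (B := G) (fun b => b.1) Subtype.val_injective
      (fun E => by
        refine Set.Finite.of_finite_image (f := Subtype.val)
          ((hG_finite E).subset ?_) Subtype.val_injective.injOn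
        rintro _ ⟨b, hb, rfl⟩
        exact ⟨b.2, hb⟩) (f fun i => S.incl (x i)) (fun E hE => by
        rw [hc] at hE
        by_contra h
        refine hE ?_
        have : g'.coeff E = 0 := dif_neg fun h' => h ⟨⟨E, h'⟩, rfl⟩
        rw [this]; rfl)
    convert h using 4 with β
    rw [hc]
    have : g'.coeff β = g β := dif_pos β.2
    rw [this]

end KStructure

end KCoefficients

/-! ### Leading terms in the list calculus -/

section LeadingTerms

variable {A C D W : Type*} [AddCommGroup C] [AddCommGroup D] [AddCommGroup W]

theorem splitSum_eq_sum (ψ : List A → List A → W) (l : List A) :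
    splitSum ψ l = ∑ q ∈ Finset.range (l.length + 1), ψ (l.take q) (l.drop q) := by
  induction l generalizing ψ with
  | nil => simp [splitSum_nil]
  | cons x t ih =>
    rw [splitSum_cons, ih, List.length_cons, Finset.sum_range_succ' _ (t.length + 1), add_comm]
    simp

theorem insertOp_eq_sum (σ : C → C) (m : List C → C) (φ : List C → W) (l : List C) :
    insertOp σ m φ l = ∑ p ∈ Finset.range (l.length + 1), ∑ q ∈ Finset.range (l.length + 1 - p),
      φ ((l.take p).map σ ++ m ((l.drop p).take q) :: l.drop (p + q)) := by
  induction l generalizing φ with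
  | nil => simp [insertOp_nil]
  | cons x t ih =>
    rw [insertOp_cons, ih, splitSum_eq_sum, add_comm]
    refine Eq.trans ?_ (Finset.sum_range_succ' _ (t.length + 1)).symm
    refine congrArg₂ (· + ·) ?_ ?_
    · refine Finset.sum_congr rfl fun p _ => ?_
      rw [List.length_cons, show t.length + 1 + 1 - (p + 1) = t.length + 1 - p by omega]
      refine Finset.sum_congr rfl fun q _ => ?_
      rw [show p + 1 + q = p + q + 1 from by omega]
      simp
    · simp

theorem splitSum_eq_nil_left {ψ : List A → List A → W} {l : List A}
    (h : ∀ u v, u ++ v = l → u ≠ [] → ψ u v = 0) : splitSum ψ l = ψ [] l := by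
  cases l with
  | nil => rfl
  | cons x t =>
    rw [splitSum_cons, splitSum_zero, add_zero]
    exact fun u v huv => h (x :: u) v (by simp [huv]) (by simp)

theorem splitSum_concat {ψ : List A → List A → W} {s : List A} {y : A}
    (h : ∀ u v, u ++ v = s ++ [y] → 2 ≤ v.length → ψ u v = 0) :
    splitSum ψ (s ++ [y]) = ψ s [y] + ψ (s ++ [y]) [] := by
  induction s generalizing ψ with
  | nil => rfl
  | cons x t ih =>
    rw [List.cons_append, splitSum_cons, h [] (x :: (t ++ [y])) rfl (by simp), zero_add, ih]
    exact fun u v huv => h (x :: u) v (by simp [huv])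

theorem blockSum_congr {f g : List C → D} {φ : List D → W} {l : List C}
    (h : ∀ b : List C, b ≠ [] → b.length ≤ l.length → f b = g b) :
    blockSum f φ l = blockSum g φ l := by
  induction hl : l.length using Nat.strong_induction_on generalizing l φ with
  | _ n ih =>
    cases l with
    | nil => rfl
    | cons x t =>
      rw [blockSum_cons, blockSum_cons]
      refine splitSum_congr fun u v huv => ?_
      have h1 : u.length + v.length = t.length := by rw [← huv, List.length_append]
      have h2 : t.length + 1 = n := hl
      rw [h (x :: u) (by simp) (by simp; omega)]
      exact ih v.length (by omega) (fun b hb hb' => h b hb (by simp; omega)) rfl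

/-- Only the decomposition with a single block evaluates `f` or `g` on a list of full length. -/
theorem blockSum_sub_of_agree {f g : List C → D} {φ : List D → W} {l : List C} (hl : l ≠ [])
    (h : ∀ b : List C, b ≠ [] → b.length < l.length → f b = g b) :
    blockSum f φ l - blockSum g φ l = φ [f l] - φ [g l] := by
  obtain ⟨x, t, rfl⟩ := List.exists_cons_of_ne_nil hl
  rw [blockSum_cons, blockSum_cons, sub_eq_add_neg, ← splitSum_neg, ← splitSum_add]
  have key : ∀ u v, u ++ v = t → v ≠ [] →
      blockSum f (fun l => φ (f (x :: u) :: l)) v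
        + -blockSum g (fun l => φ (g (x :: u) :: l)) v = 0 := by
    intro u v huv hv
    have h1 : u.length + v.length = t.length := by rw [← huv, List.length_append]
    have h2 := List.length_pos_of_ne_nil hv
    rw [h (x :: u) (by simp) (by simp; omega), blockSum_congr (g := g), add_neg_cancel]
    exact fun b hb hb' => h b hb (by simp; omega)
  rcases List.eq_nil_or_concat t with rfl | ⟨s, y, rfl⟩
  · simp [splitSum_nil, blockSum_nil, sub_eq_add_neg]
  · rw [List.concat_eq_append] at *
    rw [splitSum_concat fun u v huv hv => key u v huv (by rintro rfl; simp at hv),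
      key s [y] rfl (by simp), zero_add, blockSum_nil, blockSum_nil, sub_eq_add_neg]

/-- The part of `blockSum f φ` linear in the values of `f` on lists one shorter. -/
theorem blockSum_sub_eq_two {f g : List C → D} {φ : List D → W} (hφ : Slotwise IsAdd φ)
    (hφ1 : ∀ x, φ [x] = 0) {x y : C} {s t : List C} (hst : x :: t = s ++ [y])
    (ht : t ≠ []) (h : ∀ b : List C, b ≠ [] → b.length < t.length → f b = g b) :
    blockSum f φ (x :: t) - blockSum g φ (x :: t)
      = φ [f s - g s, f [y]] + φ [g [x], f t - g t] := by
  have hsub1 : ∀ a b c, φ [a - b, c] = φ [a, c] - φ [b, c] := fun a b c =>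
    IsAdd.map_sub (hφ [] [c]) a b
  have hsub2 : ∀ a b c, φ [c, a - b] = φ [c, a] - φ [c, b] := fun a b c =>
    IsAdd.map_sub (hφ [c] []) a b
  obtain ⟨t', z, rfl⟩ : ∃ t' z, t = t' ++ [z] := by
    rcases List.eq_nil_or_concat t with h | ⟨s, y, h⟩
    · exact absurd h ht
    · exact ⟨s, y, by rw [h, List.concat_eq_append]⟩
  rw [← List.cons_append] at hst
  obtain ⟨h1, h2⟩ := List.append_inj' hst rfl
  obtain rfl : z = y := by simpa using h2
  subst h1
  rw [blockSum_cons, blockSum_cons, sub_eq_add_neg, ← splitSum_neg, ← splitSum_add]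
  have key : ∀ u v, u ++ v = t' ++ [z] → u ≠ [] → 2 ≤ v.length →
      blockSum f (fun l => φ (f (x :: u) :: l)) v
        + -blockSum g (fun l => φ (g (x :: u) :: l)) v = 0 := by
    intro u v huv hu hv
    have h1 : u.length + v.length = t'.length + 1 := by rw [← List.length_append, huv]; simp
    have h2 := List.length_pos_of_ne_nil hu
    rw [h (x :: u) (by simp) (by simp; omega), blockSum_congr (g := g), add_neg_cancel]
    exact fun b hb hb' => h b hb (by simp; omega)
  cases t' with
  | nil =>
    simp only [List.nil_append, splitSum_cons, splitSum_nil, blockSum_cons, blockSum_nil, hφ1]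
    rw [hsub1, hsub2]
    abel
  | cons a r =>
    have hx : f [x] = g [x] := h _ (by simp) (by simp)
    have hz : f [z] = g [z] := h _ (by simp) (by simp)
    rw [List.cons_append, splitSum_cons, splitSum_concat fun u v huv hv =>
      key (a :: u) v (by simp [huv]) (by simp) hv, hx, ← sub_eq_add_neg,
      ← List.cons_append, blockSum_sub_of_agree ht h]
    simp only [blockSum_nil, hφ1, blockSum_cons, splitSum_nil, hz, hsub1, hsub2, List.cons_append]
    abel

theorem blockSumAt_eq_zero {σ : D → D} {f X : List C → D} {φ : List D → W}
    (hφ : Slotwise IsAdd φ) {l : List C}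
    (h : ∀ b : List C, b ≠ [] → b.length ≤ l.length → X b = 0) : blockSumAt σ f X φ l = 0 := by
  induction hl : l.length using Nat.strong_induction_on generalizing l φ with
  | _ n ih =>
    cases l with
    | nil => rfl
    | cons x t =>
      rw [blockSumAt_cons]
      refine splitSum_zero fun u v huv => ?_
      have h1 : u.length + v.length = t.length := by rw [← huv, List.length_append]
      have h2 : t.length + 1 = n := hl
      rw [h (x :: u) (by simp) (by simp; omega), ih v.length (by omega) (hφ.cons _)
        (fun b hb hb' => h b hb (by simp; omega)) rfl, add_zero]
      refine blockSum_zero fun bs _ _ => (hφ.head _).map_zero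

/-- If there are at least two blocks, `X` is evaluated on a shorter list, where it vanishes. -/
theorem blockSumAt_eq_whole {σ : D → D} {f X : List C → D} {φ : List D → W}
    (hφ : Slotwise IsAdd φ) {l : List C} (hl : l ≠ [])
    (h : ∀ b : List C, b ≠ [] → b.length < l.length → X b = 0) :
    blockSumAt σ f X φ l = φ [X l] := by
  obtain ⟨x, t, rfl⟩ := List.exists_cons_of_ne_nil hl
  rw [blockSumAt_cons]
  have key : ∀ u v, u ++ v = t → v ≠ [] → blockSum f (fun l => φ (X (x :: u) :: l)) v
      + blockSumAt σ f X (fun l => φ (σ (f (x :: u)) :: l)) v = 0 := by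
    intro u v huv hv
    have h1 : u.length + v.length = t.length := by rw [← huv, List.length_append]
    have h2 := List.length_pos_of_ne_nil hv
    rw [blockSumAt_eq_zero (hφ.cons _) (fun b hb hb' => h b hb (by simp; omega)), add_zero]
    refine blockSum_zero fun bs _ _ => ?_
    rw [h (x :: u) (by simp) (by simp; omega)]
    exact (hφ.head _).map_zero
  rcases List.eq_nil_or_concat t with rfl | ⟨s, y, rfl⟩
  · simp [splitSum_nil, blockSum_nil, blockSumAt]
  · rw [List.concat_eq_append] at *
    rw [splitSum_concat fun u v huv hv => key u v huv (by rintro rfl; simp at hv),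
      key s [y] rfl (by simp), zero_add, blockSum_nil]
    simp [blockSumAt]

/-- The block carrying `X` omits at most one entry of the list. The block equal to the whole list is
killed by `φ [x] = 0`, so `X` sees either all entries but the last or all but the first. -/
theorem blockSumAt_eq_two {σ : D → D} {f X : List C → D} {φ : List D → W}
    (hφ : Slotwise IsAdd φ) (hφ1 : ∀ x, φ [x] = 0) {x y : C} {s t : List C}
    (hst : x :: t = s ++ [y]) (ht : t ≠ [])
    (h : ∀ b : List C, b ≠ [] → b.length < t.length → X b = 0) :
    blockSumAt σ f X φ (x :: t) = φ [X s, f [y]] + φ [σ (f [x]), X t] := by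
  obtain ⟨t', z, rfl⟩ : ∃ t' z, t = t' ++ [z] := by
    rcases List.eq_nil_or_concat t with h | ⟨s, y, h⟩
    · exact absurd h ht
    · exact ⟨s, y, by rw [h, List.concat_eq_append]⟩
  rw [← List.cons_append] at hst
  obtain ⟨h1, h2⟩ := List.append_inj' hst rfl
  obtain rfl : z = y := by simpa using h2
  subst h1
  rw [blockSumAt_cons, splitSum_add, splitSum_concat]
  · rw [splitSum_eq_nil_left, blockSumAt_eq_whole (hφ.cons _) ht h, blockSum_nil, hφ1, add_zero,
      blockSum_cons, splitSum_nil, blockSum_nil]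
    intro u v huv hu
    have h1 : u.length + v.length = t'.length + 1 := by rw [← List.length_append, huv]; simp
    have h2 := List.length_pos_of_ne_nil hu
    exact blockSumAt_eq_zero (hφ.cons _) fun b hb hb' => h b hb (by simp; omega)
  · intro u v huv hv
    have h1 : u.length + v.length = t'.length + 1 := by rw [← List.length_append, huv]; simp
    refine blockSum_zero fun bs _ _ => ?_
    rw [h (x :: u) (by simp) (by simp; omega)]
    exact (hφ.head _).map_zero

/-- The part of `insertOp` that inserts a binary operation. -/
def adjacentOp (σ : C → C) (m : List C → C) : (List C → W) → List C → W
  | _, [] => 0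
  | _, [_] => 0
  | φ, x :: y :: t => φ (m [x, y] :: t) + adjacentOp σ m (fun l => φ (σ x :: l)) (y :: t)

/-- Inserting an operation on `q` entries shortens the list by `q - 1`. The hypothesis on `φ`
excludes `q > 2`, and the vanishing of `m` excludes `q < 2`. -/
theorem insertOp_eq_adjacentOp {σ : C → C} {m : List C → C} (hm0 : m [] = 0)
    (hm1 : ∀ x, m [x] = 0) {φ : List C → W} (hφ : Slotwise IsAdd φ) {l : List C}
    (h : ∀ b : List C, b.length + 1 < l.length → φ b = 0) :
    insertOp σ m φ l = adjacentOp σ m φ l := by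
  have h0 : ∀ {φ : List C → W}, Slotwise IsAdd φ → ∀ t, φ (0 :: t) = 0 :=
    fun hφ t => (hφ.head t).map_zero
  induction l generalizing φ with
  | nil => rw [insertOp_nil, hm0, h0 hφ]; rfl
  | cons x t ih =>
    rw [insertOp_cons, ih (hφ.cons _) fun b hb => h _ (by simp at hb ⊢; omega)]
    cases t with
    | nil => simp [splitSum_cons, splitSum_nil, adjacentOp, hm0, hm1, h0 hφ]
    | cons y r =>
      rw [adjacentOp, splitSum_cons, splitSum_cons, splitSum_eq_nil_left, hm0, hm1, h0 hφ, h0 hφ]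
      · simp
      · intro u v huv hu
        have h1 : u.length + v.length = r.length := by rw [← List.length_append, huv]
        have h2 := List.length_pos_of_ne_nil hu
        exact h _ (by simp; omega)

end LeadingTerms

/-! ### Multilinear maps with given values on words in a basis -/

section WordMap

variable {k : Type*} [Field k] {M M' κ : Type*} [AddCommGroup M] [Module k M]
  [AddCommGroup M'] [Module k M']

/-- The multilinear map with given values on words in a basis. -/
def wordMap (e : Module.Basis κ k M) : ∀ n : ℕ, (List κ → M') →
    MultilinearMap k (fun _ : Fin n => M) M'
  | 0, Ψ => MultilinearMap.constOfIsEmpty k _ (Ψ [])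
  | n + 1, Ψ => LinearMap.uncurryLeft (e.constr k fun I => wordMap e n fun w => Ψ (I :: w))

theorem wordMap_apply (e : Module.Basis κ k M) (n : ℕ) (Ψ : List κ → M') (v : Fin n → κ) :
    wordMap e n Ψ (fun i => e (v i)) = Ψ (List.ofFn v) := by
  induction n generalizing Ψ with
  | zero => simp [wordMap]
  | succ n ih =>
    rw [wordMap, LinearMap.uncurryLeft_apply, Module.Basis.constr_basis, List.ofFn_succ]
    exact ih _ _

end WordMap

namespace KStructure

variable {k : Type*} [Field k] {N : ℕ}
  {C : Type*} [NormedAddCommGroup C] [Module (Novikov k) C]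
  {Cbar : Type*} [AddCommGroup Cbar] [Module k Cbar]
  {gr : ZMod N → Submodule (Novikov k) C} {grbar : ZMod N → Submodule k Cbar}
  (S : KStructure gr grbar)

/-! ### Leading coefficients -/

theorem exists_monomial_smul {x : C} {γ : ℝ} (hx : x ∈ S.ge γ) :
    ∃ y ∈ S.ge 0, x = novMonomial γ (1 : k) • y ∧ ∀ E, S.coeff y E = S.coeff x (E + γ) := by
  have h : ∀ E, S.coeff (novMonomial (-γ) (1 : k) • x) E = S.coeff x (E + γ) := fun E => by
    rw [S.coeff_monomial_smul, one_smul, sub_neg_eq_add]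
  refine ⟨novMonomial (-γ) (1 : k) • x, fun E hE => ?_, S.ext_coeff fun E => ?_, h⟩
  · rw [h]; exact hx _ (by linarith)
  · rw [S.coeff_monomial_smul, h, one_smul, sub_add_cancel]

/-- The support is left-finite, so it has a smallest exponent if it meets the range up to one. -/
theorem exists_pos_mem_ge {x : C} (hx : x ∈ S.ge 0) (h0 : S.coeff x 0 = 0) :
    ∃ ε > 0, x ∈ S.ge ε := by
  have hfin := S.leftFinite_support x 1
  by_cases hne : (Function.support (S.coeff x) ∩ Set.Iic 1).Nonempty
  · obtain ⟨b, hb, hmin⟩ := hfin.exists_minimal hne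
    refine ⟨b, ?_, fun E hE => ?_⟩
    · rcases lt_trichotomy b 0 with h | h | h
      · exact absurd (hx b h) hb.1
      · exact absurd (h ▸ h0) hb.1
      · exact h
    · by_contra hE'
      have hE1 : E ∈ Function.support (S.coeff x) ∩ Set.Iic 1 :=
        ⟨hE', (hE.le.trans hb.2 : E ≤ 1)⟩
      exact absurd (hmin hE1 hE.le) (not_le.mpr hE)
  · refine ⟨1, one_pos, fun E hE => ?_⟩
    by_contra hE'
    exact hne ⟨E, hE', hE.le⟩

/-- The leading coefficient of the value of a linear map depends only on the leading coefficient of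
the argument. -/
theorem coeff_apply_eq {h : C → C} (hh : IsContLinear (k := k) h) {γ : ℝ}
    (hγ : ∀ x ∈ S.ge 0, h x ∈ S.ge γ) {z : C} (hz : z ∈ S.ge 0) :
    S.coeff (h z) γ = S.coeff (h (S.incl (S.coeff z 0))) γ := by
  -- Subtracting the leading term leaves an element of some valuation `ε > 0`, whose image under `h`
  -- has valuation at least `ε + γ` and does not reach `T ^ γ`.
  have h1 : z - S.incl (S.coeff z 0) ∈ S.ge 0 := sub_mem hz (S.incl_mem_ge _)
  obtain ⟨ε, hε, h2⟩ := S.exists_pos_mem_ge h1 (by simp [S.coeff_sub, S.coeff_incl_zero])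
  obtain ⟨y, hy, h3, -⟩ := S.exists_monomial_smul h2
  have h4 : h (z - S.incl (S.coeff z 0)) ∈ S.ge (ε + γ) := by
    rw [h3, hh.2.2]
    exact S.monomial_smul_mem_ge (hγ y hy) _ _
  rw [hh.2.1.map_sub] at h4
  have h5 := h4 γ (by linarith)
  rwa [S.coeff_sub, sub_eq_zero] at h5

/-- Lists of integral elements. -/
def IsIntegralList (l : List C) : Prop := ∀ x ∈ l, x ∈ S.ge 0

variable {S}

theorem IsIntegralList.cons {x : C} {l : List C} (hx : x ∈ S.ge 0) (hl : S.IsIntegralList l) :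
    S.IsIntegralList (x :: l) := by
  simpa [IsIntegralList] using ⟨hx, hl⟩

theorem isIntegralList_nil : S.IsIntegralList [] := by simp [IsIntegralList]

/-- After the factor `T ^ β` is pulled out by linearity, both inputs are integral, and the
coefficient at zero depends only on their coefficients at zero. -/
theorem coeff_pair_left {m : List C → C} (hm : IsContMultilinear (k := k) m)
    (hint : ∀ l, S.IsIntegralList l → m l ∈ S.ge 0) {x y : C} {β : ℝ} (hx : x ∈ S.ge β)
    (hy : y ∈ S.ge 0) :
    S.coeff (m [x, y]) β = S.coeff (m [S.incl (S.coeff x β), S.incl (S.coeff y 0)]) 0 := by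
  obtain ⟨x', hx', rfl, hc⟩ := S.exists_monomial_smul hx
  have h1 : m [novMonomial β (1 : k) • x', y] = novMonomial β (1 : k) • m [x', y] :=
    (hm [] [y]).2.2 _ _
  have h2 := S.coeff_apply_eq (hm [] [y]) (γ := 0) (fun z hz => hint _
    (.cons hz (.cons hy isIntegralList_nil))) hx'
  have h3 := S.coeff_apply_eq (hm [S.incl (S.coeff x' 0)] []) (γ := 0) (fun z hz => hint _
    (.cons (S.incl_mem_ge _) (.cons hz isIntegralList_nil))) hy
  simp only [List.nil_append, List.cons_append] at h2 h3
  rw [h1, S.coeff_monomial_smul, sub_self, one_smul, h2, h3, hc, zero_add]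

theorem coeff_pair_right {m : List C → C} (hm : IsContMultilinear (k := k) m)
    (hint : ∀ l, S.IsIntegralList l → m l ∈ S.ge 0) {x y : C} {β : ℝ} (hx : x ∈ S.ge 0)
    (hy : y ∈ S.ge β) :
    S.coeff (m [x, y]) β = S.coeff (m [S.incl (S.coeff x 0), S.incl (S.coeff y β)]) 0 := by
  obtain ⟨y', hy', rfl, hc⟩ := S.exists_monomial_smul hy
  have h1 : m [x, novMonomial β (1 : k) • y'] = novMonomial β (1 : k) • m [x, y'] :=
    (hm [x] []).2.2 _ _
  have h2 := S.coeff_apply_eq (hm [] [y']) (γ := 0) (fun z hz => hint _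
    (.cons hz (.cons hy' isIntegralList_nil))) hx
  have h3 := S.coeff_apply_eq (hm [S.incl (S.coeff x 0)] []) (γ := 0) (fun z hz => hint _
    (.cons (S.incl_mem_ge _) (.cons hz isIntegralList_nil))) hy'
  simp only [List.nil_append, List.cons_append] at h2 h3
  rw [h1, S.coeff_monomial_smul, sub_self, one_smul, h2, h3, hc, zero_add]

variable (S)

/-! ### Words in a basis -/

variable {κ : Type*} (e : Module.Basis κ k Cbar)

/-- The list of elements of `C` given by a word in a basis of `Cbar`. -/
def word (w : List κ) : List C := w.map fun I => S.incl (e I)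

theorem word_nil : S.word e [] = [] := rfl

theorem word_cons (I : κ) (w : List κ) : S.word e (I :: w) = S.incl (e I) :: S.word e w := rfl

theorem word_append (u w : List κ) : S.word e (u ++ w) = S.word e u ++ S.word e w :=
  List.map_append

theorem length_word (w : List κ) : (S.word e w).length = w.length := List.length_map _

theorem isIntegralList_word (w : List κ) : S.IsIntegralList (S.word e w) := by
  intro x hx
  obtain ⟨I, -, rfl⟩ := List.mem_map.mp hx
  exact S.incl_mem_ge _

/-- To prove that the values of a continuous multilinear function lie in a closed subgroup, it is
enough to consider words in a basis. -/
theorem mem_of_word {φ : List C → C} (hφ : IsContMultilinear (k := k) φ) {Q : AddSubgroup C}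
    (hQ : IsClosed (Q : Set C)) {F : Set ℝ}
    (hF : ∀ E ∈ F, ∀ (a : k), ∀ q ∈ Q, novMonomial E a • q ∈ Q) {n : ℕ}
    (h : ∀ w : List κ, w.length = n → φ (S.word e w) ∈ Q) {l : List C} (hn : l.length = n)
    (hl : ∀ x ∈ l, ∀ E, S.coeff x E ≠ 0 → E ∈ F) : φ l ∈ Q := by
  refine S.slotwise_mem hφ hQ hF (ξ := Unit) (fun _ => Set.range e)
    (fun β hβ => ?_) (d := l.map fun _ => ()) ?_
  · have hlen : β.length = n := by rw [hβ.length_eq, List.length_map, hn]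
    suffices H : ∃ w : List κ, β.map S.incl = S.word e w by
      obtain ⟨w, hw⟩ := H
      rw [hw]
      exact h w (by rw [← hlen, ← S.length_word e w, ← hw, List.length_map])
    clear hlen
    generalize l.map (fun _ => ()) = du at hβ
    induction hβ with
    | nil => exact ⟨[], rfl⟩
    | cons hb _ ih =>
      obtain ⟨I, rfl⟩ := hb
      obtain ⟨w, hw⟩ := ih
      exact ⟨I :: w, by rw [List.map_cons, hw, word_cons]⟩
  · rw [List.forall₂_map_right_iff, List.forall₂_same]
    exact fun x hx => ⟨hl x hx, fun E => by rw [e.span_eq]; trivial⟩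

theorem mem_ge_of_word {φ : List C → C} (hφ : IsContMultilinear (k := k) φ) {γ : ℝ} {n : ℕ}
    (h : ∀ w : List κ, w.length = n → φ (S.word e w) ∈ S.ge γ) {l : List C} (hn : l.length = n)
    (hl : S.IsIntegralList l) : φ l ∈ S.ge γ := by
  refine S.mem_of_word e hφ (S.isClosed_ge γ) (F := Set.Ici 0) (fun E hE a q hq => ?_) h hn
    fun x hx E hE => not_lt.mp fun h' => hE (hl x hx E h')
  exact S.ge_anti (by have : (0 : ℝ) ≤ E := hE; linarith) (S.monomial_smul_mem_ge hq E a)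

theorem eq_zero_of_word {φ : List C → C} (hφ : IsContMultilinear (k := k) φ) {n : ℕ}
    (h : ∀ w : List κ, w.length = n → φ (S.word e w) = 0) {l : List C} (hn : l.length = n) :
    φ l = 0 := by
  have := S.mem_of_word e hφ (Q := ⊥) (by simp) (F := Set.univ)
    (fun E _ a q hq => by rw [AddSubgroup.mem_bot] at hq ⊢; rw [hq, smul_zero])
    (fun w hw => by simpa using h w hw) hn (fun _ _ _ _ => trivial)
  simpa using this

/-! ### Gapped extension of functions of words -/

/-- The elements whose exponents all lie in `G`. -/
def gapped (G : AddSubmonoid ℝ) : AddSubgroup C where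
  carrier := {x | ∀ E, E ∉ G → S.coeff x E = 0}
  zero_mem' := fun E _ => by simp
  add_mem' := fun hx hy E hE => by rw [S.coeff_add, hx E hE, hy E hE, add_zero]
  neg_mem' := fun hx E hE => by rw [S.coeff_neg, hx E hE, neg_zero]

theorem isClosed_gapped (G : AddSubmonoid ℝ) : IsClosed (S.gapped G : Set C) :=
  S.isClosed_coeff fun E => {y : Cbar | E ∉ G → y = 0}

theorem incl_mem_gapped (G : AddSubmonoid ℝ) (x : Cbar) : S.incl x ∈ S.gapped G := fun _ hE =>
  S.coeff_incl_of_ne x fun h => hE (h ▸ G.zero_mem)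

theorem mem_gapped_of_word {G : AddSubmonoid ℝ} {φ : List C → C}
    (hφ : IsContMultilinear (k := k) φ)
    (h : ∀ w : List κ, φ (S.word e w) ∈ S.gapped G) {l : List C}
    (hl : ∀ x ∈ l, x ∈ S.gapped G) : φ l ∈ S.gapped G := by
  refine S.mem_of_word e hφ (S.isClosed_gapped G) (F := G) (fun E hE a q hq E' hE' => ?_)
    (fun w _ => h w) rfl fun x hx E hE => by_contra fun h' => hE (hl x hx E h')
  rw [S.coeff_monomial_smul, hq, smul_zero]
  intro h'
  exact hE' (by simpa using G.add_mem h' hE)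

variable {G : AddSubmonoid ℝ}

theorem exists_wordExtension (hG_nonneg : ∀ x ∈ G, 0 ≤ x)
    (hG_finite : ∀ E : ℝ, {x : ℝ | x ∈ G ∧ x ≤ E}.Finite) (F : ℕ × G → List κ → Cbar) :
    ∃ f : ∀ n : ℕ, MultilinearMap (Novikov k) (fun _ : Fin n => C) C,
      (∀ n (α : Fin n → C), ‖f n α‖ ≤ ∏ i, ‖α i‖) ∧
      ∀ n (x : Fin n → Cbar), HasSum (fun β : G => novT k β • S.incl (wordMap e n (F (n, β)) x))
        (f n (fun i => S.incl (x i))) := by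
  choose f hf hf' using fun n => S.exists_extension hG_nonneg hG_finite n
    (fun β => wordMap e n (F (n, β)))
  exact ⟨f, hf, hf'⟩

theorem coeff_evalList_word {f : ∀ n : ℕ, MultilinearMap (Novikov k) (fun _ : Fin n => C) C}
    {g : ∀ n : ℕ, G → MultilinearMap k (fun _ : Fin n => Cbar) Cbar}
    (hf : ∀ n (x : Fin n → Cbar), HasSum (fun β : G => novT k β • S.incl (g n β x))
        (f n (fun i => S.incl (x i)))) (x : List Cbar) :
    (∀ β : G, S.coeff (evalList f (x.map S.incl)) β = g x.length β x.get) ∧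
      evalList f (x.map S.incl) ∈ S.gapped G := by
  have h1 : evalList f (x.map S.incl) = f x.length (fun i => S.incl (x.get i)) := by
    rw [evalList_of_length f (List.length_map _)]
    congr 1
    funext i
    simp
  rw [h1]
  exact ⟨fun β => S.coeff_of_hasSum_apply (e := fun β : G => (β : ℝ)) Subtype.val_injective
    (hf _ _) β, fun E hE => S.coeff_of_hasSum_eq_zero (e := fun β : G => (β : ℝ))
    Subtype.val_injective (hf _ _) fun b hb => hE (hb ▸ b.2)⟩

theorem coeff_evalList_wordMap {f : ∀ n : ℕ, MultilinearMap (Novikov k) (fun _ : Fin n => C) C}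
    {F : ℕ × G → List κ → Cbar}
    (hf : ∀ n (x : Fin n → Cbar), HasSum (fun β : G => novT k β •
      S.incl (wordMap e n (F (n, β)) x)) (f n (fun i => S.incl (x i)))) (w : List κ) :
    (∀ β : G, S.coeff (evalList f (S.word e w)) β = F (w.length, β) w) ∧
      evalList f (S.word e w) ∈ S.gapped G := by
  have h1 : S.word e w = (w.map e).map S.incl := by simp [word]
  rw [h1]
  obtain ⟨h2, h3⟩ := S.coeff_evalList_word hf (w.map e)
  refine ⟨fun β => ?_, h3⟩
  rw [h2 β]
  have h4 : ∀ n (hn : n = w.length), wordMap e n (F (n, β)) (fun i => e (w.get (i.cast hn)))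
      = F (w.length, β) w := by
    rintro n rfl
    rw [wordMap_apply]
    congr 1
    exact List.ofFn_get w
  rw [← h4 (w.map e).length (by simp)]
  congr 1
  funext i
  simp

end KStructure

/-! ### Signs and degrees -/

section Degrees

variable {N : ℕ}

/-- For even `N`, reduction modulo two is defined on `ZMod N`, so parity questions can be decided in
`ZMod 2`. -/
theorem even_iff_castHom (hN : Even N) (a : ZMod N) :
    Even a ↔ ZMod.castHom hN.two_dvd (ZMod 2) a = 0 := by
  constructor
  · rintro ⟨b, rfl⟩
    rw [map_add, ← two_mul, show (2 : ZMod 2) = 0 from rfl, zero_mul]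
  · intro h
    obtain ⟨z, rfl⟩ := ZMod.intCast_surjective a
    rw [map_intCast, ZMod.intCast_zmod_eq_zero_iff_dvd] at h
    obtain ⟨y, rfl⟩ := h
    exact ⟨(y : ZMod N), by push_cast; ring⟩

theorem degSign_add (hN : Even N) (a b : ZMod N) : degSign (a + b) = degSign a * degSign b := by
  have h2 : ∀ x y : ZMod 2, x + y = 0 ↔ (x = 0 ↔ y = 0) := by decide
  simp only [degSign, even_iff_castHom hN, map_add, h2]
  split_ifs <;> tauto

theorem degSign_one (hN : Even N) : degSign (1 : ZMod N) = -1 := by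
  have : ¬ Even (1 : ZMod N) := by
    rw [even_iff_castHom hN, map_one]; decide
  simp [degSign, this]

theorem degSign_zero : degSign (0 : ZMod N) = 1 := by simp [degSign]

theorem degSign_mul_self (a : ZMod N) : degSign a * degSign a = 1 := by
  unfold degSign; split_ifs <;> rfl

theorem degSign_odd (hN : Even N) {a : ZMod N} (ha : Odd a) : degSign a = -1 := by
  obtain ⟨b, rfl⟩ := ha
  rw [degSign_add hN, degSign_one hN, two_mul, degSign_add hN, degSign_mul_self, one_mul]

theorem degSign_eq_one_or (a : ZMod N) : degSign a = 1 ∨ degSign a = -1 := by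
  unfold degSign; split_ifs <;> simp

theorem degSign_neg (hN : Even N) (a : ZMod N) : degSign (-a) = degSign a := by
  have h : degSign (-a) * degSign a = 1 := by
    rw [← degSign_add hN, neg_add_cancel, degSign_zero]
  rcases degSign_eq_one_or a with h1 | h1 <;> rw [h1] at h ⊢ <;> linarith

theorem degSign_natCast (hN : Even N) (n : ℕ) : degSign (n : ZMod N) = (-1) ^ n := by
  induction n with
  | zero => simp [degSign_zero]
  | succ n ih => rw [Nat.cast_succ, degSign_add hN, ih, degSign_one hN, pow_succ]

/-- Adding one to each degree and subtracting the number of degrees give exponents that differ by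
twice the length. -/
theorem degSign_shift (hN : Even N) (dl : List (ZMod N)) :
    degSign (dl.map (· + 1)).sum = degSign (dl.sum - (dl.length : ZMod N)) := by
  have h1 : (dl.map (· + 1)).sum = dl.sum + (dl.length : ZMod N) := by
    induction dl with
    | nil => simp
    | cons a t ih => simp [ih]; ring
  rw [h1, sub_eq_add_neg, degSign_add hN, degSign_add hN, degSign_neg hN]

variable {k : Type*} [Field k]
  {C : Type*} [NormedAddCommGroup C] [Module (Novikov k) C]
  (gr : ZMod N → Submodule (Novikov k) C)

/-- The function of lists has degree `δ - n` on lists of length `n`. -/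
def HasDegree (δ : ZMod N) (φ : List C → C) : Prop :=
  ∀ (α : List C) (dl : List (ZMod N)), IsHomogeneousList gr α dl →
    φ α ∈ gr (dl.sum + δ - (α.length : ZMod N))

/-- The map is the identity in odd degrees, and minus the identity in even degrees. -/
def IsParity (σ : C →ₗ[Novikov k] C) : Prop := ∀ i, ∀ x ∈ gr i, σ x = degSign (i + 1) • x

variable {gr}

theorem IsHomogeneousList.append_left {u w : List C} {dl : List (ZMod N)}
    (h : IsHomogeneousList gr (u ++ w) dl) :
    ∃ d₁ d₂, dl = d₁ ++ d₂ ∧ IsHomogeneousList gr u d₁ ∧ IsHomogeneousList gr w d₂ :=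
  ⟨dl.take u.length, dl.drop u.length, (List.take_append_drop _ _).symm,
    by simpa [IsHomogeneousList] using List.forall₂_take u.length h,
    by simpa [IsHomogeneousList] using List.forall₂_drop u.length h⟩

theorem exists_isHomogeneousList {l : List C} (h : ∀ x ∈ l, ∃ i, x ∈ gr i) :
    ∃ dl, IsHomogeneousList gr l dl := by
  induction l with
  | nil => exact ⟨[], .nil⟩
  | cons x t ih =>
    obtain ⟨i, hi⟩ := h x (by simp)
    obtain ⟨dl, hdl⟩ := ih fun y hy => h y (by simp [hy])
    exact ⟨i :: dl, .cons hi hdl⟩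

theorem IsParity.map_mem {σ : C →ₗ[Novikov k] C} (hσ : IsParity gr σ) {i : ZMod N} {x : C}
    (hx : x ∈ gr i) : σ x ∈ gr i := by
  rw [hσ i x hx]
  exact zsmul_mem hx _

theorem IsHomogeneousList.map_parity {σ : C →ₗ[Novikov k] C} (hσ : IsParity gr σ) {l : List C}
    {dl : List (ZMod N)} (h : IsHomogeneousList gr l dl) : IsHomogeneousList gr (l.map σ) dl := by
  induction h with
  | nil => exact .nil
  | cons h _ ih => exact .cons (hσ.map_mem h) ih

/-- This converts the Koszul sign of the entries to the left of an insertion into the application of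
`σ` to these entries. -/
theorem Slotwise.map_map_parity (hN : Even N) {σ : C →ₗ[Novikov k] C} (hσ : IsParity gr σ)
    {W : Type*} [AddCommGroup W] {φ : List C → W}
    (hφ : Slotwise IsAdd φ) {l : List C} {dl : List (ZMod N)} (h : IsHomogeneousList gr l dl) :
    φ (l.map σ) = degSign (dl.map (· + 1)).sum • φ l := by
  induction h generalizing φ with
  | nil => simp [degSign_zero]
  | @cons x i t dt hx _ ih =>
    have h1 : ∀ z : ℤ, φ ((z • x) :: t.map σ) = z • φ (x :: t.map σ) := fun z =>
      (AddMonoidHom.mk' (fun x => φ (x :: t.map σ)) (hφ [] _)).map_zsmul z x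
    rw [List.map_cons, hσ i x hx, h1, ih (φ := fun l => φ (x :: l)) (hφ.cons _), smul_smul,
      List.map_cons, List.sum_cons, degSign_add hN (i + 1)]

/-- Functions of even degree commute with the parity. -/
theorem HasDegree.map_parity_even (hN : Even N) {σ : C →ₗ[Novikov k] C} (hσ : IsParity gr σ)
    {φ : List C → C} (hφ : HasDegree gr 1 φ) (hadd : Slotwise IsAdd φ) {l : List C}
    (h : ∀ x ∈ l, ∃ i, x ∈ gr i) : φ (l.map σ) = σ (φ l) := by
  obtain ⟨dl, hdl⟩ := exists_isHomogeneousList h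
  rw [hadd.map_map_parity hN hσ hdl, hσ _ _ (hφ _ _ hdl), degSign_shift hN, hdl.length_eq,
    show dl.sum + 1 - (dl.length : ZMod N) + 1 = (dl.sum - (dl.length : ZMod N)) + (1 + 1) by ring,
    degSign_add hN _ (1 + 1), degSign_add hN 1 1, degSign_mul_self, mul_one]

/-- Functions of odd degree anticommute with the parity. -/
theorem HasDegree.map_parity_odd (hN : Even N) {σ : C →ₗ[Novikov k] C} (hσ : IsParity gr σ)
    {φ : List C → C} (hφ : HasDegree gr 2 φ) (hadd : Slotwise IsAdd φ) {l : List C}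
    (h : ∀ x ∈ l, ∃ i, x ∈ gr i) : φ (l.map σ) = -σ (φ l) := by
  obtain ⟨dl, hdl⟩ := exists_isHomogeneousList h
  rw [hadd.map_map_parity hN hσ hdl, hσ _ _ (hφ _ _ hdl), degSign_shift hN, hdl.length_eq,
    show dl.sum + 2 - (dl.length : ZMod N) + 1 = (dl.sum - (dl.length : ZMod N)) + (1 + 1) + 1
      by ring,
    degSign_add hN _ 1, degSign_add hN _ (1 + 1), degSign_add hN 1 1, degSign_mul_self, mul_one,
    degSign_one hN, mul_neg_one, neg_smul, neg_neg]

/-- The invariant is the sum of the shifted degrees, that is, the sum of the degrees minus the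
number of entries. A map of degree `1 - n` on `n` inputs preserves it. -/
theorem HasDegree.exists_blocks {f : List C → C} (hf : HasDegree gr 1 f) (bs : List (List C))
    {dl : List (ZMod N)} (h : IsHomogeneousList gr bs.flatten dl) :
    ∃ dl', IsHomogeneousList gr (bs.map f) dl' ∧
      dl'.sum - (bs.length : ZMod N) = dl.sum - (bs.flatten.length : ZMod N) := by
  induction bs generalizing dl with
  | nil =>
    obtain rfl : dl = [] := by simpa [IsHomogeneousList] using h
    exact ⟨[], .nil, by simp⟩
  | cons b bs ih =>
    rw [List.flatten_cons] at h
    obtain ⟨d₁, d₂, rfl, h1, h2⟩ := h.append_left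
    obtain ⟨d', hd', e⟩ := ih h2
    refine ⟨_, .cons (hf b d₁ h1) hd', ?_⟩
    simp only [List.sum_cons, List.sum_append, List.length_cons, List.flatten_cons,
      List.length_append, Nat.cast_add, Nat.cast_one]
    linear_combination e

theorem HasDegree.blockSum {f m : List C → C} (hf : HasDegree gr 1 f) (hm : HasDegree gr 2 m) :
    HasDegree gr 2 (blockSum f m) := by
  intro α dl h
  refine blockSum_induction (Q := fun x => x ∈ gr (dl.sum + 2 - (α.length : ZMod N)))
    (fun _ _ => add_mem) fun bs _ hbs => ?_
  subst hbs
  obtain ⟨d', hd', e⟩ := hf.exists_blocks bs h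
  have := hm _ _ hd'
  rw [List.length_map] at this
  rwa [show dl.sum + 2 - (bs.flatten.length : ZMod N) = d'.sum + 2 - (bs.length : ZMod N) by
    linear_combination -e]

theorem HasDegree.insertOp {σ : C →ₗ[Novikov k] C} (hσ : IsParity gr σ) {φ m : List C → C}
    {δ : ZMod N} (hφ : HasDegree gr δ φ) (hm : HasDegree gr 2 m) :
    HasDegree gr (δ + 1) (insertOp σ m φ) := by
  intro α dl h
  refine insertOp_induction (Q := fun x => x ∈ gr (dl.sum + (δ + 1) - (α.length : ZMod N)))
    (fun _ _ => add_mem) fun u v w huvw => ?_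
  subst huvw
  obtain ⟨d', d₃, rfl, h', h3⟩ := h.append_left
  obtain ⟨d₁, d₂, rfl, h1, h2⟩ := h'.append_left
  have := hφ _ _ (List.rel_append (h1.map_parity hσ) (.cons (hm _ _ h2) h3))
  refine (congrArg (fun i => _ ∈ gr i) ?_).mp this
  simp only [List.sum_append, List.sum_cons, List.length_append, List.length_cons, List.length_map]
  push_cast
  ring

theorem HasDegree.defect {σ : C →ₗ[Novikov k] C} (hσ : IsParity gr σ) {f m m' : List C → C}
    (hf : HasDegree gr 1 f) (hm : HasDegree gr 2 m) (hm' : HasDegree gr 2 m') :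
    HasDegree gr 2 (defect σ m m' f) := fun α dl h =>
  sub_mem (hf.blockSum hm' α dl h) (by
    have := hf.insertOp hσ hm α dl h
    rwa [one_add_one_eq_two] at this)

end Degrees

/-! ### Scalars and last entries in the Hochschild operators -/

section WordOperators

variable {ι k M : Type*} [LinearOrder ι] [CommRing k] [AddCommGroup M] [Module k M]

theorem mergeOp_smul (s : Finset ι → k) (c : Finset ι → Finset ι → k) (a : k)
    (Ψ : List (Finset ι) → M) (w : List (Finset ι)) :
    mergeOp s c (fun w => a • Ψ w) w = a • mergeOp s c Ψ w := by
  induction w generalizing Ψ with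
  | nil => simp [mergeOp]
  | cons I t ih =>
    cases t with
    | nil => simp [mergeOp]
    | cons J t => simp only [mergeOp, ih (fun w => Ψ (I :: w)), smul_add, smul_comm a]

theorem rightOp_concat (R : Finset ι → M →ₗ[k] M) (Ψ : List (Finset ι) → M)
    (u : List (Finset ι)) (I : Finset ι) : rightOp R Ψ (u ++ [I]) = R I (Ψ u) := by
  induction u generalizing Ψ with
  | nil => rfl
  | cons J t ih =>
    cases t with
    | nil => rfl
    | cons K t => exact ih (fun w => Ψ (J :: w))

end WordOperators

/-! ### Gapped functions of lists -/

section Leading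

variable {k : Type*} [Field k] {N : ℕ}
  {C : Type*} [NormedAddCommGroup C] [Module (Novikov k) C]
  {Cbar : Type*} [AddCommGroup Cbar] [Module k Cbar]
  {gr : ZMod N → Submodule (Novikov k) C} {grbar : ZMod N → Submodule k Cbar}
  (S : KStructure gr grbar) {κ : Type*} (e : Module.Basis κ k Cbar) (G : AddSubmonoid ℝ)

theorem IsContMultilinear.blockSum {f m : List C → C} (hf : IsContMultilinear (k := k) f)
    (hm : IsContMultilinear (k := k) m) : IsContMultilinear (k := k) (blockSum f m) :=
  blockSum_slot IsContLinear.add IsContLinear.add IsContLinear.comp hf hm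

theorem IsContMultilinear.insertOp {σ : C → C} (hσ : IsContLinear (k := k) σ)
    {φ m : List C → C} (hφ : IsContMultilinear (k := k) φ) (hm : IsContMultilinear (k := k) m) :
    IsContMultilinear (k := k) (insertOp σ m φ) :=
  insertOp_slot IsContLinear.add IsContLinear.comp hσ hm hφ

/-- A continuous multilinear function of lists that is a sum of terms `T ^ β φ_β` with `β ∈ G`. -/
structure IsGappedMap (φ : List C → C) : Prop where
  cont : IsContMultilinear (k := k) φ
  gapped : ∀ w : List κ, φ (S.word e w) ∈ S.gapped G

/-- The map is the extension of a map on `Cbar`. -/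
structure IsStructured (σ : C →ₗ[Novikov k] C) (σbar : Cbar →ₗ[k] Cbar) : Prop where
  coeff_apply : ∀ (x : C) (E : ℝ), S.coeff (σ x) E = σbar (S.coeff x E)

variable {S e G}

theorem IsStructured.isContLinear {σ : C →ₗ[Novikov k] C} {σbar : Cbar →ₗ[k] Cbar}
    (hσ : IsStructured S σ σbar) : IsContLinear (k := k) σ := by
  refine ⟨?_, map_add σ, map_smul σ⟩
  refine AddMonoidHomClass.continuous_of_bound σ 1 fun x => ?_
  rw [one_mul]
  by_cases hx : x = 0
  · simp [hx]
  have hlog : ‖x‖ = Real.exp (-(-Real.log ‖x‖)) := by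
    rw [neg_neg, Real.exp_log (norm_pos_iff.mpr hx)]
  have h := (S.norm_le_exp_iff x _).mp hlog.le
  rw [hlog, S.norm_le_exp_iff]
  intro E hE
  rw [hσ.coeff_apply, h E hE, map_zero]

theorem IsStructured.mem_ge {σ : C →ₗ[Novikov k] C} {σbar : Cbar →ₗ[k] Cbar}
    (hσ : IsStructured S σ σbar) {x : C} {γ : ℝ} (hx : x ∈ S.ge γ) : σ x ∈ S.ge γ := fun E hE => by
  rw [hσ.coeff_apply, hx E hE, map_zero]

theorem IsStructured.mem_gapped {σ : C →ₗ[Novikov k] C} {σbar : Cbar →ₗ[k] Cbar}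
    (hσ : IsStructured S σ σbar) {x : C} (hx : x ∈ S.gapped G) : σ x ∈ S.gapped G := fun E hE => by
  rw [hσ.coeff_apply, hx E hE, map_zero]

theorem IsGappedMap.integral (hG : ∀ x ∈ G, 0 ≤ x) {φ : List C → C}
    (hφ : IsGappedMap S e G φ) {l : List C} (hl : S.IsIntegralList l) : φ l ∈ S.ge 0 :=
  S.mem_ge_of_word e hφ.cont (fun w _ E hE => hφ.gapped w E fun h =>
    absurd (hG E h) (not_le.mpr hE))
    rfl hl

theorem IsGappedMap.mem_gapped {φ : List C → C} (hφ : IsGappedMap S e G φ) {l : List C}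
    (hl : ∀ x ∈ l, x ∈ S.gapped G) : φ l ∈ S.gapped G :=
  S.mem_gapped_of_word e hφ.cont hφ.gapped hl

theorem IsGappedMap.sub {φ χ : List C → C} (hφ : IsGappedMap S e G φ)
    (hχ : IsGappedMap S e G χ) : IsGappedMap S e G (fun l => φ l - χ l) :=
  ⟨hφ.cont.sub hχ.cont, fun w => sub_mem (hφ.gapped w) (hχ.gapped w)⟩

theorem KStructure.word_mem_gapped (w : List κ) : ∀ x ∈ S.word e w, x ∈ S.gapped G := by
  intro x hx
  obtain ⟨I, -, rfl⟩ := List.mem_map.mp hx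
  exact S.incl_mem_gapped G _

theorem IsGappedMap.defect {σ : C →ₗ[Novikov k] C} {σbar : Cbar →ₗ[k] Cbar}
    (hσ : IsStructured S σ σbar) {f m m' : List C → C} (hf : IsGappedMap S e G f)
    (hm : IsGappedMap S e G m) (hm' : IsGappedMap S e G m') :
    IsGappedMap S e G (defect σ m m' f) := by
  refine ⟨(hf.cont.blockSum hm'.cont).sub (hf.cont.insertOp hσ.isContLinear hm.cont),
    fun w => sub_mem ?_ ?_⟩
  · refine blockSum_induction (Q := fun x => x ∈ S.gapped G) (fun _ _ => add_mem)
      fun bs _ hbs => hm'.mem_gapped fun x hx => ?_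
    obtain ⟨b, hb, rfl⟩ := List.mem_map.mp hx
    exact hf.mem_gapped fun y hy => KStructure.word_mem_gapped w y
      (hbs ▸ List.mem_flatten.mpr ⟨b, hb, hy⟩)
  · refine insertOp_induction (Q := fun x => x ∈ S.gapped G) (fun _ _ => add_mem)
      fun u v t huvt => hf.mem_gapped fun x hx => ?_
    have H : ∀ y ∈ u ++ v ++ t, y ∈ S.gapped G := huvt ▸ KStructure.word_mem_gapped w
    rcases List.mem_append.mp hx with hx | hx
    · obtain ⟨y, hy, rfl⟩ := List.mem_map.mp hx
      exact hσ.mem_gapped (H y (by simp [hy]))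
    · rcases List.mem_cons.mp hx with rfl | hx
      · exact hm.mem_gapped fun y hy => H y (by simp [hy])
      · exact H x (by simp [hx])

end Leading

/-! ### Leading coefficients of the defect -/

section Defect

variable {k : Type*} [Field k] {N : ℕ}
  {C : Type*} [NormedAddCommGroup C] [Module (Novikov k) C]
  {Cbar : Type*} [AddCommGroup Cbar] [Module k Cbar]
  {gr : ZMod N → Submodule (Novikov k) C} {grbar : ZMod N → Submodule k Cbar}
  (S : KStructure gr grbar) {ι : Type*} [LinearOrder ι] (e : Module.Basis (Finset ι) k Cbar)
  (G : AddSubmonoid ℝ)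

/-- The degree of a monomial in variables of degrees `d`. -/
def monomialDegree (d : ι → ZMod N) (I : Finset ι) : ZMod N := ∑ i ∈ I, d i

variable (grbar) in
/-- A product on `Cbar`, with a monomial basis on which it is, up to signs, the product of an
exterior algebra on generators of degrees `d`. -/
structure IsExteriorBasis (μ : Cbar →ₗ[k] Cbar →ₗ[k] Cbar) (d : ι → ZMod N)
    (s : Finset ι → k) (c : Finset ι → Finset ι → k) : Prop where
  monomial : IsMonomialProduct s c
  mul : ∀ I J, μ (e I) (e J) = c I J • e (I ∪ J)
  mem : ∀ I, e I ∈ grbar (monomialDegree d I)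
  le_span : ∀ i, grbar i ≤ Submodule.span k (e '' {I | monomialDegree d I = i})
  sign : ∀ I, s I = ((degSign (monomialDegree d I + 1) : ℤ) : k)
  mul_one : ∀ I, μ (e I) (e ∅) = -s I • e I

variable (gr) in
/-- The operations of a gapped `A_∞` algebra with `m_0 = m_1 = 0`, with leading product `μ`, that
are antisymmetric on generators. -/
structure IsMinimalOps (μ : Cbar →ₗ[k] Cbar →ₗ[k] Cbar) (σ : C →ₗ[Novikov k] C)
    (m : List C → C) : Prop extends IsGappedMap S e G m where
  nil : m [] = 0
  single : ∀ x, m [x] = 0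
  degree : HasDegree gr 2 m
  relation : ∀ l : List C, (∀ x ∈ l, ∃ i, x ∈ gr i) → insertOp σ m m l = 0
  leading : ∀ x y, S.coeff (m [S.incl x, S.incl y]) 0 = μ x y
  reverse : ∀ v : List ι, m (S.word e (v.map fun i => {i})).reverse
    = -m (S.word e (v.map fun i => {i}))

variable {S e G}
variable {μ : Cbar →ₗ[k] Cbar →ₗ[k] Cbar} {d : ι → ZMod N} {s : Finset ι → k}
  {c : Finset ι → Finset ι → k} {σ : C →ₗ[Novikov k] C} {σbar : Cbar →ₗ[k] Cbar}

theorem KStructure.incl_mem_gr {i : ZMod N} {x : Cbar} (hx : x ∈ grbar i) : S.incl x ∈ gr i := by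
  rw [S.mem_gr]
  intro E
  change S.coeff _ E ∈ _
  rw [S.coeff_incl]
  split_ifs
  · exact hx
  · exact zero_mem _

theorem IsExteriorBasis.parity (hb : IsExteriorBasis grbar e μ d s c) (hp : IsParity gr σ)
    (I : Finset ι) : σ (S.incl (e I)) = S.incl (s I • e I) := by
  rw [hp _ _ (S.incl_mem_gr (hb.mem I)), hb.sign]
  have : ∀ z : ℤ, z • S.incl (e I) = S.incl ((z : k) • e I) := fun z => by
    rw [Int.cast_smul_eq_zsmul]
    exact ((AddMonoidHom.mk' S.incl S.incl_add).map_zsmul z _).symm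
  exact this _

/-- The values of `φ` have valuation at least `β`, so at `T ^ β` only the leading part `μ` of the
inserted operation matters. On basis elements `μ` has structure constants `c` and `σ` is the scalar
`s`, which gives the recursion of `mergeOp`. -/
theorem coeff_adjacentOp (hb : IsExteriorBasis grbar e μ d s c) (hp : IsParity gr σ)
    (hG : ∀ x ∈ G, 0 ≤ x) {m : List C → C}
    (hm : IsMinimalOps gr S e G μ σ m) {φ : List C → C} (hφ : IsContMultilinear (k := k) φ) {n : ℕ}
    {β : ℝ} (hβ : ∀ l, l.length = n → S.IsIntegralList l → φ l ∈ S.ge β) {w : List (Finset ι)}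
    (hw : w.length = n + 1) :
    S.coeff (adjacentOp σ m φ (S.word e w)) β
      = mergeOp s c (fun w => S.coeff (φ (S.word e w)) β) w := by
  have hsm : ∀ {φ : List C → C}, IsContMultilinear (k := k) φ → ∀ (a : k) (J : Finset ι) t,
      S.coeff (φ (S.incl (a • e J) :: t)) β = a • S.coeff (φ (S.incl (e J) :: t)) β := by
    intro φ hφ a J t
    have := (hφ [] t).2.2 (novMonomial 0 a) (S.incl (e J))
    simp only [List.nil_append] at this
    rw [S.incl_smul, this, S.coeff_monomial_smul, sub_zero]
  induction w generalizing φ n with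
  | nil => simp at hw
  | cons I t ih =>
    cases t with
    | nil => simp [mergeOp, KStructure.word, adjacentOp]
    | cons J t =>
      obtain ⟨n, rfl⟩ : ∃ n', n = n' + 1 := ⟨t.length, by simpa using hw.symm⟩
      rw [S.word_cons, S.word_cons, adjacentOp, mergeOp, S.coeff_add, ← S.word_cons]
      congr 1
      · have h1 : ∀ x ∈ S.ge 0, φ (x :: S.word e t) ∈ S.ge β := fun x hx =>
          hβ _ (by simpa [S.length_word] using hw) (.cons hx (S.isIntegralList_word e t))
        have h2 := S.coeff_apply_eq (hφ [] (S.word e t)) h1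
          (hm.integral hG (.cons (S.incl_mem_ge (e I))
            (.cons (S.incl_mem_ge (e J)) KStructure.isIntegralList_nil)))
        simp only [List.nil_append] at h2
        rw [h2, hm.leading, hb.mul, hsm hφ]
        rfl
      · rw [ih (n := n) (hφ.cons _), ← mergeOp_smul]
        · congr 1
          funext w'
          rw [hb.parity hp, hsm hφ]
          rfl
        · intro l hl hl'
          refine hβ _ (by simp [hl]) (.cons ?_ hl')
          rw [hb.parity hp]
          exact S.incl_mem_ge _
        · simpa using hw

/-- Let `g` be changed in arity `n`, from exponent `β` on. In arity `n + 1` and at `T ^ β`, the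
change meets only a binary `m` before it, or a binary `m'` after it together with the identity on
the first or last entry: these are the three parts of the Hochschild differential. Arities above `n`
do not enter, since `m` and `m'` have no operations with fewer than two inputs. -/
theorem coeff_variation (hb : IsExteriorBasis grbar e μ d s c) (hp : IsParity gr σ)
    (hG : ∀ x ∈ G, 0 ≤ x) {m m' f g : List C → C} (hm : IsMinimalOps gr S e G μ σ m)
    (hm' : IsMinimalOps gr S e G μ σ m') (hf : IsGappedMap S e G f) (hg : IsGappedMap S e G g)
    (hf1 : ∀ I, S.coeff (f [S.incl (e I)]) 0 = e I) (hg1 : ∀ I, S.coeff (g [S.incl (e I)]) 0 = e I)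
    {n : ℕ} (hn : 1 ≤ n) {β : ℝ} (hlt : ∀ l : List C, l.length < n → f l = g l)
    (hβ : ∀ l, l.length = n → S.IsIntegralList l → f l - g l ∈ S.ge β)
    {w : List (Finset ι)} (hw : w.length = n + 1) :
    S.coeff (defect σ m m' f (S.word e w)) β = S.coeff (defect σ m m' g (S.word e w)) β
      - wordDiff s c (fun I => -μ (e I)) (fun I => -μ.flip (e I))
        (fun w => S.coeff (f (S.word e w) - g (S.word e w)) β) w := by
  obtain ⟨I, t, rfl⟩ := List.exists_cons_of_length_eq_add_one hw
  have ht : t.length = n := by simpa using hw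
  obtain ⟨u, J, huJ⟩ : ∃ u J, I :: t = u ++ [J] := by
    rcases List.eq_nil_or_concat (I :: t) with h | ⟨u, J, h⟩
    · exact absurd h (by simp)
    · exact ⟨u, J, by rw [h, List.concat_eq_append]⟩
  have hu : u.length = n := by
    have := congrArg List.length huJ
    simp at this; omega
  have hD : IsContMultilinear (k := k) (fun l => f l - g l) := (hf.sub hg).cont
  have h1 : S.incl (e I) :: S.word e t = S.word e u ++ [S.incl (e J)] := by
    rw [← S.word_cons, huJ, S.word_append]; rfl
  have hnil : S.word e t ≠ [] := by
    intro h; have := congrArg List.length h; rw [S.length_word, List.length_nil] at this; omega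
  have e1 := blockSum_sub_eq_two hm'.cont.isAdd hm'.single h1 hnil
    (f := f) (g := g) (fun b _ hb => hlt b (by rwa [S.length_word, ht] at hb))
  have e2 : insertOp σ m f (S.word e (I :: t)) - insertOp σ m g (S.word e (I :: t))
      = adjacentOp σ m (fun l => f l - g l) (S.word e (I :: t)) := by
    rw [← insertOp_sub, insertOp_eq_adjacentOp hm.nil hm.single hD.isAdd]
    intro b hb
    rw [S.length_word] at hb
    rw [hlt b (by simp at hb; omega), sub_self]
  have e3 := coeff_adjacentOp hb hp hG hm hD hβ hw
  have hint := fun l hl => hm'.integral (l := l) hG hl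
  have hlu := hβ _ ((S.length_word e u).trans hu) (S.isIntegralList_word e u)
  have hlt' := hβ _ ((S.length_word e t).trans ht) (S.isIntegralList_word e t)
  have hsing : ∀ I, S.IsIntegralList [S.incl (e I)] := fun I =>
    .cons (S.incl_mem_ge _) KStructure.isIntegralList_nil
  have e4 := KStructure.coeff_pair_left hm'.cont hint hlu (hf.integral hG (hsing J))
  have e5 := KStructure.coeff_pair_right hm'.cont hint (hg.integral hG (hsing I)) hlt'
  rw [hf1, hm'.leading] at e4
  rw [hg1, hm'.leading] at e5
  have e6 : S.coeff (blockSum f m' (S.word e (I :: t))) β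
      - S.coeff (blockSum g m' (S.word e (I :: t))) β
      = μ (S.coeff (f (S.word e u) - g (S.word e u)) β) (e J)
        + μ (e I) (S.coeff (f (S.word e t) - g (S.word e t)) β) := by
    rw [← S.coeff_sub, S.word_cons, e1, S.coeff_add, e4, e5]
  rw [← e2, S.coeff_sub] at e3
  have e7 : rightOp (fun I => -μ.flip (e I))
      (fun w => S.coeff (f (S.word e w) - g (S.word e w)) β) (I :: t)
      = -μ (S.coeff (f (S.word e u) - g (S.word e u)) β) (e J) := by
    rw [huJ, rightOp_concat]; rfl
  rw [wordDiff, e7, leftOp, LinearMap.neg_apply, ← e3, defect, defect, S.coeff_sub, S.coeff_sub,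
    sub_eq_iff_eq_add.mp e6]
  abel

/-- This is the coefficient of `T ^ β` in the Bianchi identity in arity `n + 2`. The factor `s I` in
the left action, absent from `coeff_variation`, comes from the sign operator on the entry to the
left of the defect, which has odd shifted degree. -/
theorem wordDiff_coeff_defect (hN : Even N) (hb : IsExteriorBasis grbar e μ d s c)
    (hp : IsParity gr σ) (hσ : IsStructured S σ σbar)
    (hG : ∀ x ∈ G, 0 ≤ x) {m m' f : List C → C} (hm : IsMinimalOps gr S e G μ σ m)
    (hm' : IsMinimalOps gr S e G μ σ m') (hf : IsGappedMap S e G f) (hfd : HasDegree gr 1 f)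
    (hf1 : ∀ I, S.coeff (f [S.incl (e I)]) 0 = e I)
    {n : ℕ} {β : ℝ} (hlt : ∀ l : List C, l.length < n + 1 → defect σ m m' f l = 0)
    (hβ : ∀ l, l.length = n + 1 → S.IsIntegralList l → defect σ m m' f l ∈ S.ge β)
    {w : List (Finset ι)} (hw : w.length = n + 2) :
    wordDiff s c (fun I => s I • μ (e I)) (fun I => μ.flip (e I))
        (fun w => S.coeff (defect σ m m' f (S.word e w)) β) w = 0 := by
  obtain ⟨I, t, rfl⟩ := List.exists_cons_of_length_eq_add_one hw
  have ht : t.length = n + 1 := by simpa using hw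
  obtain ⟨u, J, huJ⟩ : ∃ u J, I :: t = u ++ [J] := by
    rcases List.eq_nil_or_concat (I :: t) with h | ⟨u, J, h⟩
    · exact absurd h (by simp)
    · exact ⟨u, J, by rw [h, List.concat_eq_append]⟩
  have hu : u.length = n + 1 := by
    have := congrArg List.length huJ
    simp at this; omega
  set E := defect σ m m' f with hE
  have hEg : IsGappedMap S e G E := IsGappedMap.defect hσ hf hm.toIsGappedMap hm'.toIsGappedMap
  have h1 : S.incl (e I) :: S.word e t = S.word e u ++ [S.incl (e J)] := by
    rw [← S.word_cons, huJ, S.word_append]; rfl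
  have hnil : S.word e t ≠ [] := by
    intro h; have := congrArg List.length h; rw [S.length_word, List.length_nil] at this; omega
  have e0 := bianchi (P := fun x => ∃ i, x ∈ gr i) (P' := fun x => ∃ i, x ∈ gr i) (τ := σ)
    (map_add σ) hm.cont.isAdd hm'.cont.isAdd hf.cont.isAdd hm.nil hm'.nil
    (fun l hl => hm.degree.map_parity_odd hN hp hm.cont.isAdd hl) hm.relation
    (fun l hl => hfd.map_parity_even hN hp hf.cont.isAdd hl)
    (fun l hl => by
      obtain ⟨dl, hdl⟩ := exists_isHomogeneousList hl
      exact ⟨_, hfd _ _ hdl⟩) hm'.relation (S.word e (I :: t)) (by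
      intro x hx
      obtain ⟨K, -, rfl⟩ := List.mem_map.mp hx
      exact ⟨_, S.incl_mem_gr (hb.mem K)⟩)
  rw [← hE] at e0
  have e1 := blockSumAt_eq_two (σ := σ) (f := f) (X := E) hm'.cont.isAdd hm'.single h1 hnil
    (fun b _ hb => hlt b (by rwa [S.length_word, ht] at hb))
  rw [insertOp_eq_adjacentOp hm.nil hm.single hEg.cont.isAdd (fun b hb => hlt b (by
    rw [S.length_word, hw] at hb; omega)), S.word_cons, e1, ← S.word_cons] at e0
  have e3 := coeff_adjacentOp hb hp hG hm hEg.cont hβ hw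
  have hint := fun l hl => hm'.integral (l := l) hG hl
  have hlu := hβ _ ((S.length_word e u).trans hu) (S.isIntegralList_word e u)
  have hlt' := hβ _ ((S.length_word e t).trans ht) (S.isIntegralList_word e t)
  have hsing : ∀ I, S.IsIntegralList [S.incl (e I)] := fun I =>
    .cons (S.incl_mem_ge _) KStructure.isIntegralList_nil
  have hσI : S.coeff (σ (f [S.incl (e I)])) 0 = s I • e I := by
    rw [hσ.coeff_apply, hf1]
    have := hσ.coeff_apply (S.incl (e I)) 0
    rwa [hb.parity hp, S.coeff_incl_zero, S.coeff_incl_zero, eq_comm] at this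
  have e4 := KStructure.coeff_pair_left hm'.cont hint hlu (hf.integral hG (hsing J))
  have e5 := KStructure.coeff_pair_right hm'.cont hint (hσ.mem_ge (hf.integral hG (hsing I))) hlt'
  rw [hf1, hm'.leading] at e4
  rw [hσI, hm'.leading] at e5
  have e6 := congrArg (fun x => S.coeff x β) e0
  simp only [S.coeff_add, S.coeff_zero] at e6
  rw [e4, e5, e3] at e6
  rw [wordDiff, huJ, rightOp_concat, ← huJ, leftOp, ← e6]
  simp only [LinearMap.smul_apply, LinearMap.flip_apply, map_smul]
  abel

end Defect

/-! ### Words in the generators -/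

section GeneratorWords

variable {ι : Type*} [LinearOrder ι]

/-- The word whose entries are singletons. -/
def generatorWord (v : List ι) : List (Finset ι) := v.map fun i => {i}

/-- Consequently cochains supported on lower words vanish on all words in the generators. -/
theorem isUpper_or_isCritical_generatorWord (p : WithTop ι) (v : List ι) :
    IsUpper p (generatorWord v) ∨ IsCritical p (generatorWord v) := by
  induction v generalizing p with
  | nil => exact .inr (.nil p)
  | cons j t ih =>
    by_cases h : (j : WithTop ι) ≤ p
    · rcases ih j with h' | h'
      · exact .inl (.cons p j _ h h')
      · exact .inr (.cons p j _ h h')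
    · exact .inl (.ascent p _ _ (by simp) (by simpa using h))

theorem IsCritical.exists_generatorWord {p : WithTop ι} {w : List (Finset ι)}
    (h : IsCritical p w) : ∃ v : List ι, w = generatorWord v ∧ v.Pairwise (· ≥ ·) ∧
      ∀ i ∈ v, (i : WithTop ι) ≤ p := by
  induction h with
  | nil p => exact ⟨[], rfl, .nil, by simp⟩
  | cons p j t hj _ ih =>
    obtain ⟨v, rfl, hv, hle⟩ := ih
    refine ⟨j :: v, rfl, List.pairwise_cons.mpr ⟨fun i hi => WithTop.coe_le_coe.mp (hle i hi), hv⟩,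
      fun i hi => ?_⟩
    rcases List.mem_cons.mp hi with rfl | hi
    · exact hj
    · exact (hle i hi).trans hj

/-- A word has only one weakly decreasing rearrangement, so any other rearrangement is not critical.
-/
theorem isUpper_generatorWord_of_perm {u v : List ι} (h : u.Perm v) (hne : u ≠ v)
    (hv : IsCritical ⊤ (generatorWord v)) : IsUpper ⊤ (generatorWord u) := by
  refine (isUpper_or_isCritical_generatorWord ⊤ u).resolve_right fun hu => hne ?_
  have inj : Function.Injective (generatorWord (ι := ι)) :=
    List.map_injective_iff.mpr Finset.singleton_injective
  obtain ⟨v', hv', hs, -⟩ := hv.exists_generatorWord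
  obtain ⟨u', hu', hs', -⟩ := hu.exists_generatorWord
  obtain rfl := inj hv'
  obtain rfl := inj hu'
  exact h.eq_of_pairwise (fun a b _ _ h1 h2 => le_antisymm h2 h1) hs' hs

end GeneratorWords

/-! ### Reversing a block in all rearrangements of a list -/

section Reversal

/-- The reversal of the block of length `q` after the first `p` entries. -/
def reverseBlock {A : Type*} (p q : ℕ) (u : List A) : List A :=
  u.take p ++ ((u.drop p).take q).reverse ++ u.drop (p + q)

variable {A : Type*} {p q : ℕ} {u : List A}

theorem reverseBlock_perm (p q : ℕ) (u : List A) : (reverseBlock p q u).Perm u := by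
  have h : u.take p ++ (u.drop p).take q ++ u.drop (p + q) = u := by
    rw [← List.drop_drop, List.append_assoc, List.take_append_drop, List.take_append_drop]
  conv_rhs => rw [← h]
  exact ((List.reverse_perm _).append_left _).append_right _

theorem reverseBlock_parts (h : p + q ≤ u.length) :
    (reverseBlock p q u).take p = u.take p ∧
    ((reverseBlock p q u).drop p).take q = ((u.drop p).take q).reverse ∧
    (reverseBlock p q u).drop (p + q) = u.drop (p + q) := by
  have h1 : (u.take p).length = p := by simp; omega
  have h2 : ((u.drop p).take q).reverse.length = q := by simp; omega
  have h3 : (u.take p ++ ((u.drop p).take q).reverse).length = p + q := by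
    rw [List.length_append, h1, h2]
  refine ⟨?_, ?_, ?_⟩
  · rw [reverseBlock, List.append_assoc, List.take_left' h1]
  · rw [reverseBlock, List.append_assoc, List.drop_left' h1, List.take_left' h2]
  · rw [reverseBlock, List.drop_left' h3]

theorem reverseBlock_reverseBlock (h : p + q ≤ u.length) :
    reverseBlock p q (reverseBlock p q u) = u := by
  obtain ⟨h1, h2, h3⟩ := reverseBlock_parts h
  rw [reverseBlock, h1, h2, h3, List.reverse_reverse, ← List.drop_drop, List.append_assoc,
    List.take_append_drop, List.take_append_drop]

/-- A function on the rearrangements of a list that changes sign under the reversal of a block has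
sum equal to minus itself. -/
theorem sum_rearrangements_eq_neg [DecidableEq A] {W : Type*} [AddCommGroup W] {v : List A}
    (hpq : p + q ≤ v.length) {T : List A → W}
    (hT : ∀ u : List A, u.Perm v → T (reverseBlock p q u) = -T u) :
    ∑ u ∈ v.permutations.toFinset, T u = -∑ u ∈ v.permutations.toFinset, T u := by
  have hmem : ∀ u : List A, u ∈ v.permutations.toFinset ↔ u.Perm v := fun u => by
    rw [List.mem_toFinset, List.mem_permutations]
  rw [← Finset.sum_neg_distrib]
  refine Finset.sum_nbij' (reverseBlock p q) (reverseBlock p q) ?_ ?_ ?_ ?_ ?_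
  · exact fun u hu => (hmem _).mpr ((reverseBlock_perm p q u).trans ((hmem u).mp hu))
  · exact fun u hu => (hmem _).mpr ((reverseBlock_perm p q u).trans ((hmem u).mp hu))
  · exact fun u hu => reverseBlock_reverseBlock (((hmem u).mp hu).length_eq ▸ hpq)
  · exact fun u hu => reverseBlock_reverseBlock (((hmem u).mp hu).length_eq ▸ hpq)
  · exact fun u hu => by rw [hT u ((hmem u).mp hu), neg_neg]

end Reversal

/-! ### The symmetrised defect on generators -/

section Generators

/-- A block with two or more entries contributes zero, which leaves the decomposition into single
entries. -/
theorem blockSum_eq_of_strict {C W : Type*} [AddCommGroup C] [AddCommGroup W] {f : List C → C}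
    {φ : List C → W} (hφ : Slotwise IsAdd φ) {l : List C} (h1 : ∀ x ∈ l, f [x] = x)
    (h2 : ∀ b : List C, (∀ x ∈ b, x ∈ l) → 2 ≤ b.length → f b = 0) : blockSum f φ l = φ l := by
  induction l generalizing φ with
  | nil => rfl
  | cons x t ih =>
    rw [blockSum_cons, splitSum_eq_nil_left, h1 x (by simp), ih (hφ.cons x)
      (fun y hy => h1 y (by simp [hy])) fun b hb => h2 b fun y hy => by simp [hb y hy]]
    intro u v huv hu
    have h3 := List.length_pos_of_ne_nil hu
    rw [h2 (x :: u) (fun y hy => ?_) (by simp; omega)]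
    · exact blockSum_zero fun _ _ _ => (hφ.head _).map_zero
    · rcases List.mem_cons.mp hy with rfl | hy
      · simp
      · simp [← huv, hy]

variable {k : Type*} [Field k] {N : ℕ}
  {C : Type*} [NormedAddCommGroup C] [Module (Novikov k) C]
  {Cbar : Type*} [AddCommGroup Cbar] [Module k Cbar]
  {gr : ZMod N → Submodule (Novikov k) C} {grbar : ZMod N → Submodule k Cbar}
  {S : KStructure gr grbar} {ι : Type*} [LinearOrder ι] {e : Module.Basis (Finset ι) k Cbar}
  {G : AddSubmonoid ℝ}
  {μ : Cbar →ₗ[k] Cbar →ₗ[k] Cbar} {d : ι → ZMod N} {s : Finset ι → k}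
  {c : Finset ι → Finset ι → k} {σ : C →ₗ[Novikov k] C} {σbar : Cbar →ₗ[k] Cbar}

theorem KStructure.eq_zero_of_eq_neg (S : KStructure gr grbar) (hk : ringChar k ≠ 2) {x : C}
    (h : x = -x) : x = 0 := by
  refine S.ext_coeff fun E => ?_
  have h1 : S.coeff x E = -S.coeff x E := by
    conv_lhs => rw [h, S.coeff_neg]
  have h2 : (2 : k) • S.coeff x E = 0 := by
    rw [two_smul]; nth_rewrite 1 [h1]; exact neg_add_cancel _
  rw [S.coeff_zero]
  exact (smul_eq_zero.mp h2).resolve_left (Ring.two_ne_zero hk)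

/-- The sum of the defect over all rearrangements of a word in the generators vanishes. -/
theorem sum_defect_generatorWord [DecidableEq ι] (hk : ringChar k ≠ 2)
    (hb : IsExteriorBasis grbar e μ d s c)
    (hp : IsParity gr σ) {m m' f : List C → C} (hm : IsMinimalOps gr S e G μ σ m)
    (hm' : IsMinimalOps gr S e G μ σ m') (hf : IsContMultilinear (k := k) f)
    (hf1 : ∀ i, f [S.incl (e {i})] = S.incl (e {i}))
    (hf2 : ∀ v : List ι, 2 ≤ v.length → f (S.word e (generatorWord v)) = 0) (v : List ι) :
    ∑ u ∈ v.permutations.toFinset, defect σ m m' f (S.word e (generatorWord u)) = 0 := by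
  have hmem : ∀ u : List ι, u ∈ v.permutations.toFinset ↔ u.Perm v := fun u => by
    rw [List.mem_toFinset, List.mem_permutations]
  have hX : ∀ u : List ι, S.word e (generatorWord u) = u.map fun i => S.incl (e {i}) := fun u => by
    simp [KStructure.word, generatorWord]
  have hrev : ∀ u : List ι, m (u.map fun i => S.incl (e {i})).reverse
      = -m (u.map fun i => S.incl (e {i})) := fun u => by rw [← hX]; exact hm.reverse u
  have hrev' : ∀ u : List ι, m' (u.map fun i => S.incl (e {i})).reverse
      = -m' (u.map fun i => S.incl (e {i})) := fun u => by rw [← hX]; exact hm'.reverse u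
  have hσ : ∀ u : List ι, (u.map fun i => S.incl (e {i})).map σ = u.map fun i => S.incl (e {i}) :=
    fun u => by
      rw [List.map_map]
      refine List.map_congr_left fun i _ => ?_
      rw [Function.comp_apply, hb.parity hp, hb.monomial.sign_singleton, one_smul]
  simp only [defect, Finset.sum_sub_distrib]
  rw [sub_eq_zero]
  -- As `f` is strict on the generators, the block sum is `m'` of the word itself, and reversing the
  -- whole word changes its sign.
  have h1 : ∑ u ∈ v.permutations.toFinset, blockSum f m' (S.word e (generatorWord u)) = 0 := by
    have h2 : ∀ u : List ι, blockSum f m' (S.word e (generatorWord u))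
        = m' (u.map fun i => S.incl (e {i})) := fun u => by
      rw [← hX]
      refine blockSum_eq_of_strict hm'.cont.isAdd (fun x hx => ?_) fun b hb hb2 => ?_
      · rw [hX] at hx
        obtain ⟨i, -, rfl⟩ := List.mem_map.mp hx
        exact hf1 i
      · have : ∃ u' : List ι, b = u'.map fun i => S.incl (e {i}) := by
          have h3 : ∀ x ∈ b, ∃ i, S.incl (e {i}) = x := fun x hx => by
            have := hb x hx
            rw [hX] at this
            obtain ⟨i, -, rfl⟩ := List.mem_map.mp this
            exact ⟨i, rfl⟩
          clear hb hb2
          induction b with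
          | nil => exact ⟨[], rfl⟩
          | cons x t ih =>
            obtain ⟨u', rfl⟩ := ih fun y hy => h3 y (by simp [hy])
            obtain ⟨i, rfl⟩ := h3 x (by simp)
            exact ⟨i :: u', rfl⟩
        obtain ⟨u', rfl⟩ := this
        rw [← hX]
        exact hf2 u' (by simpa using hb2)
    simp only [h2]
    refine S.eq_zero_of_eq_neg hk (sum_rearrangements_eq_neg (p := 0) (q := v.length) (by simp)
      fun u hu => ?_)
    have : reverseBlock 0 v.length u = u.reverse := by simp [reverseBlock, ← hu.length_eq]
    rw [this, List.map_reverse, hrev']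
  rw [h1]
  -- Generators have odd degree and are fixed by `σ`, so the insertions carry no signs. The
  -- summation over rearrangements can then be done first, with position and length of the inserted
  -- block fixed.
  have hlen : ∀ u ∈ v.permutations.toFinset, insertOp σ m f (S.word e (generatorWord u))
      = ∑ p ∈ Finset.range (v.length + 1), ∑ q ∈ Finset.range (v.length + 1 - p),
        f ((u.take p).map (fun i => S.incl (e {i})) ++
          m (((u.drop p).take q).map fun i => S.incl (e {i})) ::
            (u.drop (p + q)).map fun i => S.incl (e {i})) := by
    intro u hu
    rw [insertOp_eq_sum, hX, List.length_map, ((hmem u).mp hu).length_eq]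
    refine Finset.sum_congr rfl fun p _ => Finset.sum_congr rfl fun q _ => ?_
    rw [← List.map_take, hσ, ← List.map_drop, ← List.map_take, ← List.map_drop]
  rw [Finset.sum_congr rfl hlen, Finset.sum_comm]
  refine (Finset.sum_eq_zero fun p hp => ?_).symm
  rw [Finset.sum_comm]
  refine Finset.sum_eq_zero fun q hq => ?_
  have hpq : p + q ≤ v.length := by
    have := Finset.mem_range.mp hp
    have := Finset.mem_range.mp hq
    omega
  -- Only the inputs of `m` are reversed; the other inputs of `f` are unchanged, so the sign of `m`
  -- passes through `f`.
  refine S.eq_zero_of_eq_neg hk (sum_rearrangements_eq_neg hpq fun u hu => ?_)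
  obtain ⟨e1, e2, e3⟩ := reverseBlock_parts (u := u) (hu.length_eq ▸ hpq)
  rw [e1, e2, e3, List.map_reverse, hrev]
  exact (hf.isAdd _ _).map_neg _

end Generators

/-! ### Degrees of words and of the Hochschild differential -/

section WordDegree

variable {ι : Type*} [LinearOrder ι] {N : ℕ} (d : ι → ZMod N)

/-- The degree of a word. -/
def wordDegree (w : List (Finset ι)) : ZMod N := (w.map (monomialDegree d)).sum

theorem wordDegree_nil : wordDegree d [] = 0 := rfl

theorem wordDegree_cons (I : Finset ι) (w : List (Finset ι)) :
    wordDegree d (I :: w) = monomialDegree d I + wordDegree d w := by simp [wordDegree]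

theorem wordDegree_append (u w : List (Finset ι)) :
    wordDegree d (u ++ w) = wordDegree d u + wordDegree d w := by simp [wordDegree]

theorem sum_letters (w : List (Finset ι)) : ((letters w).map d).sum = wordDegree d w := by
  induction w with
  | nil => rfl
  | cons I t ih =>
    rw [letters, List.map_append, List.sum_append, ih, wordDegree_cons, monomialDegree,
      Finset.sum_eq_multiset_sum, ← Finset.sort_eq I (· ≤ ·), Multiset.map_coe, Multiset.sum_coe]

theorem IsLower.wordDegree_lift {p : WithTop ι} {w : List (Finset ι)} (h : IsLower p w) :
    wordDegree d (lift w) = wordDegree d w := by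
  rw [← sum_letters, h.letters_lift, sum_letters]

variable {d}
variable {k M : Type*} [CommRing k] [AddCommGroup M] [Module k M]
  {s : Finset ι → k} {c : Finset ι → Finset ι → k} {L R : Finset ι → M →ₗ[k] M}

theorem wordDiff_congr {Ψ Ψ' : List (Finset ι) → M} {n : ℕ}
    (h : ∀ w : List (Finset ι), w.length = n → Ψ w = Ψ' w)
    {w : List (Finset ι)} (hw : w.length = n + 1) :
    wordDiff s c L R Ψ w = wordDiff s c L R Ψ' w := by
  rw [← sub_eq_zero, ← wordDiff_sub]
  exact wordDiff_eq_zero (fun w hw => by rw [h w hw, sub_self]) hw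

theorem mergeOp_mem {grM : ZMod N → Submodule k M} (hc : ∀ I J, ¬ Disjoint I J → c I J = 0)
    {Ψ : List (Finset ι) → M} {a : ZMod N}
    (h : ∀ w, Ψ w ∈ grM (a + wordDegree d w - (w.length : ZMod N))) (u : List (Finset ι)) :
    mergeOp s c Ψ u ∈ grM (a + 1 + wordDegree d u - (u.length : ZMod N)) := by
  induction u generalizing Ψ a with
  | nil => exact zero_mem _
  | cons I t ih =>
    cases t with
    | nil => exact zero_mem _
    | cons J t =>
      refine add_mem ?_ (Submodule.smul_mem _ _ ?_)
      · by_cases hd : Disjoint I J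
        · refine Submodule.smul_mem _ _ ?_
          have := h ((I ∪ J) :: t)
          rw [wordDegree_cons, monomialDegree, Finset.sum_union hd] at this
          refine (congrArg (fun i => _ ∈ grM i) ?_).mp this
          simp only [wordDegree_cons, monomialDegree, List.length_cons]
          push_cast; ring
        · rw [hc I J hd, zero_smul]; exact zero_mem _
      · have := ih (Ψ := fun w => Ψ (I :: w)) (a := a + monomialDegree d I - 1) fun w => by
          refine (congrArg (fun i => _ ∈ grM i) ?_).mp (h (I :: w))
          simp only [wordDegree_cons, List.length_cons]
          push_cast; ring
        refine (congrArg (fun i => _ ∈ grM i) ?_).mp this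
        simp only [wordDegree_cons, List.length_cons]
        push_cast; ring

/-- All three parts preserve the total degree and shorten the word by one entry. The product may
fail to have the expected degree only when the sets meet, and then its coefficient is zero. -/
theorem wordDiff_mem {grM : ZMod N → Submodule k M} (hc : ∀ I J, ¬ Disjoint I J → c I J = 0)
    (hL : ∀ I i, ∀ x ∈ grM i, L I x ∈ grM (monomialDegree d I + i))
    (hR : ∀ I i, ∀ x ∈ grM i, R I x ∈ grM (monomialDegree d I + i))
    {Ψ : List (Finset ι) → M} {a : ZMod N}
    (h : ∀ w, Ψ w ∈ grM (a + wordDegree d w - (w.length : ZMod N))) (u : List (Finset ι)) :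
    wordDiff s c L R Ψ u ∈ grM (a + 1 + wordDegree d u - (u.length : ZMod N)) := by
  refine add_mem (add_mem (mergeOp_mem hc h u) ?_) ?_
  · cases u with
    | nil => exact zero_mem _
    | cons I t =>
      refine (congrArg (fun i => _ ∈ grM i) ?_).mp (hL I _ _ (h t))
      simp only [wordDegree_cons, List.length_cons]
      push_cast; ring
  · rcases List.eq_nil_or_concat u with rfl | ⟨t, I, rfl⟩
    · exact zero_mem _
    · rw [List.concat_eq_append, rightOp_concat]
      refine (congrArg (fun i => _ ∈ grM i) ?_).mp (hR I _ _ (h t))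
      simp only [wordDegree_append, wordDegree_cons, wordDegree_nil, List.length_append,
        List.length_cons, List.length_nil]
      push_cast; ring

end WordDegree

/-! ### Corrections by Hochschild cochains on an exterior algebra -/

section ExteriorBasis

variable {k : Type*} [Field k] {N : ℕ} {Cbar : Type*} [AddCommGroup Cbar] [Module k Cbar]
  {grbar : ZMod N → Submodule k Cbar} {ι : Type*} [LinearOrder ι]
  {e : Module.Basis (Finset ι) k Cbar} {μ : Cbar →ₗ[k] Cbar →ₗ[k] Cbar} {d : ι → ZMod N}
  {s : Finset ι → k} {c : Finset ι → Finset ι → k}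

namespace IsExteriorBasis

variable (hb : IsExteriorBasis grbar e μ d s c)
include hb

theorem map_mem {f : Cbar →ₗ[k] Cbar} {I : Finset ι}
    (hf : ∀ J, f (e J) ∈ grbar (monomialDegree d I + monomialDegree d J)) {i : ZMod N} {x : Cbar}
    (hx : x ∈ grbar i) : f x ∈ grbar (monomialDegree d I + i) := by
  have h : Submodule.span k (e '' {J | monomialDegree d J = i})
      ≤ (grbar (monomialDegree d I + i)).comap f := by
    rw [Submodule.span_le]
    rintro _ ⟨J, rfl, rfl⟩
    exact hf J
  exact h (hb.le_span i hx)

theorem mul_mem (I J : Finset ι) :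
    μ (e I) (e J) ∈ grbar (monomialDegree d I + monomialDegree d J) := by
  rw [hb.mul]
  by_cases h : Disjoint I J
  · refine Submodule.smul_mem _ _ ?_
    have := hb.mem (I ∪ J)
    rwa [monomialDegree, Finset.sum_union h] at this
  · rw [hb.monomial.of_not_disjoint I J h, zero_smul]; exact zero_mem _

theorem mul_left_mem (I : Finset ι) (i : ZMod N) (x : Cbar) (hx : x ∈ grbar i) :
    μ (e I) x ∈ grbar (monomialDegree d I + i) := hb.map_mem (fun J => hb.mul_mem I J) hx

theorem mul_right_mem (I : Finset ι) (i : ZMod N) (x : Cbar) (hx : x ∈ grbar i) :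
    μ.flip (e I) x ∈ grbar (monomialDegree d I + i) :=
  hb.map_mem (fun J => by rw [add_comm]; exact hb.mul_mem J I) hx

theorem one_mul (x : Cbar) : μ (e ∅) x = x := by
  have : μ (e ∅) = LinearMap.id := e.ext fun J => by
    rw [hb.mul, hb.monomial.empty_left, one_smul, Finset.empty_union]; rfl
  rw [this]; rfl

theorem sign_mul_self (I : Finset ι) : s I * s I = 1 := by
  rw [hb.sign, ← Int.cast_mul, degSign_mul_self, Int.cast_one]

/-- Since `μ` is the associative product up to the sign of the left factor, right multiplication by
the unit is the sign of the degree rather than the identity. -/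
theorem involutive : Function.Involutive (μ.flip (e ∅)) := by
  intro x
  have : μ.flip (e ∅) ∘ₗ μ.flip (e ∅) = LinearMap.id := e.ext fun I => by
    simp only [LinearMap.comp_apply, LinearMap.flip_apply, hb.mul_one, map_smul,
      smul_smul, LinearMap.id_apply]
    rw [neg_mul_neg, hb.sign_mul_self, one_smul]
  exact LinearMap.congr_fun this x

/-- Right multiplication by the unit. -/
def unitEquiv : Cbar ≃ₗ[k] Cbar := LinearEquiv.ofInvolutive (μ.flip (e ∅)) hb.involutive

theorem unitEquiv_symm_mem {i : ZMod N} {x : Cbar} (hx : x ∈ grbar i) :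
    hb.unitEquiv.symm x ∈ grbar i := by
  have h : hb.unitEquiv.symm x = μ.flip (e ∅) x := by
    rw [LinearEquiv.symm_apply_eq]
    exact (hb.involutive x).symm
  rw [h]
  simpa [monomialDegree] using hb.mul_right_mem ∅ i x hx

open Classical in
/-- The correction of a cochain on upper words. -/
theorem exists_correction [WellFoundedLT ι] (Nw : List (Finset ι) → Cbar) :
    ∃ Ψ : List (Finset ι) → Cbar,
      (∀ u, IsUpper ⊤ u → Ψ u = 0) ∧ (∀ u, IsCritical ⊤ u → Ψ u = 0) ∧
      (∀ u, IsUpper ⊤ u →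
        Nw u = wordDiff s c (fun I => -μ (e I)) (fun I => -μ.flip (e I)) Ψ u) ∧
      ((∀ u, Nw u ∈ grbar (wordDegree d u + 2 - (u.length : ZMod N))) →
        ∀ w, Ψ w ∈ grbar (wordDegree d w + 1 - (w.length : ZMod N))) := by
  -- The defect changes by minus the differential of the correction, hence the input `-Nw` and the
  -- right action `-unitEquiv` of the unit.
  obtain ⟨Ψ, hU, hC, h, hQ⟩ := exists_wordDiff_eq (L := fun I => -μ (e I))
    (R := fun I => -μ.flip (e I)) hb.monomial (r := hb.unitEquiv.trans (LinearEquiv.neg k))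
    (fun x => rfl) (fun x => by rw [LinearMap.neg_apply, hb.one_mul]) (fun w => -Nw w)
  refine ⟨Ψ, hU, hC, fun u hu => ?_, fun hN => hQ
    (fun w => grbar (wordDegree d w + 1 - (w.length : ZMod N)))
    (fun w => grbar (wordDegree d w + 2 - (w.length : ZMod N))) (fun u => neg_mem (hN u))
    (fun Ψ hΨ u => ?_) fun w hw x hx => ?_⟩
  · have := h u hu
    rwa [neg_add_eq_zero] at this
  · have := wordDiff_mem (s := s) (grM := grbar) (d := d) (a := 1) hb.monomial.of_not_disjoint
      (L := fun I => -μ (e I)) (R := fun I => -μ.flip (e I))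
      (fun I i x hx => neg_mem (hb.mul_left_mem I i x hx))
      (fun I i x hx => neg_mem (hb.mul_right_mem I i x hx)) (Ψ := Ψ)
      (fun w => by rw [add_comm 1]; exact hΨ w) u
    refine (congrArg (fun i => _ ∈ grbar i) ?_).mp this
    ring
  · have h1 : x ∈ grbar (wordDegree d w + 1 - (w.length : ZMod N)) := by
      refine (congrArg (fun i => _ ∈ grbar i) ?_).mp hx
      rw [hw.wordDegree_lift, hw.length_lift]
      push_cast; ring
    exact ⟨h1, hb.unitEquiv_symm_mem (neg_mem h1)⟩

end IsExteriorBasis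

end ExteriorBasis

/-- Well-founded recursion, with a default value. -/
theorem exists_eq_of_wellFounded {A B : Type*} {r : A → A → Prop} (hr : WellFounded r)
    [∀ a b, Decidable (r a b)] (z : B) (step : A → (A → B) → B) :
    ∃ F : A → B, ∀ p, F p = step p (fun q => if r q p then F q else z) := by
  refine ⟨hr.fix fun p rec => step p fun q => if h : r q p then rec q h else z, fun p => ?_⟩
  rw [hr.fix_eq]
  simp only [dite_eq_ite]

theorem wellFoundedLT_of_finite {G : AddSubmonoid ℝ}
    (hG_finite : ∀ E : ℝ, {x : ℝ | x ∈ G ∧ x ≤ E}.Finite) : WellFoundedLT G := by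
  refine ⟨WellFounded.wellFounded_iff_has_min.mpr fun T ⟨b, hb⟩ => ?_⟩
  have hfin : {x : G | x ∈ T ∧ x ≤ b}.Finite :=
    Set.Finite.of_finite_image ((hG_finite b).subset (by
      rintro _ ⟨x, hx, rfl⟩; exact ⟨x.2, hx.2⟩)) Subtype.val_injective.injOn
  obtain ⟨a, ha, hmin⟩ := hfin.exists_minimal ⟨b, hb, le_rfl⟩
  refine ⟨a, ha.1, fun x hx hlt => ?_⟩
  exact absurd (hmin ⟨hx, hlt.le.trans ha.2⟩ hlt.le) (not_le.mpr hlt)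

/-! ### Recursive construction of the homomorphism -/

section Construction

variable {k : Type*} [Field k] {N : ℕ}
  {C : Type*} [NormedAddCommGroup C] [Module (Novikov k) C]
  {Cbar : Type*} [AddCommGroup Cbar] [Module k Cbar]
  {gr : ZMod N → Submodule (Novikov k) C} {grbar : ZMod N → Submodule k Cbar}
  {S : KStructure gr grbar} {ι : Type*} [LinearOrder ι] {e : Module.Basis (Finset ι) k Cbar}
  {G : AddSubmonoid ℝ}
  {μ : Cbar →ₗ[k] Cbar →ₗ[k] Cbar} {d : ι → ZMod N} {s : Finset ι → k}
  {c : Finset ι → Finset ι → k} {σ : C →ₗ[Novikov k] C} {σbar : Cbar →ₗ[k] Cbar}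

variable (S e) in
/-- The function of lists `f` has components `F` on words. -/
structure IsWordExtension (F : ℕ × G → List (Finset ι) → Cbar) (f : List C → C) : Prop
    extends IsGappedMap S e G f where
  coeff_word : ∀ (w : List (Finset ι)) (β : G), S.coeff (f (S.word e w)) β = F (w.length, β) w

-- The graded pieces are closed and their coefficients are spanned by monomials of the same degree,
-- so approximation by words reduces all homogeneous lists to this case.
variable (S) in
theorem hasDegree_of_word (hb : IsExteriorBasis grbar e μ d s c) {f : List C → C}
    (hf : IsContMultilinear (k := k) f) {δ : ZMod N}
    (h : ∀ w, f (S.word e w) ∈ gr (wordDegree d w + δ - (w.length : ZMod N))) :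
    HasDegree gr δ f := by
  intro α dl hα
  have hclosed : IsClosed ((gr (dl.sum + δ - (α.length : ZMod N))).toAddSubgroup : Set C) := by
    have := S.isClosed_coeff fun _ => (grbar (dl.sum + δ - (α.length : ZMod N)) : Set Cbar)
    convert this using 1
    ext x
    exact S.mem_gr _ x
  refine S.slotwise_mem hf (Q := (gr _).toAddSubgroup) hclosed (F := Set.univ)
    (fun E _ a q hq => Submodule.smul_mem _ _ hq)
    (fun i => e '' {I | monomialDegree d I = i}) (fun β hβ => ?_) (hα.imp fun x i hx => ?_)
  · suffices H : ∃ w, β.map S.incl = S.word e w ∧ wordDegree d w = dl.sum by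
      obtain ⟨w, hw, hd⟩ := H
      have h1 := h w
      rw [← S.length_word e w, ← hw, List.length_map, hβ.length_eq, ← hα.length_eq, hd] at h1
      exact hw ▸ h1
    clear hα hclosed
    induction hβ with
    | nil => exact ⟨[], rfl, rfl⟩
    | cons hb' _ ih =>
      obtain ⟨I, rfl, rfl⟩ := hb'
      obtain ⟨w, hw, hd⟩ := ih
      exact ⟨I :: w, by rw [List.map_cons, hw, S.word_cons], by
        rw [wordDegree_cons, hd, List.sum_cons]⟩
  · exact ⟨fun _ _ => trivial, fun E => hb.le_span i ((S.mem_gr i x).mp hx E)⟩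

theorem IsWordExtension.hasDegree (hb : IsExteriorBasis grbar e μ d s c)
    {F : ℕ × G → List (Finset ι) → Cbar} {f : List C → C} (hf : IsWordExtension S e F f)
    (hF : ∀ p w, F p w ∈ grbar (wordDegree d w + 1 - (w.length : ZMod N))) :
    HasDegree gr 1 f := by
  refine hasDegree_of_word S hb hf.cont fun w => ?_
  rw [S.mem_gr]
  intro E
  by_cases hE : E ∈ G
  · change S.coeff _ E ∈ _
    rw [hf.coeff_word w ⟨E, hE⟩]
    exact hF _ _
  · have := hf.gapped w E hE
    rw [KStructure.coeff] at this
    rw [this]; exact zero_mem _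

open Classical in
/-- The components of the homomorphism. -/
theorem exists_components [WellFoundedLT ι]
    (hG_finite : ∀ E : ℝ, {x : ℝ | x ∈ G ∧ x ≤ E}.Finite)
    (hb : IsExteriorBasis grbar e μ d s c)
    (m m' : List C → C) (X : (ℕ × G → List (Finset ι) → Cbar) → List C → C) (σ : C → C) :
    ∃ F : ℕ × G → List (Finset ι) → Cbar,
      (∀ I, F (1, 0) [I] = e I) ∧ (∀ w, w.length ≠ 1 → F (1, 0) w = 0) ∧
      ∀ p, p ≠ (1, 0) →
        (∀ u, IsUpper ⊤ u → F p u = 0) ∧ (∀ u, IsCritical ⊤ u → F p u = 0) ∧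
        (∀ u, IsUpper ⊤ u → u.length = p.1 + 1 →
          S.coeff (defect σ m m' (X fun q => if Prod.Lex (· < ·) (· < ·) q p then F q else 0)
            (S.word e u)) p.2
          = wordDiff s c (fun I => -μ (e I)) (fun I => -μ.flip (e I)) (F p) u) ∧
        ((∀ u, u.length = p.1 + 1 →
          S.coeff (defect σ m m' (X fun q => if Prod.Lex (· < ·) (· < ·) q p then F q else 0)
            (S.word e u)) p.2 ∈ grbar (wordDegree d u + 2 - (u.length : ZMod N))) →
          ∀ w, F p w ∈ grbar (wordDegree d w + 1 - (w.length : ZMod N))) := by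
  have := wellFoundedLT_of_finite hG_finite
  -- The component in arity one and exponent zero is the identity. Any other component corrects, on
  -- upper words with one more entry, the defect of the map formed from the earlier components. The
  -- values of a component on words of any length other than its arity are never used.
  let step : ℕ × G → (ℕ × G → List (Finset ι) → Cbar) → List (Finset ι) → Cbar := fun p F =>
    if p = (1, 0) then fun w => match w with
      | [I] => e I
      | _ => 0
    else Classical.choose (hb.exists_correction fun u => if u.length = p.1 + 1 then
      S.coeff (defect σ m m' (X F) (S.word e u)) p.2 else 0)
  obtain ⟨F, hF⟩ := exists_eq_of_wellFounded
    (r := Prod.Lex (· < ·) (· < ·)) (WellFounded.prod_lex (wellFounded_lt (α := ℕ))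
      (wellFounded_lt (α := G))) (0 : List (Finset ι) → Cbar) step
  refine ⟨F, fun I => ?_, fun w hw => ?_, fun p hp => ?_⟩
  · rw [hF]; simp only [step, if_pos]
  · rw [hF]; simp only [step, if_pos]
    match w with
    | [] => rfl
    | [I] => simp at hw
    | I :: J :: t => rfl
  · have h1 : F p = _ := hF p
    simp only [step, if_neg hp] at h1
    obtain ⟨hU, hC, h2, h3⟩ := Classical.choose_spec (hb.exists_correction fun u =>
      if u.length = p.1 + 1 then S.coeff (defect σ m m'
        (X fun q => if Prod.Lex (· < ·) (· < ·) q p then F q else 0) (S.word e u)) p.2 else 0)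
    rw [← h1] at hU hC h2 h3
    refine ⟨hU, hC, fun u hu hl => ?_, fun h => h3 fun u => ?_⟩
    · rw [← h2 u hu, if_pos hl]
    · split_ifs with hl
      · exact h u hl
      · exact zero_mem _

theorem IsWordExtension.coeff_nil {F : ℕ × G → List (Finset ι) → Cbar} {f : List C → C}
    (hf : IsWordExtension S e F f) (h : ∀ β, F (0, β) [] = 0) : f [] = 0 := by
  refine S.ext_coeff fun E => ?_
  rw [S.coeff_zero]
  by_cases hE : E ∈ G
  · exact (hf.coeff_word [] ⟨E, hE⟩).trans (h _)
  · exact hf.gapped [] E hE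

theorem IsMinimalOps.defect_nil {m m' f : List C → C} (hm : IsMinimalOps gr S e G μ σ m)
    (hm' : IsMinimalOps gr S e G μ σ m') (hf : IsContMultilinear (k := k) f) :
    defect σ m m' f [] = 0 := by
  rw [defect, blockSum_nil, insertOp_nil, hm.nil, hm'.nil,
    show f [0] = 0 from (hf.isAdd [] []).map_zero, sub_zero]

theorem IsMinimalOps.defect_singleton {m m' f : List C → C} (hm : IsMinimalOps gr S e G μ σ m)
    (hm' : IsMinimalOps gr S e G μ σ m') (hf : IsContMultilinear (k := k) f) (x : C) :
    defect σ m m' f [x] = 0 := by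
  rw [defect, blockSum_cons, splitSum_nil, blockSum_nil, hm'.single,
    insertOp_eq_adjacentOp hm.nil hm.single hf.isAdd (by simp), adjacentOp, sub_zero]

/-- At exponent zero the equation on pairs compares the two leading products, which agree. So the
prescribed identity component meets no obstruction. -/
theorem coeff_defect_pair (hb : IsExteriorBasis grbar e μ d s c) (hp : IsParity gr σ)
    (hG : ∀ x ∈ G, 0 ≤ x) {m m' f : List C → C} (hm : IsMinimalOps gr S e G μ σ m)
    (hm' : IsMinimalOps gr S e G μ σ m') (hf : IsGappedMap S e G f) (hf0 : f [] = 0)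
    (hf1 : ∀ I, S.coeff (f [S.incl (e I)]) 0 = e I) (I J : Finset ι) :
    S.coeff (defect σ m m' f (S.word e [I, J])) 0 = 0 := by
  have hint := fun l hl => hm'.integral (l := l) hG hl
  have hsing : ∀ I, f [S.incl (e I)] ∈ S.ge 0 := fun I => hf.integral hG
    (.cons (S.incl_mem_ge _) KStructure.isIntegralList_nil)
  have h1 := coeff_adjacentOp (n := 1) (β := 0) hb hp hG hm hf.cont
    (fun l _ hl => hf.integral hG hl) (w := [I, J]) rfl
  have h2 : blockSum f m' (S.word e [I, J]) = m' [f [S.incl (e I)], f [S.incl (e J)]] := by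
    simp [KStructure.word, blockSum_cons, splitSum_cons, splitSum_nil, blockSum_nil, hm'.single]
  have h3 := KStructure.coeff_pair_left hm'.cont hint (hsing I) (hsing J)
  rw [hf1, hf1, hm'.leading, hb.mul] at h3
  rw [defect, insertOp_eq_adjacentOp hm.nil hm.single hf.cont.isAdd, S.coeff_sub, h1, h2, h3]
  · simp only [mergeOp, smul_zero, add_zero]
    rw [show S.word e [I ∪ J] = [S.incl (e (I ∪ J))] from rfl, hf1, sub_self]
  · intro b hb'
    obtain rfl : b = [] := by simpa [S.length_word] using hb'
    exact hf0

open Classical in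
/-- The homomorphism with the given components has no defect. -/
theorem coeff_defect_eq_zero [WellFoundedLT ι] (hk : ringChar k ≠ 2) (hN : Even N)
    (hG : ∀ x ∈ G, 0 ≤ x) (hG_finite : ∀ E : ℝ, {x : ℝ | x ∈ G ∧ x ≤ E}.Finite)
    (hb : IsExteriorBasis grbar e μ d s c) (hp : IsParity gr σ) (hσ : IsStructured S σ σbar)
    {m m' f : List C → C} (hm : IsMinimalOps gr S e G μ σ m)
    (hm' : IsMinimalOps gr S e G μ σ m') {F : ℕ × G → List (Finset ι) → Cbar}
    (hf : IsWordExtension S e F f) (hfd : HasDegree gr 1 f)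
    {g : ℕ × G → List C → C} (hg : ∀ p, IsWordExtension S e
      (fun q => if Prod.Lex (· < ·) (· < ·) q p then F q else 0) (g p))
    (hF1 : ∀ I, F (1, 0) [I] = e I)
    (hFU : ∀ p, p ≠ (1, 0) → ∀ u, IsUpper ⊤ u → F p u = 0)
    (hFC : ∀ p, p ≠ (1, 0) → ∀ u, IsCritical ⊤ u → F p u = 0)
    (hFE : ∀ p, p ≠ (1, 0) → ∀ u, IsUpper ⊤ u → u.length = p.1 + 1 →
          S.coeff (defect σ m m' (g p) (S.word e u)) p.2
          = wordDiff s c (fun I => -μ (e I)) (fun I => -μ.flip (e I)) (F p) u)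
    (p : ℕ × G) : ∀ w : List (Finset ι), w.length = p.1 + 1 →
      S.coeff (defect σ m m' f (S.word e w)) p.2 = 0 := by
  have := wellFoundedLT_of_finite hG_finite
  have hEg : IsGappedMap S e G (defect σ m m' f) :=
    IsGappedMap.defect hσ hf.toIsGappedMap hm.toIsGappedMap hm'.toIsGappedMap
  have hf0 : f [] = 0 := hf.coeff_nil fun β => hFC _ (by simp) _ (.nil _)
  have hf1 : ∀ I, S.coeff (f [S.incl (e I)]) 0 = e I := fun I =>
    (hf.coeff_word [I] 0).trans (hF1 I)
  have hGz : ∀ β : G, (0 : G) ≤ β := fun β => hG β β.2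
  have hgen : ∀ p, p ≠ (1, 0) → ∀ v, F p (generatorWord v) = 0 := fun p hp v =>
    (isUpper_or_isCritical_generatorWord ⊤ v).elim (hFU p hp _) (hFC p hp _)
  -- All components except the identity vanish on words in the generators; hence `f` is strict
  -- there, as the symmetrisation argument requires.
  have hfv : ∀ v : List ι, 2 ≤ v.length → f (S.word e (generatorWord v)) = 0 := fun v hv => by
    refine S.ext_coeff fun E => ?_
    rw [S.coeff_zero]
    by_cases hE : E ∈ G
    · refine (hf.coeff_word _ ⟨E, hE⟩).trans (hgen _ (fun h => ?_) v)
      have := congrArg Prod.fst h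
      simp [generatorWord] at this
      omega
    · exact hf.gapped _ E hE
  have hfi : ∀ i, f [S.incl (e {i})] = S.incl (e {i}) := fun i => by
    refine S.ext_coeff fun E => ?_
    rw [S.coeff_incl]
    split_ifs with h0
    · rw [h0, hf1]
    · by_cases hE : E ∈ G
      · refine (hf.coeff_word [{i}] ⟨E, hE⟩).trans (hgen _ (fun h => h0 ?_) [i])
        exact congrArg (fun q : ℕ × G => (q.2 : ℝ)) h
      · exact hf.gapped [{i}] E hE
  -- The pair `(n, β)` stands for arity `n + 1` of the defect, the arity controlled by `f_{n,β}`.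
  refine (WellFounded.prod_lex (wellFounded_lt (α := ℕ)) (wellFounded_lt (α := G))).induction
    (C := fun p => ∀ w : List (Finset ι), w.length = p.1 + 1 →
      S.coeff (defect σ m m' f (S.word e w)) p.2 = 0) p ?_
  rintro ⟨n, β⟩ ih w hw
  rcases n.eq_zero_or_pos with rfl | hn
  · obtain ⟨I, rfl⟩ := List.length_eq_one_iff.mp hw
    rw [show S.word e [I] = [S.incl (e I)] from rfl, hm.defect_singleton hm' hf.cont, S.coeff_zero]
  by_cases hp1 : (n, β) = (1, 0)
  · obtain ⟨rfl, rfl⟩ := Prod.mk.inj hp1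
    obtain ⟨I, J, rfl⟩ := List.length_eq_two.mp hw
    exact coeff_defect_pair hb hp hG hm hm' hf.toIsGappedMap hf0 hf1 I J
  -- In lower arities the defect is zero at all exponents by induction; in arity `n + 1` only
  -- exponents below `β` are known. These are the hypotheses that make `β` a leading exponent.
  have hlt : ∀ l : List C, l.length < n + 1 → defect σ m m' f l = 0 := by
    intro l hl
    refine S.eq_zero_of_word e hEg.cont (n := l.length) (fun w hw' => ?_) rfl
    rcases Nat.eq_zero_or_pos l.length with h0 | h0
    · rw [h0] at hw'
      rw [List.eq_nil_of_length_eq_zero hw']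
      exact hm.defect_nil hm' hf.cont
    · refine S.ext_coeff fun E => ?_
      rw [S.coeff_zero]
      by_cases hE : E ∈ G
      · exact ih (l.length - 1, ⟨E, hE⟩) (.left _ _ (by omega)) w (by simp only; omega)
      · exact hEg.gapped _ E hE
  have hβ : ∀ l, l.length = n + 1 → S.IsIntegralList l → defect σ m m' f l ∈ S.ge β := by
    intro l hl hl'
    refine S.mem_ge_of_word e hEg.cont (fun w hw' E hE' => ?_) hl hl'
    by_cases hE : E ∈ G
    · exact ih (n, ⟨E, hE⟩) (.right _ hE') w hw'
    · exact hEg.gapped _ E hE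
  -- The coefficients in arity `n + 1` are extended by zero to words of other lengths, so that the
  -- cocycle equation holds on all words.
  have hcocycle : ∀ u : List (Finset ι), wordDiff s c (fun I => s I • μ (e I))
      (fun I => μ.flip (e I)) (fun w => if w.length = n + 1 then
        S.coeff (defect σ m m' f (S.word e w)) β else 0) u = 0 := by
    intro u
    by_cases hu : u.length = n + 2
    · rw [← wordDiff_coeff_defect hN hb hp hσ hG hm hm' hf.toIsGappedMap hfd hf1 hlt hβ hu]
      exact wordDiff_congr (fun w hw => if_pos hw) hu
    · rcases Nat.eq_zero_or_pos u.length with h0 | h0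
      · rw [List.eq_nil_of_length_eq_zero h0]
        simp [wordDiff, mergeOp, leftOp, rightOp]
      · exact wordDiff_eq_zero (n := u.length - 1) (fun w hw => if_neg (by omega)) (by omega)
  have hupper : ∀ u : List (Finset ι), IsUpper ⊤ u → u.length = n + 1 →
      S.coeff (defect σ m m' f (S.word e u)) β = 0 := by
    intro u hu hul
    -- The identity component precedes `(n, β)`, so the truncated map `g (n, β)` also has it as
    -- leading linear part.
    have hlex : Prod.Lex (· < ·) (· < ·) ((1 : ℕ), (0 : G)) (n, β) := by
      rcases Nat.lt_or_ge 1 n with h' | h'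
      · exact .left _ _ h'
      · obtain rfl : n = 1 := by omega
        exact .right _ ((hGz β).lt_of_ne fun h => hp1 (by rw [← h]))
    have hg1 : ∀ I, S.coeff (g (n, β) [S.incl (e I)]) 0 = e I := fun I => by
      refine ((hg (n, β)).coeff_word [I] 0).trans ?_
      simp only [List.length_singleton, if_pos hlex, hF1]
    have hD := (hf.toIsGappedMap.sub (hg (n, β)).toIsGappedMap)
    have hfg : ∀ l : List C, l.length < n → f l = g (n, β) l := by
      intro l hl
      rw [← sub_eq_zero]
      refine S.eq_zero_of_word e hD.cont (n := l.length) (fun w hw' => ?_) rfl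
      refine S.ext_coeff fun E => ?_
      rw [S.coeff_zero]
      by_cases hE : E ∈ G
      · have h1 := hf.coeff_word w ⟨E, hE⟩
        have h2 := (hg (n, β)).coeff_word w ⟨E, hE⟩
        rw [if_pos (.left _ _ (by omega))] at h2
        rw [S.coeff_sub]
        exact sub_eq_zero.mpr (h1.trans h2.symm)
      · exact hD.gapped _ E hE
    have hfgβ : ∀ l, l.length = n → S.IsIntegralList l → f l - g (n, β) l ∈ S.ge β := by
      intro l hl hl'
      refine S.mem_ge_of_word e hD.cont (fun w hw' E hE' => ?_) hl hl'
      by_cases hE : E ∈ G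
      · have h1 := hf.coeff_word w ⟨E, hE⟩
        have h2 := (hg (n, β)).coeff_word w ⟨E, hE⟩
        rw [hw', if_pos (.right _ hE')] at h2
        rw [hw'] at h1
        rw [S.coeff_sub]
        exact sub_eq_zero.mpr (h1.trans h2.symm)
      · exact hD.gapped _ E hE
    -- Truncation at `(n, β)` removes the component `F (n, β)` itself, so in arity `n` and at `T ^
    -- β` the maps differ by exactly this component, whose differential was chosen to be the defect
    -- of the truncated map.
    rw [coeff_variation hb hp hG hm hm' hf.toIsGappedMap (hg (n, β)).toIsGappedMap hf1 hg1 hn hfg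
      hfgβ hul, hFE (n, β) hp1 u hu hul, sub_eq_zero]
    refine wordDiff_congr (fun w hw' => ?_) hul
    have h1 := hf.coeff_word w β
    have h2 := (hg (n, β)).coeff_word w β
    have hirr : ¬ Prod.Lex (· < ·) (· < ·) ((n : ℕ), (β : G)) (n, β) := by
      intro h
      rcases h with ⟨_, _, h⟩ | ⟨_, h⟩
      · exact lt_irrefl _ h
      · exact lt_irrefl _ h
    rw [hw', if_neg hirr] at h2
    rw [S.coeff_sub, h1, h2, hw', Pi.zero_apply, sub_zero]
  have hcritical : ∀ u : List (Finset ι), IsCritical ⊤ u → u.length = n + 1 →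
      S.coeff (defect σ m m' f (S.word e u)) β = 0 := by
    intro u hu hul
    obtain ⟨v, rfl, -, -⟩ := hu.exists_generatorWord
    have hsum := sum_defect_generatorWord hk hb hp hm hm' hf.cont hfi hfv v
    have h2 := congrArg (fun x => S.coeff x β) hsum
    simp only [S.coeff_sum, S.coeff_zero] at h2
    -- Every other rearrangement is an upper word, where the defect already vanishes. The finite set
    -- of rearrangements contains `v` once, so no factorial has to be inverted.
    rw [Finset.sum_eq_single v] at h2
    · exact h2
    · intro u' hu' hne
      rw [List.mem_toFinset, List.mem_permutations] at hu'
      refine hupper _ (isUpper_generatorWord_of_perm hu' hne hu) ?_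
      rw [← hul, generatorWord, generatorWord, List.length_map, List.length_map, hu'.length_eq]
    · intro h
      exact absurd (List.mem_toFinset.mpr (List.mem_permutations.mpr (List.Perm.refl v))) h
  -- The defect coefficient is a cocycle that vanishes on upper and critical words.
  have := eq_zero_of_wordDiff_eq_zero hb.monomial (L := fun I => s I • μ (e I))
    (R := fun I => μ.flip (e I)) (r := hb.unitEquiv) (fun x => rfl)
    (fun x => by
      rw [hb.monomial.sign_empty, LinearMap.smul_apply, hb.one_mul, neg_one_smul])
    (Ψ := fun w => if w.length = n + 1 then
        S.coeff (defect σ m m' f (S.word e w)) β else 0)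
    (fun u hu => by
      split_ifs with h
      · exact hupper u hu h
      · rfl)
    (fun u hu => by
      split_ifs with h
      · exact hcritical u hu h
      · rfl) hcocycle w
  rwa [if_pos hw] at this

/-- Two minimal antisymmetric structures with the same leading product are related by a homomorphism
whose leading linear part is the identity. -/
theorem exists_homomorphism [WellFoundedLT ι] (hk : ringChar k ≠ 2) (hN : Even N)
    (hG : ∀ x ∈ G, 0 ≤ x) (hG_finite : ∀ E : ℝ, {x : ℝ | x ∈ G ∧ x ≤ E}.Finite)
    (hb : IsExteriorBasis grbar e μ d s c) (hp : IsParity gr σ) (hσ : IsStructured S σ σbar)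
    {m m' : List C → C} (hm : IsMinimalOps gr S e G μ σ m) (hm' : IsMinimalOps gr S e G μ σ m') :
    ∃ (f : ∀ n : ℕ, MultilinearMap (Novikov k) (fun _ : Fin n => C) C)
      (g : ∀ n : ℕ, G → MultilinearMap k (fun _ : Fin n => Cbar) Cbar),
      (∀ n (α : Fin n → C), ‖f n α‖ ≤ ∏ i, ‖α i‖) ∧
      (∀ n (x : Fin n → Cbar), HasSum (fun β : G => novT k β • S.incl (g n β x))
        (f n (fun i => S.incl (x i)))) ∧
      HasDegree gr 1 (evalList f) ∧ evalList f [] = 0 ∧ unary (g 1 0) = LinearMap.id ∧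
      ∀ l, defect σ m m' (evalList f) l = 0 := by
  classical
  choose X hXn hXs using S.exists_wordExtension e hG hG_finite
  have hX : ∀ F, IsWordExtension S e F (evalList (X F)) := fun F =>
    { cont := isContMultilinear_evalList (hXn F)
      gapped := fun w => (S.coeff_evalList_wordMap e (hXs F) w).2
      coeff_word := fun w => (S.coeff_evalList_wordMap e (hXs F) w).1 }
  obtain ⟨F, hF1, hF1', hF⟩ := exists_components (S := S) hG_finite hb m m'
    (fun F => evalList (X F)) σ
  have := wellFoundedLT_of_finite hG_finite
  -- Degrees are checked along the same recursion: if the earlier components have the right degree,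
  -- so does the defect of the map they form, and the correction inherits it.
  have hmem : ∀ p w, F p w ∈ grbar (wordDegree d w + 1 - (w.length : ZMod N)) := by
    intro p
    refine (WellFounded.prod_lex (wellFounded_lt (α := ℕ)) (wellFounded_lt (α := G))).induction
      (C := fun p => ∀ w, F p w ∈ grbar (wordDegree d w + 1 - (w.length : ZMod N))) p ?_
    intro p ih
    by_cases hp1 : p = (1, 0)
    · subst hp1
      intro w
      by_cases hw : w.length = 1
      · obtain ⟨I, rfl⟩ := List.length_eq_one_iff.mp hw
        rw [hF1]
        simpa [wordDegree] using hb.mem I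
      · rw [hF1' w hw]; exact zero_mem _
    · refine (hF p hp1).2.2.2 fun u _ => ?_
      have hd : HasDegree gr 1 (evalList (X fun q =>
          if Prod.Lex (· < ·) (· < ·) q p then F q else 0)) := by
        refine (hX _).hasDegree hb fun q w => ?_
        split_ifs with hq
        · exact ih q hq w
        · exact zero_mem _
      have h1 := (hd.defect hp hm.degree hm'.degree) (S.word e u) (u.map (monomialDegree d)) (by
        rw [IsHomogeneousList, KStructure.word, List.forall₂_map_left_iff,
          List.forall₂_map_right_iff, List.forall₂_same]
        exact fun I _ => S.incl_mem_gr (hb.mem I))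
      rw [S.length_word, S.mem_gr] at h1
      exact h1 _
  have hfd := (hX F).hasDegree hb hmem
  have hE := coeff_defect_eq_zero hk hN hG hG_finite hb hp hσ hm hm' (hX F) hfd (fun p => hX _) hF1
    (fun p hp1 => (hF p hp1).1) (fun p hp1 => (hF p hp1).2.1) (fun p hp1 => (hF p hp1).2.2.1)
  have hEg : IsGappedMap S e G (defect σ m m' (evalList (X F))) :=
    IsGappedMap.defect hσ (hX F).toIsGappedMap hm.toIsGappedMap hm'.toIsGappedMap
  refine ⟨X F, fun n β => wordMap e n (F (n, β)), hXn F, hXs F, hfd,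
    (hX F).coeff_nil fun β => (hF _ (by simp)).2.1 _ (.nil _), ?_, fun l => ?_⟩
  · refine e.ext fun I => ?_
    refine (wordMap_apply e 1 (F (1, 0)) fun _ => I).trans ?_
    exact hF1 I
  · refine S.eq_zero_of_word e hEg.cont (n := l.length) (fun w hw => ?_) rfl
    rcases Nat.eq_zero_or_pos l.length with h0 | h0
    · rw [h0] at hw
      rw [List.eq_nil_of_length_eq_zero hw]
      exact hm.defect_nil hm' (hX F).cont
    · refine S.ext_coeff fun E => ?_
      rw [S.coeff_zero]
      by_cases hEG : E ∈ G
      · exact hE (l.length - 1, ⟨E, hEG⟩) w (by simp only; omega)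
      · exact hEg.gapped _ E hEG

end Construction

universe v

/-! ### The monomial basis of an exterior algebra -/

section Monomials

variable {k V ι : Type*} [Field k] [AddCommGroup V] [Module k V] [LinearOrder ι]
  (b : Module.Basis ι k V)

theorem exteriorBasis_eq_prod (I : Finset ι) :
    b.ExteriorAlgebra I = ((I.sort).map fun i => ExteriorAlgebra.ι k (b i)).prod := by
  rw [ExteriorAlgebra.basis_apply_ofCard b (s := I) rfl, ExteriorAlgebra.ιMulti_family,
    ExteriorAlgebra.ιMulti_apply, List.ofFn_eq_map]
  have h := I.listMap_orderEmbOfFin_finRange (rfl : I.card = I.card)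
  rw [← h, List.map_map]
  rfl

theorem exteriorBasis_empty : b.ExteriorAlgebra ∅ = 1 := by simp [exteriorBasis_eq_prod]

theorem exteriorBasis_singleton (i : ι) : b.ExteriorAlgebra {i} = ExteriorAlgebra.ι k (b i) := by
  simp [exteriorBasis_eq_prod]

theorem exteriorBasis_singleton_mul {j : ι} {J : Finset ι} (h : ∀ x ∈ J, j < x) :
    b.ExteriorAlgebra {j} * b.ExteriorAlgebra J = b.ExteriorAlgebra ({j} ∪ J) := by
  rw [exteriorBasis_singleton, exteriorBasis_eq_prod b ({j} ∪ J), ← Finset.insert_eq,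
    sort_insert_of_lt h, List.map_cons, List.prod_cons, ← exteriorBasis_eq_prod]

theorem exists_exteriorBasis_mul (I J : Finset ι) : ∃ a : k,
    b.ExteriorAlgebra I * b.ExteriorAlgebra J = a • b.ExteriorAlgebra (I ∪ J) ∧
      (¬ Disjoint I J → a = 0) := by
  by_cases h : Disjoint I J
  · have h1 := ExteriorAlgebra.basis_mul_of_disjoint b (Set.powersetCard.ofCard (s := I) rfl)
      (Set.powersetCard.ofCard (s := J) rfl) h
    refine ⟨(((Set.powersetCard.permOfDisjoint (s := Set.powersetCard.ofCard (s := I) rfl)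
      (t := Set.powersetCard.ofCard (s := J) rfl) h).sign : ℤ) : k), ?_, fun h' => absurd h h'⟩
    rw [Set.powersetCard.val_ofCard, Set.powersetCard.val_ofCard] at h1
    rw [h1, Int.cast_smul_eq_zsmul, Units.smul_def]
    congr 2
    exact Finset.disjUnion_eq_union I J h
  · refine ⟨0, ?_, fun _ => rfl⟩
    rw [zero_smul]
    exact ExteriorAlgebra.basis_mul_of_not_disjoint b (Set.powersetCard.ofCard (s := I) rfl)
      (Set.powersetCard.ofCard (s := J) rfl) h

theorem map_neg_exteriorBasis (I : Finset ι) :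
    ExteriorAlgebra.map (-LinearMap.id : V →ₗ[k] V) (b.ExteriorAlgebra I)
      = (-1 : k) ^ I.card • b.ExteriorAlgebra I := by
  rw [exteriorBasis_eq_prod, map_list_prod, List.map_map, ← Finset.length_sort (· ≤ ·) (s := I)]
  induction I.sort with
  | nil => simp
  | cons i t ih =>
    rw [List.map_cons, List.prod_cons, ih, List.map_cons, List.prod_cons, List.length_cons,
      pow_succ', Function.comp_apply, ExteriorAlgebra.map_apply_ι]
    simp

variable {N : ℕ} {grV : ZMod N → Submodule k V} {d : ι → ZMod N}

theorem exteriorBasis_mem (hb : ∀ i, b i ∈ grV (d i)) (I : Finset ι) :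
    b.ExteriorAlgebra I ∈ exteriorGrading grV (monomialDegree d I) := by
  refine Submodule.subset_span ⟨I.sort.map b, I.sort.map d, ?_, ?_, ?_⟩
  · rw [List.forall₂_map_left_iff, List.forall₂_map_right_iff, List.forall₂_same]
    exact fun i _ => hb i
  · rw [monomialDegree, Finset.sum_eq_multiset_sum, ← Finset.sort_eq I (· ≤ ·),
      Multiset.map_coe, Multiset.sum_coe]
  · rw [List.map_map]; exact exteriorBasis_eq_prod b I

/-- By induction on the number of factors: multiplying a monomial by a basis vector of `V` gives a
multiple of a monomial and adds the degrees. -/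
theorem exteriorGrading_le_span (hV : ∀ j, grV j ≤ Submodule.span k (b '' {x | d x = j}))
    (i : ZMod N) : exteriorGrading grV i
      ≤ Submodule.span k (b.ExteriorAlgebra '' {I | monomialDegree d I = i}) := by
  refine Submodule.span_le.mpr ?_
  rintro _ ⟨v, dl, hv, rfl, rfl⟩
  induction hv with
  | nil =>
    refine Submodule.subset_span ⟨∅, ?_, ?_⟩
    · simp [monomialDegree]
    · simp [exteriorBasis_empty]
  | @cons x j t dt hx _ ih =>
    rw [List.map_cons, List.prod_cons, List.sum_cons]
    refine Submodule.span_induction (p := fun y _ => ExteriorAlgebra.ι k y *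
      (t.map (ExteriorAlgebra.ι k)).prod ∈ Submodule.span k
        (b.ExteriorAlgebra '' {I | monomialDegree d I = j + dt.sum})) ?_ ?_ ?_ ?_ (hV j hx)
    · rintro _ ⟨y, rfl, rfl⟩
      refine Submodule.span_induction (p := fun z _ => ExteriorAlgebra.ι k (b y) * z ∈
        Submodule.span k (b.ExteriorAlgebra '' {I | monomialDegree d I = d y + dt.sum}))
        ?_ ?_ ?_ ?_ ih
      · rintro _ ⟨I, hI, rfl⟩
        obtain ⟨a, ha, ha0⟩ := exists_exteriorBasis_mul b {y} I
        rw [← exteriorBasis_singleton, ha]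
        by_cases hd : Disjoint {y} I
        · refine Submodule.smul_mem _ _ (Submodule.subset_span ⟨_, ?_, rfl⟩)
          change monomialDegree d _ = _
          rw [monomialDegree, Finset.sum_union hd, Finset.sum_singleton]
          exact congrArg _ hI
        · rw [ha0 hd, zero_smul]; exact zero_mem _
      · rw [mul_zero]; exact zero_mem _
      · intro z z' _ _ hz hz'; rw [mul_add]; exact add_mem hz hz'
      · intro a z _ hz; rw [mul_smul_comm]; exact Submodule.smul_mem _ _ hz
    · rw [map_zero, zero_mul]; exact zero_mem _
    · intro z z' _ _ hz hz'; rw [map_add, add_mul]; exact add_mem hz hz'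
    · intro a z _ hz; rw [map_smul, smul_mul_assoc]; exact Submodule.smul_mem _ _ hz

/-- A vector space concentrated in odd degrees has a well-ordered homogeneous basis. -/
theorem IsOddGrading.exists_basis {k : Type*} {V : Type v} [Field k] [AddCommGroup V] [Module k V]
    {grV : ZMod N → Submodule k V} (h : IsOddGrading grV) :
    ∃ (ι : Type v) (_ : LinearOrder ι) (_ : WellFoundedLT ι) (b : Module.Basis ι k V)
      (d : ι → ZMod N), (∀ i, b i ∈ grV (d i)) ∧ (∀ i, Odd (d i)) ∧
      ∀ j, grV j ≤ Submodule.span k (b '' {x | d x = j}) := by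
  classical
  let v := fun i => Module.Basis.ofVectorSpace k (grV i)
  let b := h.isInternal.collectedBasis v
  -- Any index set can be well-ordered. The order is unrelated to the grading and serves only the
  -- recursion on words.
  obtain ⟨o, ho⟩ := exists_wellFoundedLT (Σ i, Module.Basis.ofVectorSpaceIndex k (grV i))
  have hb : ∀ a, b a = (v a.1 a.2 : V) := fun a =>
    congrFun (h.isInternal.collectedBasis_coe v) a
  refine ⟨_, o, ho, b, Sigma.fst, fun i => ?_, fun i => ?_, fun j x hx => ?_⟩
  · exact h.isInternal.collectedBasis_mem v i
  · by_contra hodd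
    have h1 : b i ∈ grV i.1 := h.isInternal.collectedBasis_mem v i
    rw [h.eq_bot i.1 hodd, Submodule.mem_bot] at h1
    exact b.ne_zero i h1
  · have h1 : (⟨x, hx⟩ : grV j) ∈ Submodule.span k (Set.range (v j)) := by
      rw [(v j).span_eq]; trivial
    have h2 := Submodule.mem_map_of_mem (f := (grV j).subtype) h1
    rw [Submodule.map_span] at h2
    refine Submodule.span_mono ?_ h2
    rintro _ ⟨_, ⟨a, rfl⟩, rfl⟩
    exact ⟨⟨j, a⟩, rfl, hb _⟩

end Monomials

/-! ### The monomial basis of an anti-symmetric algebra -/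

section AntiSymmetricBasis

variable {k : Type*} [Field k] {N : ℕ}
  {C : Type*} [NormedAddCommGroup C] [Module (Novikov k) C]
  {Cbar : Type*} [AddCommGroup Cbar] [Module k Cbar]
  {gr : ZMod N → Submodule (Novikov k) C} {grbar : ZMod N → Submodule k Cbar}
  {S : KStructure gr grbar} {G : AddSubmonoid ℝ}

/-- A multilinear map in two variables, as a bilinear map. -/
def binary (g : MultilinearMap k (fun _ : Fin 2 => Cbar) Cbar) : Cbar →ₗ[k] Cbar →ₗ[k] Cbar :=
  LinearMap.mk₂ k (fun x y => g ![x, y]) (fun x x' y => g.cons_add ![y] x x')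
    (fun a x y => g.cons_smul ![y] a x) (fun x y y' => (g.curryLeft x).cons_add ![] y y')
    (fun a x y => (g.curryLeft x).cons_smul ![] a y)

theorem binary_apply (g : MultilinearMap k (fun _ : Fin 2 => Cbar) Cbar) (x y : Cbar) :
    binary g x y = g ![x, y] := rfl

/-- The cohomology of a vanishing differential. -/
def cohEquiv {δ : Cbar →ₗ[k] Cbar} (hδ : δ = 0) : Cbar ≃ₗ[k] Coh δ :=
  LinearEquiv.ofBijective ((cohClass δ).comp (LinearMap.codRestrict (LinearMap.ker δ) LinearMap.id
    (fun x => by rw [hδ]; rfl))) (by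
    constructor
    · rw [injective_iff_map_eq_zero]
      intro x hx
      have h1 : (⟨x, by rw [hδ]; rfl⟩ : LinearMap.ker δ)
          ∈ (LinearMap.range δ).submoduleOf (LinearMap.ker δ) :=
        (Submodule.Quotient.mk_eq_zero _).mp hx
      obtain ⟨y, hy⟩ := h1
      rw [← show δ y = x from hy, hδ]; rfl
    · intro y
      obtain ⟨⟨x, hx⟩, rfl⟩ := Submodule.mkQ_surjective _ y
      exact ⟨x, rfl⟩)

theorem cohGrading_eq_map {δ : Cbar →ₗ[k] Cbar} (hδ : δ = 0) (i : ZMod N) :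
    cohGrading grbar δ i = (grbar i).map (cohEquiv hδ : Cbar →ₗ[k] Coh δ) := by
  ext y
  constructor
  · rintro ⟨z, hz, rfl⟩
    exact ⟨z, hz, rfl⟩
  · rintro ⟨x, hx, rfl⟩
    exact ⟨⟨x, by rw [hδ]; rfl⟩, hx, rfl⟩

variable {V : Type v} [AddCommGroup V] [Module k V] {grV : ZMod N → Submodule k V}

/-- A weakly minimal anti-symmetric algebra has a basis of monomials, and its involution is the sign
of the degree. -/
theorem GappedAInfty.IsAntiSymmetric.exists_exteriorBasis (hN : Even N) {A : GappedAInfty S G}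
    {c : KInvolution S} (hA : A.IsAntiSymmetric c grV) (hmin : A.WeaklyMinimal) :
    ∃ (ι : Type v) (_ : LinearOrder ι) (_ : WellFoundedLT ι)
      (e : Module.Basis (Finset ι) k Cbar) (d : ι → ZMod N) (s : Finset ι → k)
      (ε : Finset ι → Finset ι → k), IsExteriorBasis grbar e (binary (A.comp 2 0)) d s ε ∧
      (∀ i, Odd (d i)) ∧ ∀ i, ∀ x ∈ gr i, c.c x = degSign i • x := by
  obtain ⟨ι, o, wf, b, d, hbd, hodd, hspan⟩ := hA.isOddGrading.exists_basis
  obtain ⟨Φ, hΦgr, hΦmul, hΦc⟩ := hA.exists_equiv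
  have hδ : A.diff = 0 := hmin
  have hker : ∀ x : Cbar, x ∈ LinearMap.ker A.diff := fun x => by rw [hδ]; rfl
  -- With zero differential, every element is a cocycle and cohomology is `Cbar` itself.
  let Θ : ExteriorAlgebra k V ≃ₗ[k] Cbar := Φ.trans (cohEquiv hδ).symm
  have hΘs : ∀ x, Θ.symm x = Φ.symm (cohClass A.diff ⟨x, hker x⟩) := fun x => rfl
  have hΘgr : ∀ i, (exteriorGrading grV i).map (Θ : ExteriorAlgebra k V →ₗ[k] Cbar) = grbar i := by
    intro i
    have h1 := hΦgr i
    rw [cohGrading_eq_map hδ] at h1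
    have h2 : (Θ : ExteriorAlgebra k V →ₗ[k] Cbar)
        = ((cohEquiv hδ).symm : Coh A.diff →ₗ[k] Cbar) ∘ₗ (Φ : ExteriorAlgebra k V →ₗ[k] _) := rfl
    rw [h2, Submodule.map_comp, h1, ← Submodule.map_comp]
    have h3 : ((cohEquiv hδ).symm : Coh A.diff →ₗ[k] Cbar) ∘ₗ
        (cohEquiv hδ : Cbar →ₗ[k] Coh A.diff) = LinearMap.id := by
      ext x; simp
    rw [h3, Submodule.map_id]
  let e : Module.Basis (Finset ι) k Cbar := b.ExteriorAlgebra.map Θ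
  have hes : ∀ I, Θ.symm (e I) = b.ExteriorAlgebra I := fun I => by
    simp [e]
  have hmem : ∀ I, e I ∈ grbar (monomialDegree d I) := fun I => by
    rw [← hΘgr]
    exact ⟨_, exteriorBasis_mem b hbd I, by simp [e]⟩
  have hle : ∀ i, grbar i ≤ Submodule.span k (e '' {I | monomialDegree d I = i}) := fun i => by
    rw [← hΘgr]
    refine (Submodule.map_mono (exteriorGrading_le_span b hspan i)).trans ?_
    rw [Submodule.map_span]
    refine Submodule.span_mono ?_
    rintro _ ⟨_, ⟨I, hI, rfl⟩, rfl⟩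
    exact ⟨I, hI, by simp [e]⟩
  choose a ha ha0 using exists_exteriorBasis_mul b
  have haval : ∀ I J (x : k), b.ExteriorAlgebra I * b.ExteriorAlgebra J
      = x • b.ExteriorAlgebra (I ∪ J) → a I J = x := fun I J x h => by
    have h1 := (ha I J).symm.trans h
    exact smul_left_injective k (b.ExteriorAlgebra.ne_zero (I ∪ J)) h1
  have hsgn : ∀ z : ℤ, ∀ x : Cbar, z • x = (z : k) • x := fun z x =>
    (Int.cast_smul_eq_zsmul k z x).symm
  -- The structure constants of `m_{2,0}` are those of the exterior product times the sign of the
  -- left factor, by the definition of the product of the underlying algebra.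
  have hmul : ∀ I J, binary (A.comp 2 0) (e I) (e J)
      = (((degSign (monomialDegree d I) : ℤ) : k) * a I J) • e (I ∪ J) := by
    intro I J
    let z : Cbar := degSign (monomialDegree d I) • (A.comp 2 0) ![e I, e J]
    have h1 : Θ.symm z = Θ.symm (e I) * Θ.symm (e J) :=
      hΦmul (monomialDegree d I) ⟨e I, hker _⟩ ⟨e J, hker _⟩ ⟨z, hker _⟩ (hmem I) rfl
    rw [hes, hes, ha, ← hes (I ∪ J), ← Θ.symm.map_smul, Θ.symm.injective.eq_iff] at h1
    have h2 := congrArg (fun x => degSign (monomialDegree d I) • x) h1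
    simp only [z, smul_smul, degSign_mul_self, one_smul] at h2
    rw [binary_apply, h2, hsgn, smul_smul]
  have hsu : ∀ I, (((degSign (monomialDegree d I) : ℤ) : k)) *
      ((degSign (monomialDegree d I) : ℤ) : k) = 1 := fun I => by
    rw [← Int.cast_mul, degSign_mul_self, Int.cast_one]
  have hs1 : ∀ j, degSign (monomialDegree d {j}) = -1 := fun j => by
    rw [monomialDegree, Finset.sum_singleton, degSign_odd hN (hodd j)]
  have ha1 : ∀ I, a I ∅ = 1 := fun I => haval _ _ _ (by
    rw [exteriorBasis_empty, mul_one, Finset.union_empty, one_smul])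
  refine ⟨ι, o, wf, e, d, fun I => ((degSign (monomialDegree d I + 1) : ℤ) : k), _,
    { monomial :=
        { sign_singleton := fun j => by
            rw [degSign_add hN, hs1, degSign_one hN]; simp
          sign_empty := by
            simp [monomialDegree, degSign_one hN]
          of_not_disjoint := fun I J h => by rw [ha0 I J h, mul_zero]
          empty_left := fun J => by
            rw [haval ∅ J 1 (by rw [exteriorBasis_empty, one_mul, Finset.empty_union, one_smul])]
            simp [monomialDegree, degSign_zero]
          singleton_empty := fun j => by
            rw [ha1, hs1]; simp
          isUnit := fun j J h => by
            rw [haval {j} J 1 (by rw [exteriorBasis_singleton_mul b h, one_smul]), hs1]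
            simp }
      mul := hmul
      mem := hmem
      le_span := hle
      sign := fun I => rfl
      mul_one := fun I => by
        rw [hmul, ha1, Finset.union_empty, degSign_add hN, degSign_one hN]
        simp }, hodd, ?_⟩
  -- As all generators are odd, the parity of the degree of a monomial is the parity of its number
  -- of factors. This identifies the involution induced by `-1` on `V` with the sign of the degree.
  have hcard : ∀ I : Finset ι, ((degSign (monomialDegree d I) : ℤ) : k) = (-1) ^ I.card := by
    intro I
    induction I using Finset.induction_on with
    | empty => simp [monomialDegree, degSign_zero]
    | insert j J hj ih =>
      rw [monomialDegree, Finset.sum_insert hj, degSign_add hN, degSign_odd hN (hodd j),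
        Finset.card_insert_of_notMem hj, pow_succ', ← ih]
      push_cast
      rfl
  have hcbar : ∀ I, c.cbar (e I) = ((degSign (monomialDegree d I) : ℤ) : k) • e I := by
    intro I
    have h1 : Θ.symm (c.cbar (e I)) = ExteriorAlgebra.map (-LinearMap.id) (Θ.symm (e I)) :=
      hΦc ⟨e I, hker _⟩ ⟨c.cbar (e I), hker _⟩ rfl
    rw [hes, map_neg_exteriorBasis, ← hes, ← Θ.symm.map_smul, Θ.symm.injective.eq_iff] at h1
    rw [h1, hcard]
  have hcgr : ∀ i, ∀ x ∈ grbar i, c.cbar x = degSign i • x := by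
    intro i x hx
    have h1 : Submodule.span k (e '' {I | monomialDegree d I = i})
        ≤ LinearMap.eqLocus c.cbar (((degSign i : ℤ) : k) • LinearMap.id) := by
      rw [Submodule.span_le]
      rintro _ ⟨I, rfl, rfl⟩
      exact hcbar I
    have h2 := h1 (hle i hx)
    rw [hsgn]
    exact h2
  intro i x hx
  refine S.ext_coeff fun E => ?_
  have h1 : S.coeff (c.c x) E = c.cbar (S.coeff x E) := c.coeff_c x E
  have h3 : S.coeff x E ∈ grbar i := (S.mem_gr i x).mp hx E
  rw [h1, hcgr i _ h3]
  have h2 := (AddMonoidHom.mk' (fun x => S.coeff x E)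
    (fun x y => S.coeff_add x y E)).map_zsmul (degSign i) x
  exact h2.symm

end AntiSymmetricBasis

/-! ### The operations of an anti-symmetric algebra -/

section Operations

variable {k : Type*} [Field k] {N : ℕ}
  {C : Type*} [NormedAddCommGroup C] [Module (Novikov k) C]
  {Cbar : Type*} [AddCommGroup Cbar] [Module k Cbar]
  {gr : ZMod N → Submodule (Novikov k) C} {grbar : ZMod N → Submodule k Cbar}
  {S : KStructure gr grbar} {G : AddSubmonoid ℝ}

theorem Slotwise.append_right {A W : Type*} {L : (A → W) → Prop} {φ : List A → W}
    (h : Slotwise L φ) (r : List A) : Slotwise L (fun l => φ (l ++ r)) := fun u w => by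
  simpa using h u (w ++ r)

/-- The sign in front of a term is absorbed by applying `σ` to the entries on the left of the
insertion. -/
theorem insertSum_eq_insertOp (hN : Even N) {σ : C →ₗ[Novikov k] C} (hσ : IsParity gr σ)
    {f m : ∀ n : ℕ, MultilinearMap (Novikov k) (fun _ : Fin n => C) C}
    (hf : Slotwise IsAdd (evalList f)) {α : List C} {d : List (ZMod N)}
    (h : IsHomogeneousList gr α d) :
    insertSum f m α d = insertOp σ (evalList m) (evalList f) α := by
  rw [insertOp_eq_sum]
  refine Finset.sum_congr rfl fun p _ => Finset.sum_congr rfl fun q _ => ?_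
  exact ((hf.append_right _).map_map_parity hN hσ (List.forall₂_take p h)).symm

theorem Slotwise.map_map_neg {W : Type*} [AddCommGroup W] {φ : List C → W}
    (hφ : Slotwise IsAdd φ) (l : List C) :
    φ (l.map fun x => -x) = (-1 : ℤ) ^ l.length • φ l := by
  induction l generalizing φ with
  | nil => simp
  | cons x t ih =>
    rw [List.map_cons, (hφ.head _).map_neg, ih (hφ.cons x), List.length_cons, pow_succ', mul_smul,
      neg_one_smul]

theorem degSign_even {a : ZMod N} (ha : Even a) : degSign a = 1 := by
  simp [degSign, ha]

theorem even_sum_shift {dl : List (ZMod N)} (h : ∀ i ∈ dl, Odd i) :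
    Even (dl.map (· + 1)).sum := by
  induction dl with
  | nil => simp
  | cons i t ih =>
    rw [List.map_cons, List.sum_cons]
    exact ((h i (by simp)).add_odd odd_one).add (ih fun j hj => h j (by simp [hj]))

theorem even_revExp {dl : List (ZMod N)} (h : ∀ i ∈ dl, Odd i) : Even (revExp dl) := by
  induction dl with
  | nil => simp [revExp]
  | cons i t ih =>
    exact (((h i (by simp)).add_odd odd_one).mul_right _).add (ih fun j hj => h j (by simp [hj]))

variable {ι : Type*} [LinearOrder ι] {e : Module.Basis (Finset ι) k Cbar}
  {d : ι → ZMod N} {s : Finset ι → k} {ε : Finset ι → Finset ι → k}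

theorem isHomogeneousList_word {μ : Cbar →ₗ[k] Cbar →ₗ[k] Cbar}
    (hb : IsExteriorBasis grbar e μ d s ε) (w : List (Finset ι)) :
    IsHomogeneousList gr (S.word e w) (w.map (monomialDegree d)) := by
  rw [IsHomogeneousList, KStructure.word, List.forall₂_map_left_iff, List.forall₂_map_right_iff,
    List.forall₂_same]
  exact fun I _ => S.incl_mem_gr (hb.mem I)

theorem GappedAInfty.leading (A : GappedAInfty S G) (x y : Cbar) :
    S.coeff (evalList A.m [S.incl x, S.incl y]) 0 = binary (A.comp 2 0) x y := by
  refine ((S.coeff_evalList_word A.hasSum_comp [x, y]).1 0).trans ?_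
  change A.comp 2 0 _ = A.comp 2 0 _
  congr 1
  funext i
  fin_cases i <;> rfl

theorem GappedAInfty.isGappedMap (A : GappedAInfty S G) :
    IsGappedMap S e G (evalList A.m) where
  cont := isContMultilinear_evalList A.norm_le
  gapped w := by
    have h : S.word e w = (w.map e).map S.incl := by simp [KStructure.word]
    rw [h]
    exact (S.coeff_evalList_word A.hasSum_comp _).2

/-- The operations of a weakly minimal anti-symmetric algebra. -/
theorem GappedAInfty.isMinimalOps (hk : ringChar k ≠ 2) (hN : Even N) (A : GappedAInfty S G)
    {c : KInvolution S} (hA : A.toAInfty.IsSelfDual c.c)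
    (hb : IsExteriorBasis grbar e (binary (A.comp 2 0)) d s ε) (hd : ∀ i, Odd (d i))
    (hc : ∀ i, ∀ x ∈ gr i, c.c x = degSign i • x) {σ : C →ₗ[Novikov k] C} (hσ : IsParity gr σ) :
    IsMinimalOps gr S e G (binary (A.comp 2 0)) σ (evalList A.m) := by
  have hcont := isContMultilinear_evalList A.norm_le
  have hsmul : ∀ (z : ℤ) (x : C), evalList A.m [z • x] = z • evalList A.m [x] := fun z x =>
    (AddMonoidHom.mk' (fun x => evalList A.m [x]) (hcont.isAdd.head [])).map_zsmul z x
  exact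
  { toIsGappedMap := A.isGappedMap
    -- `m_0` has degree two, so `c` fixes it, while self-duality without inputs has the sign `-1`.
    nil := by
      have h1 := hA [] [] .nil
      have h2 := A.degree [] [] .nil
      rw [AInfty.opEval, map_zsmul, List.reverse_nil, hc _ _ h2, List.map_nil] at h1
      simp only [revExp, List.sum_nil, List.length_nil, Nat.cast_zero, zero_add, sub_zero,
        degSign_one hN] at h1
      rw [← one_add_one_eq_two, degSign_add hN, degSign_mul_self, one_smul, neg_one_smul] at h1
      exact S.eq_zero_of_eq_neg hk h1
    -- With one input, self-duality has the sign `+1`, but `c` acts with opposite signs on `x` and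
    -- on `m_1 x`, whose degrees differ by one.
    single := fun x => by
      refine S.eq_zero_of_word e hcont (n := 1) (fun w hw => ?_) rfl
      obtain ⟨I, rfl⟩ := List.length_eq_one_iff.mp hw
      have hI := S.incl_mem_gr (gr := gr) (hb.mem I)
      have h1 := hA [S.incl (e I)] [_] (.cons hI .nil)
      have h2 := A.degree [S.incl (e I)] [_] (.cons hI .nil)
      rw [AInfty.opEval, map_zsmul, List.reverse_singleton, hc _ _ h2, List.map_singleton,
        hc _ _ hI, hsmul, smul_smul] at h1
      simp only [revExp, List.map_nil, List.sum_nil, List.sum_cons, mul_zero, zero_add, add_zero,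
        List.length_singleton, Nat.cast_one] at h1
      rw [degSign_add hN, degSign_mul_self, one_mul, show monomialDegree d I + 2 - 1
        = monomialDegree d I + 1 by ring, degSign_add hN, degSign_one hN, mul_neg_one,
        neg_smul] at h1
      have h3 := congrArg (fun x => degSign (monomialDegree d I) • x) (S.eq_zero_of_eq_neg hk h1)
      simp only [smul_smul, degSign_mul_self, one_smul, smul_zero] at h3
      exact h3
    degree := A.degree
    relation := fun l hl => by
      obtain ⟨dl, hdl⟩ := exists_isHomogeneousList hl
      rw [← insertSum_eq_insertOp hN hσ hcont.isAdd hdl]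
      exact A.relation _ _ hdl
    leading := A.leading
    -- On `n` odd inputs, `c` gives `(-1)^n`. The output has even degree and is fixed by `c`, the
    -- reversal exponent is even, and the remaining sign is `(-1)^(n + 1)`.
    reverse := fun v => by
      set w : List (Finset ι) := v.map fun i => {i} with hw
      have hh := isHomogeneousList_word (S := S) hb w
      set dl := w.map (monomialDegree d) with hdl
      have hodd : ∀ i ∈ dl, Odd i := by
        simp only [dl, w, List.mem_map]
        rintro _ ⟨_, ⟨i, -, rfl⟩, rfl⟩
        simpa [monomialDegree] using hd i
      have hneg : (S.word e w).map c.c = (S.word e w).map fun x => -x := by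
        refine List.map_congr_left fun x hx => ?_
        obtain ⟨I, hI, rfl⟩ := List.mem_map.mp hx
        rw [hc _ _ (S.incl_mem_gr (hb.mem I)), degSign_odd hN (hodd _ (List.mem_map_of_mem hI)),
          neg_one_smul]
      have h1 := hA _ _ hh
      have hr : IsHomogeneousList gr (S.word e w).reverse dl.reverse :=
        List.forall₂_reverse_iff.mpr hh
      have h2 := A.degree _ _ hr
      rw [AInfty.opEval, map_zsmul, hc _ _ h2, hneg, hcont.isAdd.map_map_neg, smul_smul,
        List.sum_reverse, List.length_reverse, add_sub_right_comm, degSign_add hN _ 2,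
        hh.length_eq, ← degSign_shift hN, degSign_even (even_sum_shift hodd),
        degSign_even (a := (2 : ZMod N)) even_two, mul_one, mul_one, add_assoc, degSign_add hN,
        degSign_even (even_revExp hodd), one_mul, degSign_add hN, degSign_natCast hN,
        degSign_one hN, mul_smul] at h1
      have h3 := congrArg (fun x => (-1 : ℤ) ^ dl.length • x) h1
      simp only [smul_smul, ← mul_pow, neg_mul_neg, one_mul, one_pow, one_smul, neg_smul,
        smul_neg] at h3
      rw [h3, neg_neg] }

end Operations

/-! ### The formal model -/

section FormalModel

variable {k : Type*} [Field k] {N : ℕ}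
  {C : Type*} [NormedAddCommGroup C] [Module (Novikov k) C]
  {Cbar : Type*} [AddCommGroup Cbar] [Module k Cbar]
  {gr : ZMod N → Submodule (Novikov k) C} {grbar : ZMod N → Submodule k Cbar}
  {S : KStructure gr grbar} {G : AddSubmonoid ℝ}
  {ι : Type*} [LinearOrder ι] {e : Module.Basis (Finset ι) k Cbar}
  {d : ι → ZMod N} {s : Finset ι → k} {ε : Finset ι → Finset ι → k}
  {σ : C →ₗ[Novikov k] C} {μ : Cbar →ₗ[k] Cbar →ₗ[k] Cbar}

/-- This is the relation with three inputs at exponent zero; `m_0` and `m_1` vanish, so only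
compositions of binary operations occur. -/
theorem IsMinimalOps.associative (hG : ∀ x ∈ G, 0 ≤ x)
    (hb : IsExteriorBasis grbar e μ d s ε) (hσ : IsParity gr σ) {m : List C → C}
    (hm : IsMinimalOps gr S e G μ σ m) (I J K : Finset ι) :
    μ (μ (e I) (e J)) (e K) + s I • μ (e I) (μ (e J) (e K)) = 0 := by
  have h1 := coeff_adjacentOp hb hσ hG hm hm.cont (n := 2) (β := 0)
    (fun l _ hl => hm.integral hG hl) (w := [I, J, K]) rfl
  rw [← insertOp_eq_adjacentOp hm.nil hm.single hm.cont.isAdd, hm.relation, S.coeff_zero] at h1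
  · simp only [mergeOp, KStructure.word_cons, KStructure.word_nil, smul_zero, add_zero,
      hm.leading] at h1
    simpa [hb.mul J K, hb.mul I J, smul_smul, mul_comm] using h1.symm
  · intro x hx
    obtain ⟨I, -, rfl⟩ := List.mem_map.mp hx
    exact ⟨_, S.incl_mem_gr (hb.mem I)⟩
  · intro b hb
    match b, hb with
    | [], _ => exact hm.nil
    | [x], _ => exact hm.single x
    | _ :: _ :: _, hb => simp [KStructure.word] at hb; omega

/-- Reversal antisymmetry for two generators, at exponent zero. -/
theorem IsMinimalOps.anticomm {m : List C → C} (hm : IsMinimalOps gr S e G μ σ m) (i j : ι) :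
    μ (e {j}) (e {i}) = -μ (e {i}) (e {j}) := by
  have h := congrArg (fun x => S.coeff x 0) (hm.reverse [i, j])
  simpa [KStructure.word, hm.leading] using h

/-- A function of lists that vanishes except on lists of length two, where it is the product `μ`,
has the properties of the operations of a minimal algebra, if another one has. -/
theorem IsMinimalOps.of_binary (hG : ∀ x ∈ G, 0 ≤ x)
    (hb : IsExteriorBasis grbar e μ d s ε) (hσ : IsParity gr σ)
    {σbar : Cbar →ₗ[k] Cbar} (hσbar : IsStructured S σ σbar) {m m' : List C → C}
    (hm : IsMinimalOps gr S e G μ σ m) (hcont : IsContMultilinear (k := k) m')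
    (h0 : ∀ l, l.length ≠ 2 → m' l = 0)
    (h2 : ∀ x y, m' [S.incl x, S.incl y] = S.incl (μ x y)) : IsMinimalOps gr S e G μ σ m' where
  cont := hcont
  gapped w := by
    match w with
    | [] => rw [h0 _ (by simp [KStructure.word])]; exact zero_mem _
    | [_] => rw [h0 _ (by simp [KStructure.word])]; exact zero_mem _
    | [I, J] => exact h2 (e I) (e J) ▸ S.incl_mem_gapped G _
    | _ :: _ :: _ :: _ => rw [h0 _ (by simp [KStructure.word])]; exact zero_mem _
  nil := h0 _ (by simp)
  single x := h0 _ (by simp)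
  degree := by
    refine hasDegree_of_word S hb hcont fun w => ?_
    match w with
    | [] => rw [h0 _ (by simp [KStructure.word])]; exact zero_mem _
    | [_] => rw [h0 _ (by simp [KStructure.word])]; exact zero_mem _
    | [I, J] =>
      rw [KStructure.word_cons, KStructure.word_cons, KStructure.word_nil, h2, hb.mul]
      refine S.incl_mem_gr ?_
      by_cases hIJ : Disjoint I J
      · refine Submodule.smul_mem _ _ ((congrArg (fun i => e (I ∪ J) ∈ grbar i) ?_).mp
          (hb.mem (I ∪ J)))
        rw [monomialDegree, Finset.sum_union hIJ]
        simp [wordDegree, monomialDegree]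
      · rw [hb.monomial.of_not_disjoint I J hIJ, zero_smul]; exact zero_mem _
    | _ :: _ :: _ :: _ => rw [h0 _ (by simp [KStructure.word])]; exact zero_mem _
  relation l _ := by
    refine S.eq_zero_of_word e (hcont.insertOp hσbar.isContLinear hcont) (n := l.length)
      (fun w _ => ?_) rfl
    by_cases hw : w.length = 3
    · obtain ⟨I, J, K, rfl⟩ := List.length_eq_three.mp hw
      rw [insertOp_eq_adjacentOp (h0 _ (by simp)) (fun x => h0 _ (by simp)) hcont.isAdd]
      · simp only [KStructure.word_cons, KStructure.word_nil, adjacentOp, h2, hb.parity hσ,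
          add_zero]
        rw [← S.incl_add, map_smul, LinearMap.smul_apply, hm.associative hG hb hσ, S.incl_zero]
      · intro b hb
        simp only [KStructure.length_word, List.length_cons, List.length_nil] at hb
        exact h0 _ (by omega)
    -- A nonzero term has a binary operation both inside and outside, which takes exactly three
    -- inputs.
    · refine insertOp_zero fun u v t huvt => ?_
      have hlen := congrArg List.length huvt
      simp only [List.length_append, KStructure.length_word] at hlen
      by_cases hv : v.length = 2
      · refine h0 _ ?_
        simp only [List.length_append, List.length_cons, List.length_map]
        omega
      · rw [h0 v hv]
        exact (hcont.isAdd _ _).map_zero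
  leading x y := by rw [h2, S.coeff_incl_zero]
  reverse v := by
    match v with
    | [] => simp [KStructure.word, h0]
    | [_] => simp [KStructure.word, h0]
    | [i, j] =>
      change m' [S.incl (e {j}), S.incl (e {i})] = -m' [S.incl (e {i}), S.incl (e {j})]
      rw [h2, h2, hm.anticomm, S.incl_neg]
    | _ :: _ :: _ :: _ => simp [KStructure.word, h0]

theorem IsHomogeneousList.exists_mem {α : List C} {dl : List (ZMod N)}
    (h : IsHomogeneousList gr α dl) {x : C} (hx : x ∈ α) : ∃ i, x ∈ gr i := by
  induction h with
  | nil => simp at hx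
  | cons hy _ ih =>
    rcases List.mem_cons.mp hx with rfl | hx
    · exact ⟨_, hy⟩
    · exact ih hx

theorem GappedAInfty.exists_formalModel (hN : Even N) (hG : ∀ x ∈ G, 0 ≤ x)
    (hG_finite : ∀ E : ℝ, {x : ℝ | x ∈ G ∧ x ≤ E}.Finite) (A : GappedAInfty S G)
    (hb : IsExteriorBasis grbar e (binary (A.comp 2 0)) d s ε) (hσ : IsParity gr σ)
    {σbar : Cbar →ₗ[k] Cbar} (hσbar : IsStructured S σ σbar)
    (hm : IsMinimalOps gr S e G (binary (A.comp 2 0)) σ (evalList A.m)) :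
    ∃ B : GappedAInfty S G, B.IsFormalModel A ∧ B.diff = 0 ∧
      IsMinimalOps gr S e G (binary (A.comp 2 0)) σ (evalList B.m) := by
  classical
  -- Only arity two at exponent zero is kept; the other components are zero.
  let comp : ∀ n : ℕ, G → MultilinearMap k (fun _ : Fin n => Cbar) Cbar := fun n β =>
    if n = 2 ∧ β = 0 then A.comp n β else 0
  choose m hnorm hsum using fun n => S.exists_extension hG hG_finite n (comp n)
  have hcont := isContMultilinear_evalList hnorm
  have h0 : ∀ l : List C, l.length ≠ 2 → evalList m l = 0 := fun l hl => by
    refine S.eq_zero_of_word e hcont (n := l.length) (fun w hw => S.ext_coeff fun E => ?_) rfl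
    have h : S.word e w = (w.map e).map S.incl := by simp [KStructure.word]
    obtain ⟨h1, h2⟩ := S.coeff_evalList_word hsum (w.map e)
    rw [h, S.coeff_zero]
    by_cases hE : E ∈ G
    · refine (h1 ⟨E, hE⟩).trans ?_
      have : ¬ ((w.map e).length = 2 ∧ (⟨E, hE⟩ : G) = 0) := fun h => hl (by
        rw [← hw, ← h.1, List.length_map])
      simp only [comp, if_neg this, zero_apply]
    · exact h2 E hE
  have hm2 : ∀ x : Fin 2 → Cbar, m 2 (fun i => S.incl (x i)) = S.incl (A.comp 2 0 x) := fun x => by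
    refine (hsum 2 x).unique ?_
    have h1 : S.incl (A.comp 2 0 x) = novT k ((0 : G) : ℝ) • S.incl (comp 2 0 x) := by
      refine S.ext_coeff fun E => ?_
      rw [S.coeff_novT_smul]
      simp [comp]
    rw [h1]
    refine hasSum_single 0 fun β hβ => ?_
    have : ¬ (2 = 2 ∧ β = 0) := fun h => hβ h.2
    simp only [comp, if_neg this, zero_apply, S.incl_zero, smul_zero]
  have h2 : ∀ x y, evalList m [S.incl x, S.incl y] = S.incl (binary (A.comp 2 0) x y) :=
    fun x y => by
      rw [binary_apply, ← hm2]
      change m 2 _ = m 2 _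
      congr 1
      funext i
      fin_cases i <;> rfl
  have hops := hm.of_binary hG hb hσ hσbar hcont h0 h2
  refine ⟨
    { m := m
      degree := hops.degree
      norm_le := hnorm
      norm_zero_lt := by rw [hops.nil, norm_zero]; exact one_pos
      relation := fun α dl h => by
        rw [insertSum_eq_insertOp hN hσ hcont.isAdd h]
        exact hops.relation α fun x hx => h.exists_mem hx
      comp := comp
      hasSum_comp := hsum }, ⟨fun n hn => ?_, hm2⟩, ?_, hops⟩
  · ext α
    have h := h0 (List.ofFn α) (by simpa using hn)
    rw [evalList_of_length m (List.length_ofFn (f := α))] at h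
    simpa using h
  · ext x
    simp [GappedAInfty.diff, unary, comp]

end FormalModel

/-! ### Block sums over compositions -/

section Compositions

variable {C D W : Type*} [AddCommGroup C] [AddCommGroup D] [AddCommGroup W]

/-- The finite sequences of positive integers with sum `n`. -/
def positiveLists (n : ℕ) : Finset (List ℕ) :=
  open Classical in (Finset.univ : Finset (Composition n)).image Composition.blocks

theorem mem_positiveLists {n : ℕ} {r : List ℕ} :
    r ∈ positiveLists n ↔ (∀ x ∈ r, 0 < x) ∧ r.sum = n := by
  simp only [positiveLists, Finset.mem_image, Finset.mem_univ, true_and]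
  constructor
  · rintro ⟨c, rfl⟩
    exact ⟨fun x hx => c.blocks_pos hx, c.blocks_sum⟩
  · rintro ⟨h1, h2⟩
    exact ⟨⟨r, fun {i} hi => h1 i hi, h2⟩, rfl⟩

theorem positiveLists_succ (n : ℕ) : positiveLists (n + 1) =
    open Classical in (Finset.range (n + 1)).biUnion fun q =>
      (positiveLists (n - q)).image (List.cons (q + 1)) := by
  ext r
  simp only [Finset.mem_biUnion, Finset.mem_image, Finset.mem_range, mem_positiveLists]
  constructor
  · rintro ⟨h1, h2⟩
    cases r with
    | nil => simp at h2
    | cons a r =>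
      obtain ⟨q, rfl⟩ := Nat.exists_eq_add_one.mpr (h1 a (by simp))
      rw [List.sum_cons] at h2
      exact ⟨q, by omega, r, ⟨fun x hx => h1 x (by simp [hx]), by omega⟩, rfl⟩
  · rintro ⟨q, hq, r, ⟨h1, h2⟩, rfl⟩
    refine ⟨?_, by rw [List.sum_cons]; omega⟩
    simp only [List.mem_cons, forall_eq_or_imp]
    exact ⟨by omega, h1⟩

/-- Decompositions into nonempty blocks correspond to compositions of the length; both are
enumerated by the first block. -/
theorem blockSum_eq_sum (f : List C → D) (φ : List D → W) (l : List C) :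
    blockSum f φ l = ∑ r ∈ positiveLists l.length, φ ((r.splitLengths l).map f) := by
  classical
  induction h : l.length using Nat.strong_induction_on generalizing l φ with
  | _ n ih =>
    subst h
    cases l with
    | nil =>
      have h : positiveLists 0 = {[]} := by
        ext r
        rw [mem_positiveLists, Finset.mem_singleton]
        refine ⟨fun h => ?_, by rintro rfl; simp⟩
        cases r with
        | nil => rfl
        | cons a r =>
          have h1 := h.1 a (by simp)
          have h2 := h.2
          rw [List.sum_cons] at h2
          omega
      simp [h, blockSum_nil]
    | cons x t =>
      rw [blockSum_cons, splitSum_eq_sum, List.length_cons, positiveLists_succ,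
        Finset.sum_biUnion]
      · refine Finset.sum_congr rfl fun q hq => ?_
        rw [Finset.sum_image fun _ _ _ _ h => (List.cons.inj h).2,
          ih _ (by simp only [List.length_cons, List.length_drop]; omega) _ _ rfl,
          List.length_drop]
        refine Finset.sum_congr rfl fun r _ => ?_
        simp [List.splitLengths_cons]
      · intro q _ q' _ hqq'
        rw [Function.onFun, Finset.disjoint_left]
        intro r hr hr'
        obtain ⟨u, -, rfl⟩ := Finset.mem_image.mp hr
        obtain ⟨u', -, h⟩ := Finset.mem_image.mp hr'
        have := (List.cons.inj h).1
        omega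

theorem nil_mem_splitLengths {r : List ℕ} (h : 0 ∈ r) (l : List C) : [] ∈ r.splitLengths l := by
  induction r generalizing l with
  | nil => simp at h
  | cons a r ih =>
    rw [List.splitLengths_cons]
    rcases List.mem_cons.mp h with rfl | h
    · simp
    · exact List.mem_cons_of_mem _ (ih h _)

/-- An empty block contributes `f [] = 0`, which kills its term. So the possibly infinite sum over
all lists of block lengths reduces to the finite sum over compositions. -/
theorem hasSum_blockSum [TopologicalSpace W] {f : List C → D} (hf : f [] = 0) {φ : List D → W}
    (hφ : Slotwise IsAdd φ) (l : List C) :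
    HasSum (fun r : {r : List ℕ // r.sum = l.length} => φ ((r.1.splitLengths l).map f))
      (blockSum f φ l) := by
  classical
  have h : blockSum f φ l
      = ∑ r ∈ (positiveLists l.length).subtype (fun r : List ℕ => r.sum = l.length),
        φ ((r.1.splitLengths l).map f) := by
    rw [blockSum_eq_sum,
      Finset.sum_subtype_of_mem (fun r : List ℕ => φ ((r.splitLengths l).map f))
        fun r hr => (mem_positiveLists.mp hr).2]
  rw [h]
  refine hasSum_sum_of_ne_finset_zero fun r hr => ?_
  rw [Finset.mem_subtype, mem_positiveLists] at hr
  have h0 : 0 ∈ r.1 := by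
    by_contra h0
    exact hr ⟨fun x hx => Nat.pos_of_ne_zero fun h => h0 (h ▸ hx), r.2⟩
  have h1 : (0 : D) ∈ (r.1.splitLengths l).map f :=
    List.mem_map.mpr ⟨[], nil_mem_splitLengths h0 l, hf⟩
  obtain ⟨u, w, huw⟩ := List.append_of_mem h1
  rw [huw]
  exact (hφ u w).map_zero

end Compositions

/-! ### Quasi-isomorphisms -/

section QuasiIsomorphisms

variable {k : Type*} [Field k] {N : ℕ}
  {C : Type*} [NormedAddCommGroup C] [Module (Novikov k) C]
  {Cbar : Type*} [AddCommGroup Cbar] [Module k Cbar]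
  {gr : ZMod N → Submodule (Novikov k) C} {grbar : ZMod N → Submodule k Cbar}
  {S : KStructure gr grbar} {G : AddSubmonoid ℝ}
  {ι : Type*} [LinearOrder ι] {e : Module.Basis (Finset ι) k Cbar}
  {d : ι → ZMod N} {s : Finset ι → k} {ε : Finset ι → Finset ι → k}
  {σ : C →ₗ[Novikov k] C} {σbar : Cbar →ₗ[k] Cbar} {μ : Cbar →ₗ[k] Cbar →ₗ[k] Cbar}

theorem cohMap_id_bijective {δ δ' : Cbar →ₗ[k] Cbar} (hδ : δ = δ') {f : Cbar →ₗ[k] Cbar}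
    (hf : f = LinearMap.id) (h : f ∘ₗ δ = δ' ∘ₗ f) : Function.Bijective (cohMap f h) := by
  subst hδ hf
  have h1 : ∀ y, cohMap LinearMap.id h y = y := by
    rintro ⟨y⟩
    rfl
  exact ⟨fun x y hxy => by rwa [h1, h1] at hxy, fun y => ⟨y, h1 y⟩⟩

/-- The homomorphism has leading linear part the identity, which is bijective on cohomology. The
hypotheses are symmetric in `A` and `B`, so both directions follow. -/
theorem exists_isQuasiIso [WellFoundedLT ι] (hk : ringChar k ≠ 2) (hN : Even N)
    (hG : ∀ x ∈ G, 0 ≤ x) (hG_finite : ∀ E : ℝ, {x : ℝ | x ∈ G ∧ x ≤ E}.Finite)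
    (hb : IsExteriorBasis grbar e μ d s ε) (hp : IsParity gr σ) (hσ : IsStructured S σ σbar)
    (A B : GappedAInfty S G) (hdiff : A.diff = B.diff)
    (hA : IsMinimalOps gr S e G μ σ (evalList A.m))
    (hB : IsMinimalOps gr S e G μ σ (evalList B.m)) :
    ∃ φ : GappedPreHom S S G, φ.IsQuasiIso A B := by
  obtain ⟨f, g, hnorm, hsum, hdeg, hnil, hid, hdef⟩ :=
    exists_homomorphism hk hN hG hG_finite hb hp hσ hA hB
  refine ⟨
    { f := f
      degree := hdeg
      norm_le := hnorm
      norm_zero_lt := by rw [hnil, norm_zero]; exact one_pos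
      comp := g
      hasSum_comp := hsum }, fun α dl h => ?_, ?_, cohMap_id_bijective hdiff hid _⟩
  · rw [insertSum_eq_insertOp hN hp (isContMultilinear_evalList hnorm).isAdd h,
      ← sub_eq_zero.mp (hdef α)]
    exact hasSum_blockSum hnil hB.cont.isAdd α
  · change unary (g 1 0) ∘ₗ A.diff = B.diff ∘ₗ unary (g 1 0)
    rw [hid, hdiff, LinearMap.id_comp, LinearMap.comp_id]

theorem KInvolution.isStructured_neg (c : KInvolution S) : IsStructured S (-c.c) (-c.cbar) where
  coeff_apply x E := by
    rw [LinearMap.neg_apply, LinearMap.neg_apply, S.coeff_neg]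
    exact congrArg _ (c.coeff_c x E)

end QuasiIsomorphisms

end AInf

end

theorem theorem7p9 {k : Type*} [Field k] (hk : ringChar k ≠ 2)
    {N : ℕ} (hN : Even N)
    {G : AddSubmonoid ℝ} (hG_nonneg : ∀ x ∈ G, 0 ≤ x)
    (hG_finite : ∀ E : ℝ, {x : ℝ | x ∈ G ∧ x ≤ E}.Finite)
    {C : Type*} [NormedAddCommGroup C] [Module (AInf.Novikov k) C]
    {gr : ZMod N → Submodule (AInf.Novikov k) C}
    {Cbar : Type*} [AddCommGroup Cbar] [Module k Cbar]
    {grbar : ZMod N → Submodule k Cbar}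
    {S : AInf.KStructure gr grbar}
    (A : AInf.GappedAInfty S G) (c : AInf.KInvolution S)
    {V : Type*} [AddCommGroup V] [Module k V] {grV : ZMod N → Submodule k V}
    (hA : A.IsAntiSymmetric c grV) (hmin : A.WeaklyMinimal) :
    ∃ B : AInf.GappedAInfty S G, B.IsFormalModel A ∧ A.QuasiIsomorphic B := by
  obtain ⟨ι, _, _, e, d, s, ε, hb, hd, hc⟩ := hA.exists_exteriorBasis hN hmin
  -- The involution is the sign of the degree, so `-c` is the sign of the shifted degree required of
  -- `σ`.
  have hp : AInf.IsParity gr (-c.c) := fun i x hx => by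
    rw [LinearMap.neg_apply, hc i x hx, AInf.degSign_add hN, AInf.degSign_one hN, mul_neg_one,
      neg_smul]
  have hσ := c.isStructured_neg
  have hopsA := A.isMinimalOps hk hN hA.isSelfDual hb hd hc hp
  obtain ⟨B, hB, hdiff, hopsB⟩ := A.exists_formalModel hN hG_nonneg hG_finite hb hp hσ hopsA
  have hAB : A.diff = B.diff := (show A.diff = 0 from hmin).trans hdiff.symm
  exact ⟨B, hB, AInf.exists_isQuasiIso hk hN hG_nonneg hG_finite hb hp hσ A B hAB hopsA hopsB,
    AInf.exists_isQuasiIso hk hN hG_nonneg hG_finite hb hp hσ B A hAB.symm hopsB hopsA⟩
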